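/- Fix an integer $n\ge 1$. Partitions are identified with their Young diagrams (English notation: rows are counted from the top). A skew shape is connected if any two of its cells are joined by a path of edge-adjacent cells. A ribbon is a connected skew shape with exactly $n$ cells and no $2\times 2$ square; its spin is its number of rows minus $1$, and the spin $s(T)$ of a collection $T$ of ribbons is the sum of their spins. A horizontal ribbon strip is a skew shape with a tiling by ribbons such that the cell directly above the top-right-most cell of every ribbon does not belong to the shape. A vertical ribbon strip is a skew shape with a tiling by ribbons whose conjugate (exchange of rows and columns) is a horizontal ribbon strip. A border ribbon strip of shape $\mu/\lambda$ is a chain of partitions $\lambda=\lambda^0\subset\lambda^1\subset\dots\subset\lambda^a=\mu$ with $a\ge1$ and $\mu/\lambda$ connected, together with a tiling $T_i$ of each $\lambda^i/\lambda^{i-1}$ by ribbons which makes it a non-empty horizontal ribbon strip, such that $T_1$ is connected and, for every $i\ge 2$ and every connected component $C$ of $T_i$: (1) $T_{i-1}\cup C$, with its tiling by the ribbons of $T_{i-1}$ and $C$, is not a horizontal ribbon strip; (2) for every proper subset $C'$ of the set of ribbons of $C$ such that $\lambda^{i-1}\cup C'$ is a partition, $T_{i-1}\cup C'$, with its tiling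 by the ribbons of $T_{i-1}$ and $C'$, is a horizontal ribbon strip. Its size is its total number of ribbons, its spin $s$ is the sum of the spins of all its ribbons, and its height $h$ is $\left(\sum_i \#\{\text{connected components of } T_i\}\right)-1$. For $k\ge1$ and partitions $\lambda\subseteq\mu$ put $$\mathcal K_{\mu/\lambda,k}(q)=\sum_T q^{s(T)},\qquad \mathcal L_{\mu/\lambda,k}(q)=\sum_T q^{s(T)},\qquad \mathcal X_k^{\mu/\lambda}(q)=\sum_S(-1)^{h(S)}q^{s(S)},$$ where the sums are over the tilings $T$ of $\mu/\lambda$ by $k$ ribbons that make it a horizontal ribbon strip, over those that make it a vertical ribbon strip, and over the border ribbon strips $S$ of shape $\mu/\lambda$ and size $k$, respectively. All three are $0$ if $\lambda\not\subseteq\mu$. Let $V$ be a vector space over $\mathbb C(q)$, let $(v_\lambda)$ be a family of vectors of $V$ indexed by all partitions, and let $(H_k)_{k\ge1}$, $(E_k)_{k\ge1}$, $(P_k)_{k\ge1}$ be linear operators on $V$, all commuting with each other, which satisfy every polynomial relation satisfied by the complete homogeneous, elementary and power sum symmetric functions $h_k,e_k,p_k$ in the ring of symmetric functions in infinitely many variables.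 **Theorem.** (a) If one of the following three rules holds for all $k\ge 1$ and all partitions $\lambda$, then all three hold for all $k\ge1$ and all $\lambda$: $$H_kv_\lambda=\sum_\mu \mathcal K_{\mu/\lambda,k}(q)\,v_\mu\ \text{(Pieri)},\qquad E_kv_\lambda=\sum_\mu \mathcal L_{\mu/\lambda,k}(q)\,v_\mu\ \text{(dual Pieri)},\qquad P_kv_\lambda=\sum_\mu \mathcal X_k^{\mu/\lambda}(q)\,v_\mu\ \text{(Murnaghan–Nakayama)}.$$ (b) The same holds for the lowering rules, which are obtained by replacing $\mu/\lambda$ with $\lambda/\mu$ in the coefficients: $$H_kv_\lambda=\sum_\mu \mathcal K_{\lambda/\mu,k}(q)\,v_\mu,\qquad E_kv_\lambda=\sum_\mu \mathcal L_{\lambda/\mu,k}(q)\,v_\mu,\qquad P_kv_\lambda=\sum_\mu \mathcal X_k^{\lambda/\mu}(q)\,v_\mu.$$ If one of these three holds for all $k\ge 1$ and all $\lambda$, then all three do. (Every sum over $\mu$ has finitely many non-zero coefficients.) -/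

import Mathlib

open scoped Classical

noncomputable section

namespace RibbonRules

/-! Partitions are identified with their Young diagrams (`YoungDiagram`, English notation: the
cell `(i, j)` is in row `i` and column `j`, both counted from `0`; row `0` is the northernmost). -/

/-- The cells of the skew shape `mu / lam` (meaningful when `lam ≤ mu`). -/
def skewCells (mu lam : YoungDiagram) : Finset (ℕ × ℕ) := mu.cells \ lam.cells

/-- A set of cells that is a skew shape. -/
def IsSkewShape (S : Finset (ℕ × ℕ)) : Prop :=
  ∃ lam mu : YoungDiagram, lam ≤ mu ∧ skewCells mu lam = S

/-- A (nonempty) set of cells is connected when one can pass between any two of its cells by steps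
between cells with a common edge. Two cells are related by a cover of the product order of
`ℕ × ℕ` exactly when they share an edge. -/
def IsConnectedShape (S : Finset (ℕ × ℕ)) : Prop :=
  ((SimpleGraph.hasse (ℕ × ℕ)).induce (S : Set (ℕ × ℕ))).Connected

/-- Border strips: connected skew shapes without a `2 × 2` square. -/
def IsBorderStrip (S : Finset (ℕ × ℕ)) : Prop :=
  IsSkewShape S ∧ IsConnectedShape S ∧
    ∀ i j : ℕ, ¬ (({(i, j), (i, j + 1), (i + 1, j), (i + 1, j + 1)} : Finset (ℕ × ℕ)) ⊆ S)

/-- The height of a border strip: its number of rows, minus one. -/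
def height (S : Finset (ℕ × ℕ)) : ℕ := (S.image Prod.fst).card - 1

/-- An `n`-ribbon: a border strip with `n` cells. -/
def IsRibbon (n : ℕ) (r : Finset (ℕ × ℕ)) : Prop := IsBorderStrip r ∧ r.card = n

/-- A collection of ribbons, each of them given by its set of cells. -/
abbrev RibbonSet := Finset (Finset (ℕ × ℕ))

/-- All the cells covered by a collection of ribbons. -/
def cellsOf (T : RibbonSet) : Finset (ℕ × ℕ) := T.biUnion id

/-- `T` is a tiling of `S` by `n`-ribbons. -/
def IsRibbonTiling (n : ℕ) (S : Finset (ℕ × ℕ)) (T : RibbonSet) : Prop :=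
  (∀ r ∈ T, IsRibbon n r) ∧ (T : Set (Finset (ℕ × ℕ))).PairwiseDisjoint id ∧ cellsOf T = S

/-- The spin of a collection of ribbons: the sum of the heights of the ribbons. -/
def spin (T : RibbonSet) : ℕ := ∑ r ∈ T, height r

/-- `c` is the topright-most square of the ribbon `r`. -/
def IsHead (r : Finset (ℕ × ℕ)) (c : ℕ × ℕ) : Prop :=
  c ∈ r ∧ ∀ d ∈ r, c.1 ≤ d.1 ∧ d.2 ≤ c.2

/-- The cell `c` touches the northern edge of `S`: there is no cell of `S` directly above `c`. -/
def TouchesNorth (S : Finset (ℕ × ℕ)) (c : ℕ × ℕ) : Prop :=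
  ∀ i : ℕ, c.1 = i + 1 → (i, c.2) ∉ S

/-- `T` makes `S` a horizontal `n`-ribbon strip: `S` is a skew shape tiled by the `n`-ribbons in
`T`, and the topright-most square of every ribbon touches the northern edge of `S`. -/
def IsHorizontalRibbonStrip (n : ℕ) (S : Finset (ℕ × ℕ)) (T : RibbonSet) : Prop :=
  IsSkewShape S ∧ IsRibbonTiling n S T ∧ ∀ r ∈ T, ∀ c, IsHead r c → TouchesNorth S c

/-- Conjugation (exchange of rows and columns) of a set of cells. -/
def conj (S : Finset (ℕ × ℕ)) : Finset (ℕ × ℕ) := S.image Prod.swap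

/-- `T` makes `S` a vertical `n`-ribbon strip: the conjugate is a horizontal `n`-ribbon strip. -/
def IsVerticalRibbonStrip (n : ℕ) (S : Finset (ℕ × ℕ)) (T : RibbonSet) : Prop :=
  IsHorizontalRibbonStrip n (conj S) (T.image conj)

/-- The base field `ℂ(q)`. -/
abbrev Cq := RatFunc ℂ

/-- The indeterminate `q` of `ℂ(q)`. -/
def q : Cq := RatFunc.X

/-- The spin generating function `𝒦_{mu/lam,k}(q)` of the semistandard ribbon tableaux of shape
`mu / lam` and weight `(k)`, that is, of the tilings of `mu / lam` that make it a horizontal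
`n`-ribbon strip with `k` ribbons (all filled with `1`). -/
def horizontalCoeff (n : ℕ) (mu lam : YoungDiagram) (k : ℕ) : Cq :=
  ∑ T ∈ (skewCells mu lam).powerset.powerset with
    lam ≤ mu ∧ IsHorizontalRibbonStrip n (skewCells mu lam) T ∧ T.card = k, q ^ spin T

/-- The spin generating function `ℒ_{mu/lam,k}(q)` of the column semistandard ribbon tableaux of
shape `mu / lam` and weight `(k)`. The exponent is the spin of the tableau itself, not the spin of
its conjugate. -/
def verticalCoeff (n : ℕ) (mu lam : YoungDiagram) (k : ℕ) : Cq :=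
  ∑ T ∈ (skewCells mu lam).powerset.powerset with
    lam ≤ mu ∧ IsVerticalRibbonStrip n (skewCells mu lam) T ∧ T.card = k, q ^ spin T

/-- `C` is (the set of ribbons of) a connected component of the shape tiled by `T`. -/
def IsComponent (T C : RibbonSet) : Prop :=
  C ⊆ T ∧ IsConnectedShape (cellsOf C) ∧
    ∀ D ⊆ T, C ⊆ D → IsConnectedShape (cellsOf D) → D = C

/-- The number of connected components of the shape tiled by `T`. -/
def numComponents (T : RibbonSet) : ℕ := (T.powerset.filter (IsComponent T)).card

/-- `C` touches `T` from below: the union of `C` and `T`, with its tiling by the ribbons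
of `C` and `T`, is not a horizontal ribbon strip. -/
def TouchesFromBelow (n : ℕ) (T C : RibbonSet) : Prop :=
  ¬ IsHorizontalRibbonStrip n (cellsOf (T ∪ C)) (T ∪ C)

/-- The condition on a component `C` of a part of a border ribbon strip. Here `T` is the preceding
part, and `nu` is the partition reached after adding `T`: the component `C` touches `T` from
below, and no proper part `C'` of `C` that can be added to `nu` touches `T` from below. -/
def IsAttached (n : ℕ) (nu : YoungDiagram) (T C : RibbonSet) : Prop :=
  TouchesFromBelow n T C ∧
    ∀ C' ⊂ C, IsLowerSet ((nu.cells ∪ cellsOf C' : Finset (ℕ × ℕ)) : Set (ℕ × ℕ)) →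
      ¬ TouchesFromBelow n T C'

/-- `BorderChain n lam mu [Tₐ, …, T₁]` (last part first) says that `T₁, …, Tₐ` (`a ≥ 1`) are
nonempty horizontal `n`-ribbon strips that are added one after the other to `lam` and lead to `mu`,
all intermediate shapes being partitions, that `T₁` is connected, and that for `i ≥ 2` every
connected component of `Tᵢ` is attached to `Tᵢ₋₁`. -/
inductive BorderChain (n : ℕ) (lam : YoungDiagram) : YoungDiagram → List RibbonSet → Prop
  | single (mu : YoungDiagram) (T : RibbonSet) (hle : lam ≤ mu) (hne : T.Nonempty)
      (hT : IsHorizontalRibbonStrip n (skewCells mu lam) T)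
      (hconn : IsConnectedShape (cellsOf T)) : BorderChain n lam mu [T]
  | extend (nu mu : YoungDiagram) (T T' : RibbonSet) (L : List RibbonSet)
      (hL : BorderChain n lam nu (T' :: L)) (hle : nu ≤ mu) (hne : T.Nonempty)
      (hT : IsHorizontalRibbonStrip n (skewCells mu nu) T)
      (hatt : ∀ C, IsComponent T C → IsAttached n nu T' C) : BorderChain n lam mu (T :: T' :: L)

/-- A border ribbon strip of shape `mu / lam` (given by the list of its parts, last part first). -/
def IsBorderRibbonStrip (n : ℕ) (mu lam : YoungDiagram) (L : List RibbonSet) : Prop :=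
  IsConnectedShape (skewCells mu lam) ∧ BorderChain n lam mu L

/-- The size of a border ribbon strip: its total number of ribbons. -/
def stripSize (L : List RibbonSet) : ℕ := (L.map Finset.card).sum

/-- The height of a border ribbon strip: the total number of components of its parts, minus `1`. -/
def stripHeight (L : List RibbonSet) : ℕ := (L.map numComponents).sum - 1

/-- The spin of a border ribbon strip. -/
def stripSpin (L : List RibbonSet) : ℕ := (L.map spin).sum

/-- `𝒳_k^{mu/lam}(q)`, the sum of `(-1)^height q^spin` over all the border ribbon strips of shape
`mu / lam` and size `k` (finitely many, as their parts are disjoint, nonempty sets of subsets of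
`mu / lam`). -/
def borderCoeff (n : ℕ) (mu lam : YoungDiagram) (k : ℕ) : Cq :=
  ∑ᶠ (L : List RibbonSet) (_ : IsBorderRibbonStrip n mu lam L ∧ stripSize L = k),
    (-1 : Cq) ^ stripHeight L * q ^ stripSpin L

section Rules

variable {V : Type*} [AddCommGroup V] [Module Cq V]

/-- `A_k v_lam = ∑_mu c(mu, lam, k) v_mu` for all `k ≥ 1` and all `lam`. For the coefficients used
below only finitely many `mu` contribute (those with `|mu| = |lam| + nk`). -/
def Raises (c : YoungDiagram → YoungDiagram → ℕ → Cq) (v : YoungDiagram → V)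
    (A : ℕ+ → Module.End Cq V) : Prop :=
  ∀ (k : ℕ+) (lam : YoungDiagram), A k (v lam) = ∑ᶠ mu : YoungDiagram, c mu lam k • v mu

/-- `A_k v_lam = ∑_mu c(lam, mu, k) v_mu` for all `k ≥ 1` and all `lam`: the lowering version. -/
def Lowers (c : YoungDiagram → YoungDiagram → ℕ → Cq) (v : YoungDiagram → V)
    (A : ℕ+ → Module.End Cq V) : Prop :=
  ∀ (k : ℕ+) (lam : YoungDiagram), A k (v lam) = ∑ᶠ mu : YoungDiagram, c lam mu k • v mu

/-- The ribbon Pieri rule holds for `H`. -/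
def PieriRule (n : ℕ) (v : YoungDiagram → V) (H : ℕ+ → Module.End Cq V) : Prop :=
  Raises (horizontalCoeff n) v H

/-- The ribbon dual-Pieri rule holds for `E`. -/
def DualPieriRule (n : ℕ) (v : YoungDiagram → V) (E : ℕ+ → Module.End Cq V) : Prop :=
  Raises (verticalCoeff n) v E

/-- The ribbon Murnaghan–Nakayama rule holds for `P`. -/
def MurnaghanNakayamaRule (n : ℕ) (v : YoungDiagram → V) (P : ℕ+ → Module.End Cq V) : Prop :=
  Raises (borderCoeff n) v P

/-- The lowering ribbon Pieri rule holds for `H`. -/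
def LoweringPieriRule (n : ℕ) (v : YoungDiagram → V) (H : ℕ+ → Module.End Cq V) : Prop :=
  Lowers (horizontalCoeff n) v H

/-- The lowering ribbon dual-Pieri rule holds for `E`. -/
def LoweringDualPieriRule (n : ℕ) (v : YoungDiagram → V) (E : ℕ+ → Module.End Cq V) : Prop :=
  Lowers (verticalCoeff n) v E

/-- The lowering ribbon Murnaghan–Nakayama rule holds for `P`. -/
def LoweringMurnaghanNakayamaRule (n : ℕ) (v : YoungDiagram → V)
    (P : ℕ+ → Module.End Cq V) : Prop :=
  Lowers (borderCoeff n) v P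

end Rules

/-- A family indexed by the letters `h₁, h₂, …`, `e₁, e₂, …`, `p₁, p₂, …`. -/
def letters {A : Type*} (h e p : ℕ+ → A) : ℕ+ ⊕ (ℕ+ ⊕ ℕ+) → A := Sum.elim h (Sum.elim e p)

/-- The polynomial expression `f` in the letters `h_i`, `e_i`, `p_i` is a relation between the
complete homogeneous, elementary and power sum symmetric functions in `Λ(q)`. An identity holds
in the ring of symmetric functions in infinitely many variables if and only if it holds in `N`
variables for every `N`. -/
def IsRelation (f : FreeAlgebra Cq (ℕ+ ⊕ (ℕ+ ⊕ ℕ+))) : Prop :=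
  ∀ N : ℕ, FreeAlgebra.lift Cq (letters
    (fun i => MvPolynomial.hsymm (Fin N) Cq i)
    (fun i => MvPolynomial.esymm (Fin N) Cq i)
    (fun i => MvPolynomial.psum (Fin N) Cq i)) f = 0

/-- The operators `H_i`, `E_i`, `P_i` commute with each other and satisfy all the relations that
hold between the symmetric functions `h_i`, `e_i`, `p_i`. -/
structure SatisfiesRelations {V : Type*} [AddCommGroup V] [Module Cq V]
    (H E P : ℕ+ → Module.End Cq V) : Prop where
  commute : ∀ a b, Commute (letters H E P a) (letters H E P b)
  relation : ∀ f, IsRelation f → FreeAlgebra.lift Cq (letters H E P) f = 0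

end RibbonRules

end

/-!
Newton's identities `k h_k = ∑_{i=1}^k p_i h_{k-i}` and the relations `∑_i (-1)^i e_i h_{k-i} = 0`
(`k ≥ 1`) determine any of the families `h`, `e`, `p` by any other one (`mem_iff_of_newton`,
`mem_iff_of_alternating`). The three rules are therefore equivalent as soon as the coefficients
`𝒦`, `ℒ`, `𝒳` satisfy the same two families of identities as matrices indexed by partitions. This
is the content of `natCast_mul_horizontalCoeff` and `sum_verticalCoeff_mul_horizontalCoeff`. The
same matrix identities serve for raising and lowering, where the factors appear in opposite orders,
since the operators commute.

Both identities are proved on bead configurations. The rim of a partition is a lattice path; its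
vertical steps are beads placed on `ℤ` (`rim`, `bead`), and adding an `n`-ribbon with smallest
content `a` moves a bead from `a` to `a + n`. A horizontal ribbon strip is a set `A` of positions
whose beads are moved from left to right (`HStrip`,
`IsHorizontalRibbonStrip.exists_hStrip`, `HStrip.isHorizontalRibbonStrip`), and its ribbons are
recovered from `A`. A vertical strip is a set of positions moved from right to left (`VStrip`).

For a horizontal strip `A`, the connected components are the runs of elements of `A` with gaps of
at most `n` (`IsAddable.isComponent_iff`). A ribbon at `c` touches a preceding strip `A'` from
below if and only if `A'` has an element in `(c, c + n]`
(`HStrip.touchesFromBelow_iff`), so all the components of `A` are attached to `A'` exactly when the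
ends of the runs of `A` are its elements with this property (`HStrip.isAttached_iff_isJoined`).
A horizontal strip is the same thing as an initial part of it followed by a strip
that does not touch this part from below (`HStrip.union`, `HStrip.split`), and the spins add up.

Newton's identity follows by telescoping. For a fixed horizontal strip `D`, the signed sum over the
initial parts of `D` which are joined to `A'` vanishes, unless `D` does not touch `A'`: the run that
leads to the first element of `D` that touches `A'` can be added to or removed from the initial part
(`sum_neg_one_pow_ends`). Hence the horizontal strips after a border ribbon strip `L`, together with
those after all the extensions of `L` by a further part, only leave the horizontal strips that do
not touch the last part of `L`. Summing over `L`, only border ribbon strips with a single part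
survive. These are connected initial parts of horizontal strips with `k` ribbons, and each such
strip has `k` of them, one for each possible last ribbon (`card_initial_of_card_ends_eq_one`).

For the relation between `ℒ` and `𝒦`, consider a vertical strip followed by a horizontal one. The
smallest position of the two strips belongs to only one of them and can be moved to the other one
(`VStrip.insert_min`, `VStrip.erase_min`). This changes the sign and keeps the total spin
(`totalSpin_insert`), which is an explicit function of the positions (`vspin_add_spin`).
-/

noncomputable section

namespace RibbonRules

/-! ### The rim of a partition -/

/-- The content of a cell: the index of its diagonal. -/
def content (x : ℕ × ℕ) : ℤ := x.2 - x.1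

/-- The cell in row `r` on the diagonal of content `c` (meaningful when `0 ≤ r` and `0 ≤ r + c`). -/
def cellAt (c r : ℤ) : ℕ × ℕ := (r.toNat, (r + c).toNat)

lemma content_cellAt {c r : ℤ} (h : 0 ≤ r) (h' : 0 ≤ r + c) : content (cellAt c r) = c := by
  simp only [content, cellAt]; omega

lemma fst_cellAt {c r : ℤ} (h : 0 ≤ r) : ((cellAt c r).1 : ℤ) = r := by
  simp only [cellAt]; omega

lemma snd_cellAt {c r : ℤ} (h' : 0 ≤ r + c) : ((cellAt c r).2 : ℤ) = r + c := by
  simp only [cellAt]; omega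

lemma cell_ext {x y : ℕ × ℕ} (h : content x = content y) (h' : (x.1 : ℤ) = y.1) : x = y := by
  simp only [content] at h
  ext <;> omega

lemma cellAt_content (x : ℕ × ℕ) : cellAt (content x) x.1 = x := by
  ext <;> simp [cellAt, content]

lemma exists_notMem_diagonal (lam : YoungDiagram) (c : ℤ) :
    ∃ t : ℕ, (t + (-c).toNat, t + c.toNat) ∉ lam := by
  obtain ⟨j, hj⟩ := lam.exists_notMem_row (-c).toNat
  exact ⟨j, fun h => hj (lam.up_left_mem (by omega) (by omega) h)⟩

/-- The rim of a partition: `rim lam c` is the row of the first cell of the diagonal of content `c`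
that does not belong to `lam`. -/
def rim (lam : YoungDiagram) (c : ℤ) : ℤ :=
  (Nat.find (exists_notMem_diagonal lam c) + (-c).toNat : ℕ)

lemma rim_nonneg (lam : YoungDiagram) (c : ℤ) : 0 ≤ rim lam c := by
  unfold rim; positivity

lemma rim_add_nonneg (lam : YoungDiagram) (c : ℤ) : 0 ≤ rim lam c + c := by
  unfold rim; push_cast; omega

lemma mem_iff_lt_rim {lam : YoungDiagram} {x : ℕ × ℕ} :
    x ∈ lam ↔ (x.1 : ℤ) < rim lam (content x) := by
  generalize hc : content x = c
  obtain ⟨i, j⟩ := x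
  obtain ⟨t, hi, hj⟩ : ∃ t : ℕ, i = t + (-c).toNat ∧ j = t + c.toNat := by
    simp only [content] at hc
    exact ⟨i - (-c).toNat, by omega, by omega⟩
  clear hc
  subst hi hj
  simp only [rim]
  rw [Nat.cast_lt, add_lt_add_iff_right, Nat.lt_find_iff]
  constructor
  · intro h m hm
    rw [not_not]
    exact lam.up_left_mem (by omega) (by omega) h
  · intro h
    simpa using h t le_rfl

/-- Whether the rim has a vertical step between the diagonals of contents `p - 1` and `p`
(`1`, a bead at `p`) or a horizontal one (`0`, no bead at `p`). -/
def bead (lam : YoungDiagram) (p : ℤ) : ℤ := rim lam (p - 1) - rim lam p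

lemma bead_eq_zero_or_one (lam : YoungDiagram) (p : ℤ) : bead lam p = 0 ∨ bead lam p = 1 := by
  have h1 := rim_nonneg lam p
  have h2 := rim_add_nonneg lam p
  have h3 := rim_nonneg lam (p - 1)
  have h4 := rim_add_nonneg lam (p - 1)
  have key1 : rim lam (p - 1) ≤ rim lam p + 1 := by
    by_contra! h
    have : (((rim lam p).toNat + 1, (rim lam p + p).toNat) : ℕ × ℕ) ∈ lam := by
      rw [mem_iff_lt_rim]
      have : content ((rim lam p).toNat + 1, (rim lam p + p).toNat) = p - 1 := by
        simp only [content]; omega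
      rw [this]; push_cast; omega
    have h' : (((rim lam p).toNat, (rim lam p + p).toNat) : ℕ × ℕ) ∈ lam :=
      lam.up_left_mem (by omega) le_rfl this
    rw [mem_iff_lt_rim] at h'
    have : content ((rim lam p).toNat, (rim lam p + p).toNat) = p := by
      simp only [content]; omega
    rw [this] at h'; omega
  have key2 : rim lam p ≤ rim lam (p - 1) := by
    by_contra! h
    have : (((rim lam (p - 1)).toNat, (rim lam (p - 1) + p).toNat) : ℕ × ℕ) ∈ lam := by
      rw [mem_iff_lt_rim]
      have : content ((rim lam (p - 1)).toNat, (rim lam (p - 1) + p).toNat) = p := by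
        simp only [content]; omega
      rw [this]; push_cast; omega
    have h' : (((rim lam (p - 1)).toNat, (rim lam (p - 1) + p - 1).toNat) : ℕ × ℕ) ∈ lam :=
      lam.up_left_mem le_rfl (by omega) this
    rw [mem_iff_lt_rim] at h'
    have : content ((rim lam (p - 1)).toNat, (rim lam (p - 1) + p - 1).toNat) = p - 1 := by
      simp only [content]; omega
    rw [this] at h'; omega
  unfold bead; omega

lemma le_iff_rim_le {lam mu : YoungDiagram} : lam ≤ mu ↔ ∀ c, rim lam c ≤ rim mu c := by
  constructor
  · intro h c
    by_contra! hlt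
    have h1 := rim_nonneg mu c
    have h2 := rim_add_nonneg mu c
    have hm : cellAt c (rim mu c) ∈ lam := by
      rw [mem_iff_lt_rim, content_cellAt h1 h2, fst_cellAt h1]; exact hlt
    have := h hm
    rw [mem_iff_lt_rim, content_cellAt h1 h2, fst_cellAt h1] at this
    exact lt_irrefl _ this
  · intro h x hx
    rw [mem_iff_lt_rim] at hx ⊢
    exact hx.trans_le (h _)

lemma ext_rim {lam mu : YoungDiagram} (h : ∀ c, rim lam c = rim mu c) : lam = mu :=
  le_antisymm (le_iff_rim_le.2 fun c => (h c).le) (le_iff_rim_le.2 fun c => (h c).ge)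

/-- The rim of a partition is characterized by the membership of cells. -/
lemma rim_eq_of_mem_iff {lam : YoungDiagram} {f : ℤ → ℤ} (h0 : ∀ c, 0 ≤ f c)
    (h0' : ∀ c, 0 ≤ f c + c) (h : ∀ x : ℕ × ℕ, x ∈ lam ↔ (x.1 : ℤ) < f (content x)) (c : ℤ) :
    rim lam c = f c := by
  have h1 := rim_nonneg lam c
  have h2 := rim_add_nonneg lam c
  apply le_antisymm
  · by_contra! hlt
    have := (h (cellAt c (f c))).1 (by
      rw [mem_iff_lt_rim, content_cellAt (h0 c) (h0' c), fst_cellAt (h0 c)]; exact hlt)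
    rw [content_cellAt (h0 c) (h0' c), fst_cellAt (h0 c)] at this
    exact lt_irrefl _ this
  · by_contra! hlt
    have := (h (cellAt c (rim lam c))).2 (by
      rw [content_cellAt h1 h2, fst_cellAt h1]; exact hlt)
    rw [mem_iff_lt_rim, content_cellAt h1 h2, fst_cellAt h1] at this
    exact lt_irrefl _ this

/-- A function with steps `0` and `-1` that lies above the rim of a partition and agrees with it
outside a finite set of contents is the rim of a partition. -/
lemma exists_rim_eq (lam : YoungDiagram) (f : ℤ → ℤ) (s : Finset ℤ)
    (hs : ∀ c ∉ s, f c = rim lam c) (hle : ∀ c, rim lam c ≤ f c)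
    (hstep : ∀ c, f (c - 1) - f c = 0 ∨ f (c - 1) - f c = 1) :
    ∃ mu : YoungDiagram, ∀ c, rim mu c = f c := by
  have h0 : ∀ c, 0 ≤ f c := fun c => (rim_nonneg lam c).trans (hle c)
  have h0' : ∀ c, 0 ≤ f c + c := fun c =>
    (rim_add_nonneg lam c).trans (by have := hle c; omega)
  have hfin : {x : ℕ × ℕ | (x.1 : ℤ) < f (content x)}.Finite := by
    refine (lam.cells.finite_toSet.union
      (s.biUnion fun c => (Finset.range (f c).toNat).image fun i : ℕ =>
        cellAt c i).finite_toSet).subset ?_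
    intro x hx
    by_cases hc : content x ∈ s
    · right
      simp only [Finset.coe_biUnion, Set.mem_iUnion, Finset.mem_coe, Finset.mem_image,
        Finset.mem_range]
      refine ⟨content x, hc, x.1, ?_, cellAt_content x⟩
      simp only [Set.mem_ofPred_eq] at hx
      omega
    · left
      simp only [Set.mem_ofPred_eq, hs _ hc] at hx
      rw [← mem_iff_lt_rim] at hx
      simpa using hx
  -- moving one step up or to the left keeps a cell strictly above `f`
  have hanti : ∀ (k : ℕ) (c : ℤ), f c ≤ f (c - k) ∧ f (c - k) ≤ f c + k := by
    intro k
    induction k with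
    | zero => intro c; simp
    | succ k ih =>
      intro c
      have h1 := ih c
      have h2 := hstep (c - k)
      have h3 : c - ((k + 1 : ℕ) : ℤ) = c - k - 1 := by push_cast; ring
      rw [h3]; push_cast; omega
  have hlow : IsLowerSet {x : ℕ × ℕ | (x.1 : ℤ) < f (content x)} := by
    rintro ⟨i, j⟩ ⟨i', j'⟩ ⟨hi, hj⟩ hx
    simp only [Set.mem_ofPred_eq, content] at hx hi hj ⊢
    have h1 := (hanti (j - j') ((j : ℤ) - i)).1
    have h2 := (hanti (i - i') ((j' : ℤ) - i')).2
    have e1 : (j : ℤ) - i - ((j - j' : ℕ) : ℤ) = j' - i := by omega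
    have e2 : (j' : ℤ) - i' - ((i - i' : ℕ) : ℤ) = j' - i := by omega
    rw [e1] at h1; rw [e2] at h2
    omega
  refine ⟨⟨hfin.toFinset, by simpa using hlow⟩, rim_eq_of_mem_iff h0 h0' fun x => ?_⟩
  rw [← YoungDiagram.mem_cells]
  simp

lemma rim_transpose (lam : YoungDiagram) (c : ℤ) : rim lam.transpose c = rim lam (-c) - c := by
  refine rim_eq_of_mem_iff (f := fun c => rim lam (-c) - c) (fun c => ?_) (fun c => ?_)
    (fun x => ?_) c
  · have := rim_add_nonneg lam (-c); omega
  · have := rim_nonneg lam (-c); omega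
  · rw [YoungDiagram.mem_transpose, mem_iff_lt_rim]
    have : content x.swap = - content x := by simp [content]
    rw [this]
    simp only [content, Prod.fst_swap]
    omega

lemma bead_transpose (lam : YoungDiagram) (p : ℤ) :
    bead lam.transpose p = 1 - bead lam (1 - p) := by
  have e1 : -(p - 1) = 1 - p := by ring
  have e2 : 1 - p - 1 = -p := by ring
  simp only [bead, rim_transpose, e1, e2]
  omega

lemma mem_skewCells {mu lam : YoungDiagram} {x : ℕ × ℕ} :
    x ∈ skewCells mu lam ↔ rim lam (content x) ≤ x.1 ∧ (x.1 : ℤ) < rim mu (content x) := by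
  rw [skewCells, Finset.mem_sdiff, YoungDiagram.mem_cells, YoungDiagram.mem_cells,
    mem_iff_lt_rim, mem_iff_lt_rim, not_lt]
  tauto

/-! ### Connected sets of cells -/

lemma hasse_adj_iff {x y : ℕ × ℕ} : (SimpleGraph.hasse (ℕ × ℕ)).Adj x y ↔
    (x.1 = y.1 ∧ (x.2 + 1 = y.2 ∨ y.2 + 1 = x.2)) ∨
      (x.2 = y.2 ∧ (x.1 + 1 = y.1 ∨ y.1 + 1 = x.1)) := by
  rw [SimpleGraph.hasse_adj, Prod.covBy_iff, Prod.covBy_iff]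
  simp only [Nat.covBy_iff_add_one_eq]
  omega

/-- A set of cells is connected when a property that passes from cells to neighbours holds
everywhere as soon as it holds somewhere. -/
lemma isConnectedShape_iff {S : Finset (ℕ × ℕ)} : IsConnectedShape S ↔
    S.Nonempty ∧ ∀ P : ℕ × ℕ → Prop, (∃ x ∈ S, P x) →
      (∀ x ∈ S, ∀ y ∈ S, (SimpleGraph.hasse (ℕ × ℕ)).Adj x y → P x → P y) → ∀ y ∈ S, P y := by
  constructor
  · intro h
    obtain ⟨hpre, ⟨x₀⟩⟩ := SimpleGraph.connected_iff _ |>.1 h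
    refine ⟨⟨x₀.1, x₀.2⟩, ?_⟩
    rintro P ⟨x, hx, hPx⟩ hcl y hy
    by_contra hPy
    obtain ⟨w⟩ := hpre ⟨x, hx⟩ ⟨y, hy⟩
    obtain ⟨d, -, h1, h2⟩ := w.exists_boundary_dart {z | P z.1} hPx hPy
    exact h2 (hcl _ d.fst.2 _ d.snd.2 d.adj h1)
  · rintro ⟨⟨x₀, hx₀⟩, h⟩
    have : Nonempty ((S : Set (ℕ × ℕ)) : Type) := ⟨⟨x₀, hx₀⟩⟩
    refine SimpleGraph.Connected.mk ?_
    rintro ⟨x, hx⟩ ⟨y, hy⟩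
    have := h (fun z => ∃ hz : z ∈ S,
      ((SimpleGraph.hasse (ℕ × ℕ)).induce (S : Set (ℕ × ℕ))).Reachable ⟨x, hx⟩ ⟨z, hz⟩)
      ⟨x, hx, hx, SimpleGraph.Reachable.refl _⟩ ?_ y hy
    · exact this.2
    · rintro a ha b hb hab ⟨_, hr⟩
      refine ⟨hb, hr.trans (SimpleGraph.Adj.reachable ?_)⟩
      exact hab

/-- The rows met by the function `f` on an interval, when `f` decreases by steps of at most `1`. -/
lemma card_image_of_steps (f : ℤ → ℤ) (a : ℤ) (m : ℕ)
    (h : ∀ c, a < c → c ≤ a + m → f (c - 1) - f c = 0 ∨ f (c - 1) - f c = 1) :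
    (((Finset.Icc a (a + m)).image f).card : ℤ) = f a - f (a + m) + 1 ∧
      (Finset.Icc a (a + m)).image f = Finset.Icc (f (a + m)) (f a) := by
  have key : (Finset.Icc a (a + m)).image f = Finset.Icc (f (a + m)) (f a) ∧
      f (a + m) ≤ f a := by
    induction m with
    | zero => simp
    | succ m ih =>
      obtain ⟨ih, hle⟩ := ih fun c h1 h2 => h c h1 (by push_cast; omega)
      have hs := h (a + (m + 1 : ℕ)) (by push_cast; omega) le_rfl
      have e : a + ((m + 1 : ℕ) : ℤ) - 1 = a + m := by push_cast; ring
      rw [e] at hs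
      have hI : Finset.Icc a (a + ((m + 1 : ℕ) : ℤ)) =
          insert (a + ((m + 1 : ℕ) : ℤ)) (Finset.Icc a (a + (m : ℤ))) := by
        ext c; simp only [Finset.mem_Icc, Finset.mem_insert]; push_cast; omega
      rw [hI, Finset.image_insert, ih]
      refine ⟨?_, by omega⟩
      ext c; simp only [Finset.mem_Icc, Finset.mem_insert]; omega
  refine ⟨?_, key.1⟩
  rw [key.1, Int.card_Icc]
  have := key.2
  omega

/-! ### Horizontal strips of ribbons as sets of contents -/

/-- The number of intervals `[a, a + n)`, `a ∈ A`, that contain `c`. -/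
def cov (n : ℕ) (A : Finset ℤ) (c : ℤ) : ℤ := (A.filter fun a => a ≤ c ∧ c < a + n).card

lemma cov_eq_sum (n : ℕ) (A : Finset ℤ) (c : ℤ) :
    cov n A c = ∑ a ∈ A, if a ≤ c ∧ c < a + n then 1 else 0 := by
  simp [cov]

lemma cov_nonneg (n : ℕ) (A : Finset ℤ) (c : ℤ) : 0 ≤ cov n A c := by
  unfold cov; positivity

@[simp] lemma cov_empty (n : ℕ) (c : ℤ) : cov n ∅ c = 0 := by simp [cov]

lemma cov_union {n : ℕ} {A B : Finset ℤ} (h : Disjoint A B) (c : ℤ) :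
    cov n (A ∪ B) c = cov n A c + cov n B c := by
  simp only [cov_eq_sum, Finset.sum_union h]

lemma cov_insert {n : ℕ} {A : Finset ℤ} {a : ℤ} (h : a ∉ A) (c : ℤ) :
    cov n (insert a A) c = (if a ≤ c ∧ c < a + n then 1 else 0) + cov n A c := by
  simp only [cov_eq_sum, Finset.sum_insert h]

lemma cov_step {n : ℕ} (hn : 1 ≤ n) (A : Finset ℤ) (c : ℤ) :
    cov n A (c - 1) - cov n A c =
      (if c - n ∈ A then 1 else 0) - (if c ∈ A then 1 else 0) := by
  rw [← Finset.sum_ite_eq' A c fun _ => (1 : ℤ), ← Finset.sum_ite_eq' A (c - n) fun _ => (1 : ℤ),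
    cov_eq_sum, cov_eq_sum, ← Finset.sum_sub_distrib, ← Finset.sum_sub_distrib]
  refine Finset.sum_congr rfl fun a _ => ?_
  split_ifs <;> omega

lemma cov_congr {n : ℕ} {A B : Finset ℤ} {c : ℤ}
    (h : ∀ a, a ≤ c → c < a + n → (a ∈ A ↔ a ∈ B)) : cov n A c = cov n B c := by
  unfold cov
  congr 2
  ext a
  simp only [Finset.mem_filter]
  constructor
  · rintro ⟨h1, h2, h3⟩; exact ⟨(h a h2 h3).1 h1, h2, h3⟩
  · rintro ⟨h1, h2, h3⟩; exact ⟨(h a h2 h3).2 h1, h2, h3⟩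

lemma cov_mono {n : ℕ} {A B : Finset ℤ} {c : ℤ} (h : A ⊆ B) : cov n A c ≤ cov n B c := by
  unfold cov
  exact_mod_cast Finset.card_le_card (Finset.filter_subset_filter _ h)

lemma cov_lt_cov {n : ℕ} {A B : Finset ℤ} {c a : ℤ} (h : A ⊆ B) (ha : a ∈ B) (ha' : a ∉ A)
    (h1 : a ≤ c) (h2 : c < a + n) : cov n A c < cov n B c := by
  have := cov_mono (n := n) (c := c) (Finset.insert_subset ha h)
  rw [cov_insert ha', if_pos ⟨h1, h2⟩] at this
  omega

/-- The beads at the positions in `A` can be moved `n` places to the right, one after the other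
from left to right. -/
def IsAddable (n : ℕ) (lam : YoungDiagram) (A : Finset ℤ) : Prop :=
  ∀ a ∈ A, bead lam (a + n) = 0 ∧ (bead lam a = 1 ∨ a - n ∈ A)

/-- `mu` is obtained from `lam` by moving the beads at the positions in `A` from left to right,
that is, by adding ribbons with the contents `a, …, a + n - 1`, for each `a ∈ A`. -/
def HStrip (n : ℕ) (lam : YoungDiagram) (A : Finset ℤ) (mu : YoungDiagram) : Prop :=
  IsAddable n lam A ∧ ∀ c, rim mu c = rim lam c + cov n A c

lemma bead_eq_of_rim {n : ℕ} (hn : 1 ≤ n) {lam mu : YoungDiagram} {A : Finset ℤ}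
    (h : ∀ c, rim mu c = rim lam c + cov n A c) (p : ℤ) :
    bead mu p = bead lam p + (if p - n ∈ A then 1 else 0) - (if p ∈ A then 1 else 0) := by
  have := cov_step hn A p
  simp only [bead, h] at *
  omega

lemma HStrip.bead_eq {n : ℕ} (hn : 1 ≤ n) {lam mu : YoungDiagram} {A : Finset ℤ}
    (h : HStrip n lam A mu) (p : ℤ) :
    bead mu p = bead lam p + (if p - n ∈ A then 1 else 0) - (if p ∈ A then 1 else 0) :=
  bead_eq_of_rim hn h.2 p

lemma HStrip.le {n : ℕ} {lam mu : YoungDiagram} {A : Finset ℤ} (h : HStrip n lam A mu) :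
    lam ≤ mu :=
  le_iff_rim_le.2 fun c => by have := cov_nonneg n A c; have := h.2 c; omega

lemma HStrip.eq {n : ℕ} {lam mu nu : YoungDiagram} {A : Finset ℤ} (h : HStrip n lam A mu)
    (h' : HStrip n lam A nu) : mu = nu :=
  ext_rim fun c => (h.2 c).trans (h'.2 c).symm

/-- A set of contents whose prescribed bead moves give beads in each place at most once leads to
a partition. -/
lemma exists_rim_eq_add_cov {n : ℕ} (hn : 1 ≤ n) {lam : YoungDiagram} {A : Finset ℤ}
    (h : ∀ p, 0 ≤ bead lam p + (if p - n ∈ A then 1 else 0) - (if p ∈ A then 1 else 0) ∧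
      bead lam p + (if p - n ∈ A then 1 else 0) - (if p ∈ A then 1 else 0) ≤ 1) :
    ∃ mu, ∀ c, rim mu c = rim lam c + cov n A c := by
  refine exists_rim_eq lam _ (A.biUnion fun a => Finset.Ico a (a + n)) ?_ ?_ ?_
  · intro c hc
    have : cov n A c = cov n ∅ c := cov_congr fun a h1 h2 => by
      simp only [Finset.mem_biUnion, Finset.mem_Ico, not_exists, not_and] at hc
      simp only [Finset.notMem_empty, iff_false]
      exact fun ha => hc a ha h1 h2
    rw [this, cov_empty, add_zero]
  · intro c; have := cov_nonneg n A c; omega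
  · intro c
    have h1 := cov_step hn A c
    have h2 := h c
    simp only [bead] at h2
    omega

lemma IsAddable.exists_hStrip {n : ℕ} (hn : 1 ≤ n) {lam : YoungDiagram} {A : Finset ℤ}
    (h : IsAddable n lam A) : ∃ mu, HStrip n lam A mu := by
  obtain ⟨mu, hmu⟩ := exists_rim_eq_add_cov hn (lam := lam) (A := A) fun p => by
    have hb := bead_eq_zero_or_one lam p
    have h1 := h p
    have h2 := h (p - n)
    rw [sub_add_cancel] at h2
    split_ifs <;> simp_all
    all_goals omega
  exact ⟨mu, h, hmu⟩

/-! ### Initial parts of a strip -/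

/-- `A` is an initial part of `D`: with each element it contains all the elements of `D` at
distance at most `n` to the left. -/
def IsInitial (n : ℕ) (D A : Finset ℤ) : Prop :=
  A ⊆ D ∧ ∀ a ∈ A, ∀ b ∈ D, a - n ≤ b → b < a → b ∈ A

lemma isInitial_filter_lt (n : ℕ) (D : Finset ℤ) (a : ℤ) : IsInitial n D (D.filter (· < a)) :=
  ⟨Finset.filter_subset _ _, fun x hx b hb _ h => by
    simp only [Finset.mem_filter] at *; exact ⟨hb, h.trans hx.2⟩⟩

lemma isInitial_filter_le (n : ℕ) (D : Finset ℤ) (a : ℤ) : IsInitial n D (D.filter (· ≤ a)) :=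
  ⟨Finset.filter_subset _ _, fun x hx b hb _ h => by
    simp only [Finset.mem_filter] at *; exact ⟨hb, h.le.trans hx.2⟩⟩

lemma IsAddable.of_isInitial {n : ℕ} (hn : 1 ≤ n) {lam : YoungDiagram} {D A : Finset ℤ}
    (h : IsAddable n lam D) (hA : IsInitial n D A) : IsAddable n lam A := fun a ha => by
  obtain ⟨h1, h2⟩ := h a (hA.1 ha)
  exact ⟨h1, h2.imp_right fun h3 => hA.2 a ha _ h3 le_rfl (by omega)⟩

/-! ### The ribbons of a strip -/

/-- The rows of the cells of the ribbon at `a` in the horizontal strip `A` on `lam`. -/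
def tileRim (n : ℕ) (lam : YoungDiagram) (A : Finset ℤ) (a c : ℤ) : ℤ :=
  rim lam c + cov n (A.filter (· < a)) c

/-- The ribbon with contents `a, …, a + n - 1` in the horizontal strip `A` on `lam`: it lies below
the ribbons at smaller positions of `A`. -/
def tile (n : ℕ) (lam : YoungDiagram) (A : Finset ℤ) (a : ℤ) : Finset (ℕ × ℕ) :=
  (Finset.Ico a (a + n)).image fun c => cellAt c (tileRim n lam A a c)

/-- The ribbons of the horizontal strip `A` on `lam`. -/
def tiles (n : ℕ) (lam : YoungDiagram) (A : Finset ℤ) : RibbonSet := A.image (tile n lam A)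

lemma rim_le_tileRim (n : ℕ) (lam : YoungDiagram) (A : Finset ℤ) (a c : ℤ) :
    rim lam c ≤ tileRim n lam A a c := by
  have := cov_nonneg n (A.filter (· < a)) c
  unfold tileRim; omega

lemma tileRim_nonneg (n : ℕ) (lam : YoungDiagram) (A : Finset ℤ) (a c : ℤ) :
    0 ≤ tileRim n lam A a c ∧ 0 ≤ tileRim n lam A a c + c := by
  have := rim_le_tileRim n lam A a c
  have := rim_nonneg lam c
  have := rim_add_nonneg lam c
  omega

lemma mem_tile {n : ℕ} {lam : YoungDiagram} {A : Finset ℤ} {a : ℤ} {x : ℕ × ℕ} :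
    x ∈ tile n lam A a ↔
      a ≤ content x ∧ content x < a + n ∧ (x.1 : ℤ) = tileRim n lam A a (content x) := by
  simp only [tile, Finset.mem_image, Finset.mem_Ico]
  constructor
  · rintro ⟨c, ⟨h1, h2⟩, rfl⟩
    obtain ⟨h3, h4⟩ := tileRim_nonneg n lam A a c
    rw [content_cellAt h3 h4, fst_cellAt h3]
    exact ⟨h1, h2, rfl⟩
  · rintro ⟨h1, h2, h3⟩
    exact ⟨content x, ⟨h1, h2⟩, by rw [← h3, cellAt_content]⟩

lemma cellAt_mem_tile {n : ℕ} {lam : YoungDiagram} {A : Finset ℤ} {a c : ℤ} (h1 : a ≤ c)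
    (h2 : c < a + n) : cellAt c (tileRim n lam A a c) ∈ tile n lam A a := by
  simp only [tile, Finset.mem_image, Finset.mem_Ico]
  exact ⟨c, ⟨h1, h2⟩, rfl⟩

lemma tile_nonempty {n : ℕ} (hn : 1 ≤ n) (lam : YoungDiagram) (A : Finset ℤ) (a : ℤ) :
    (tile n lam A a).Nonempty :=
  ⟨_, cellAt_mem_tile le_rfl (by omega)⟩

lemma tile_injective {n : ℕ} (hn : 1 ≤ n) {lam lam' : YoungDiagram} {A A' : Finset ℤ} {a a' : ℤ}
    (h : tile n lam A a = tile n lam' A' a') : a = a' := by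
  have h1 := cellAt_mem_tile (n := n) (lam := lam) (A := A) (le_refl a) (by omega)
  have h2 := cellAt_mem_tile (n := n) (lam := lam') (A := A') (le_refl a') (by omega)
  rw [h, mem_tile, content_cellAt (tileRim_nonneg ..).1 (tileRim_nonneg ..).2] at h1
  rw [← h, mem_tile, content_cellAt (tileRim_nonneg ..).1 (tileRim_nonneg ..).2] at h2
  exact le_antisymm h2.1 h1.1

lemma card_tiles {n : ℕ} (hn : 1 ≤ n) (lam : YoungDiagram) (A : Finset ℤ) :
    (tiles n lam A).card = A.card :=
  Finset.card_image_of_injective _ fun _ _ => tile_injective hn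

lemma tiles_injective {n : ℕ} (hn : 1 ≤ n) {lam lam' : YoungDiagram} {A A' : Finset ℤ}
    (h : tiles n lam A = tiles n lam' A') : A = A' := by
  ext a
  constructor
  · intro ha
    have : tile n lam A a ∈ tiles n lam' A' := h ▸ Finset.mem_image_of_mem _ ha
    obtain ⟨a', ha', e⟩ := Finset.mem_image.1 this
    exact tile_injective hn e ▸ ha'
  · intro ha
    have : tile n lam' A' a ∈ tiles n lam A := h ▸ Finset.mem_image_of_mem _ ha
    obtain ⟨a', ha', e⟩ := Finset.mem_image.1 this
    exact tile_injective hn e ▸ ha'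

lemma tile_congr {n : ℕ} {lam lam' : YoungDiagram} {A A' : Finset ℤ} {a : ℤ}
    (h : ∀ c, a ≤ c → c < a + n → tileRim n lam A a c = tileRim n lam' A' a c) :
    tile n lam A a = tile n lam' A' a := by
  ext x
  simp only [mem_tile]
  constructor
  · rintro ⟨h1, h2, h3⟩; exact ⟨h1, h2, h3.trans (h _ h1 h2)⟩
  · rintro ⟨h1, h2, h3⟩; exact ⟨h1, h2, h3.trans (h _ h1 h2).symm⟩

lemma tile_of_isInitial {n : ℕ} {D A : Finset ℤ} (hA : IsInitial n D A) (lam : YoungDiagram)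
    {a : ℤ} (ha : a ∈ A) : tile n lam A a = tile n lam D a := by
  refine tile_congr fun c h1 h2 => ?_
  unfold tileRim
  congr 1
  refine cov_congr fun b h3 h4 => ?_
  simp only [Finset.mem_filter]
  exact and_congr_left fun hb => ⟨fun h => hA.1 h, fun h => hA.2 a ha b h (by omega) hb⟩

lemma tiles_of_isInitial {n : ℕ} {D A : Finset ℤ} (hA : IsInitial n D A) (lam : YoungDiagram) :
    tiles n lam A = A.image (tile n lam D) :=
  Finset.image_congr fun _ ha => tile_of_isInitial hA lam ha

lemma IsAddable.exists_tileRim {n : ℕ} (hn : 1 ≤ n) {lam : YoungDiagram} {A : Finset ℤ}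
    (h : IsAddable n lam A) (a : ℤ) :
    ∃ kap : YoungDiagram, HStrip n lam (A.filter (· < a)) kap ∧
      ∀ c, tileRim n lam A a c = rim kap c := by
  obtain ⟨kap, hkap⟩ := (h.of_isInitial hn (isInitial_filter_lt n A a)).exists_hStrip hn
  exact ⟨kap, hkap, fun c => (hkap.2 c).symm⟩

lemma IsAddable.tileRim_step {n : ℕ} (hn : 1 ≤ n) {lam : YoungDiagram} {A : Finset ℤ}
    (h : IsAddable n lam A) (a c : ℤ) :
    tileRim n lam A a (c - 1) - tileRim n lam A a c = 0 ∨
      tileRim n lam A a (c - 1) - tileRim n lam A a c = 1 := by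
  obtain ⟨kap, -, hk⟩ := h.exists_tileRim hn a
  rw [hk, hk]
  exact bead_eq_zero_or_one kap c

/-- Consecutive cells of a rim are neighbours. -/
lemma hasse_adj_cellAt {c r r' : ℤ} (h : 0 ≤ r) (h' : 0 ≤ r + c) (h1 : 0 ≤ r')
    (h2 : 0 ≤ r' + (c + 1))
    (hs : r - r' = 0 ∨ r - r' = 1) :
    (SimpleGraph.hasse (ℕ × ℕ)).Adj (cellAt c r) (cellAt (c + 1) r') := by
  rw [hasse_adj_iff]; simp only [cellAt]; omega

/-- A property of cells that passes to neighbours passes along a ribbon. -/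
lemma IsAddable.tile_induction {n : ℕ} (hn : 1 ≤ n) {lam : YoungDiagram} {A : Finset ℤ}
    (h : IsAddable n lam A) {a : ℤ} {P : ℕ × ℕ → Prop}
    (hP : ∀ x ∈ tile n lam A a, ∀ y ∈ tile n lam A a,
      (SimpleGraph.hasse (ℕ × ℕ)).Adj x y → P x → P y)
    (hx : ∃ x ∈ tile n lam A a, P x) : ∀ y ∈ tile n lam A a, P y := by
  set u : ℤ → ℕ × ℕ := fun c => cellAt c (tileRim n lam A a c) with hu
  have hadj : ∀ c, (SimpleGraph.hasse (ℕ × ℕ)).Adj (u c) (u (c + 1)) := fun c => by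
    have := h.tileRim_step hn a (c + 1)
    rw [add_sub_cancel_right] at this
    exact hasse_adj_cellAt (tileRim_nonneg ..).1 (tileRim_nonneg ..).2 (tileRim_nonneg ..).1
      (tileRim_nonneg ..).2 this
  have hmem : ∀ {c}, a ≤ c → c < a + n → u c ∈ tile n lam A a := fun h1 h2 =>
    cellAt_mem_tile h1 h2
  have hcell : ∀ x ∈ tile n lam A a, x = u (content x) := fun x hx => by
    rw [hu]; simp only; rw [← (mem_tile.1 hx).2.2, cellAt_content]
  obtain ⟨x, hx, hPx⟩ := hx
  have hup : ∀ k : ℕ, content x + k < a + n → P (u (content x + k)) := by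
    intro k
    induction k with
    | zero => intro _; rw [Nat.cast_zero, add_zero, ← hcell x hx]; exact hPx
    | succ k ih =>
      intro hk
      have := (mem_tile.1 hx).1
      push_cast at hk ⊢
      rw [← add_assoc]
      exact hP _ (hmem (by omega) (by omega)) _ (hmem (by omega) (by omega)) (hadj _)
        (ih (by omega))
  have hdown : ∀ k : ℕ, a ≤ content x - k → P (u (content x - k)) := by
    intro k
    induction k with
    | zero => intro _; rw [Nat.cast_zero, sub_zero, ← hcell x hx]; exact hPx
    | succ k ih =>
      intro hk
      have := (mem_tile.1 hx).2.1
      push_cast at hk ⊢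
      have e := hadj (content x - (k + 1))
      rw [show content x - ((k : ℤ) + 1) + 1 = content x - k by ring] at e
      exact hP _ (hmem (by omega) (by omega)) _ (hmem (by omega) (by omega)) e.symm
        (ih (by omega))
  intro y hy
  rw [hcell y hy]
  obtain ⟨h1, h2, -⟩ := mem_tile.1 hy
  rcases le_total (content x) (content y) with hle | hle
  · have := hup (content y - content x).toNat (by omega)
    rwa [show content x + ((content y - content x).toNat : ℤ) = content y by omega] at this
  · have := hdown (content x - content y).toNat (by omega)
    rwa [show content x - ((content x - content y).toNat : ℤ) = content y by omega] at this

lemma IsAddable.isRibbon_tile {n : ℕ} (hn : 1 ≤ n) {lam : YoungDiagram} {A : Finset ℤ}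
    (h : IsAddable n lam A) {a : ℤ} (ha : a ∈ A) : IsRibbon n (tile n lam A a) := by
  refine ⟨⟨?_, ?_, ?_⟩, ?_⟩
  · obtain ⟨kap, hkap⟩ := (h.of_isInitial hn (isInitial_filter_lt n A a)).exists_hStrip hn
    obtain ⟨kap', hkap'⟩ := (h.of_isInitial hn (isInitial_filter_le n A a)).exists_hStrip hn
    have hins : A.filter (· ≤ a) = insert a (A.filter (· < a)) := by
      ext x; simp only [Finset.mem_filter, Finset.mem_insert]
      constructor
      · rintro ⟨h1, h2⟩
        rcases h2.lt_or_eq with h3 | h3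
        · exact Or.inr ⟨h1, h3⟩
        · exact Or.inl h3
      · rintro (rfl | ⟨h1, h2⟩)
        · exact ⟨ha, le_rfl⟩
        · exact ⟨h1, h2.le⟩
    have hrim : ∀ c, rim kap' c = rim kap c + if a ≤ c ∧ c < a + n then 1 else 0 := fun c => by
      rw [hkap'.2, hkap.2, hins, cov_insert (by simp)]; ring
    refine ⟨kap, kap', le_iff_rim_le.2 fun c => ?_, ?_⟩
    · rw [hrim]; split_ifs <;> omega
    · ext x
      rw [mem_skewCells, mem_tile, tileRim, ← hkap.2, hrim]
      split_ifs <;> omega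
  · refine isConnectedShape_iff.2 ⟨tile_nonempty hn _ _ _, fun P hx hP => ?_⟩
    exact h.tile_induction hn hP hx
  · intro i j hsub
    have h1 := (mem_tile.1 (hsub (by simp : (i, j) ∈ _))).2.2
    have h2 := (mem_tile.1 (hsub (by simp : (i + 1, j + 1) ∈ _))).2.2
    have e : content (i + 1, j + 1) = content (i, j) := by simp [content]
    rw [e, ← h1] at h2
    simp at h2
  · rw [tile, Finset.card_image_of_injOn, Int.card_Ico]
    · simp
    · intro c _ c' _ hcc
      have := congrArg content hcc
      simpa only [content_cellAt (tileRim_nonneg ..).1 (tileRim_nonneg ..).2] using this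

lemma tileRim_lt_tileRim {n : ℕ} {lam : YoungDiagram} {A : Finset ℤ} {a b c : ℤ} (ha : a ∈ A)
    (hab : a < b) (h1 : a ≤ c) (h2 : c < a + n) :
    tileRim n lam A a c < tileRim n lam A b c := by
  unfold tileRim
  have : cov n (A.filter (· < a)) c < cov n (A.filter (· < b)) c := by
    refine cov_lt_cov (a := a) ?_ (by simp [ha, hab]) (by simp) h1 h2
    intro x; simp only [Finset.mem_filter]; exact fun hx => ⟨hx.1, hx.2.trans hab⟩
  omega

lemma disjoint_tile {n : ℕ} {lam : YoungDiagram} {A : Finset ℤ} {a b : ℤ} (ha : a ∈ A)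
    (hb : b ∈ A) (hab : a ≠ b) : Disjoint (tile n lam A a) (tile n lam A b) := by
  rw [Finset.disjoint_left]
  intro x hx hx'
  rw [mem_tile] at hx hx'
  rcases lt_or_gt_of_ne hab with h | h
  · have := tileRim_lt_tileRim (n := n) (lam := lam) ha h hx.1 hx.2.1
    omega
  · have := tileRim_lt_tileRim (n := n) (lam := lam) hb h hx'.1 hx'.2.1
    omega

/-- In a finite set of integers with more than `k` elements some element has exactly `k`
predecessors. -/
lemma exists_card_filter_lt_eq (F : Finset ℤ) {k : ℕ} (hk : k < F.card) :
    ∃ a ∈ F, (F.filter (· < a)).card = k := by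
  have hlt : ∀ a ∈ F, ∀ b, a < b → (F.filter (· < a)).card < (F.filter (· < b)).card :=
    fun a ha b hab => Finset.card_lt_card <| (Finset.ssubset_iff_of_subset
      fun x hx => by simp only [Finset.mem_filter] at *; exact ⟨hx.1, hx.2.trans hab⟩).2
        ⟨a, by simp [ha, hab], by simp⟩
  have := Finset.surjOn_of_injOn_of_card_le (s := F) (t := Finset.range F.card)
    (fun a => (F.filter (· < a)).card)
    (fun a ha => by
      simp only [Finset.coe_range, Set.mem_Iio]
      exact Finset.card_lt_card <| (Finset.ssubset_iff_of_subset (Finset.filter_subset _ _)).2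
        ⟨a, ha, by simp⟩)
    (fun a ha b hb hab => by
      by_contra hne
      rcases lt_or_gt_of_ne hne with h | h
      · have := hlt a ha b h; simp only at hab; omega
      · have := hlt b hb a h; simp only at hab; omega) (by simp)
  obtain ⟨a, ha, h⟩ := this (by simpa using hk : k ∈ _)
  exact ⟨a, ha, h⟩

lemma mem_cellsOf {T : RibbonSet} {x : ℕ × ℕ} : x ∈ cellsOf T ↔ ∃ r ∈ T, x ∈ r := by
  simp [cellsOf]

lemma mem_cellsOf_image {A : Finset ℤ} {f : ℤ → Finset (ℕ × ℕ)} {x : ℕ × ℕ} :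
    x ∈ cellsOf (A.image f) ↔ ∃ a ∈ A, x ∈ f a := by
  simp [cellsOf]

lemma HStrip.cellsOf_tiles {n : ℕ} {lam mu : YoungDiagram} {A : Finset ℤ}
    (h : HStrip n lam A mu) : cellsOf (tiles n lam A) = skewCells mu lam := by
  ext x
  rw [tiles, mem_cellsOf_image, mem_skewCells, h.2]
  have hcov : ∀ a, cov n (A.filter (· < a)) (content x) =
      (((A.filter fun a => a ≤ content x ∧ content x < a + n).filter (· < a)).card : ℤ) := by
    intro a; rw [cov, Finset.filter_filter, Finset.filter_filter]; congr 2
    ext b; simp only [Finset.mem_filter]; tauto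
  constructor
  · rintro ⟨a, ha, hx⟩
    obtain ⟨h1, h2, h3⟩ := mem_tile.1 hx
    refine ⟨h3 ▸ rim_le_tileRim .., ?_⟩
    rw [h3, tileRim]
    have := cov_lt_cov (n := n) (c := content x) (Finset.filter_subset (· < a) A) ha (by simp)
      h1 h2
    omega
  · rintro ⟨h1, h2⟩
    obtain ⟨a, ha, hk⟩ := exists_card_filter_lt_eq
      (A.filter fun a => a ≤ content x ∧ content x < a + n)
      (k := ((x.1 : ℤ) - rim lam (content x)).toNat) (by unfold cov at h2; omega)
    rw [Finset.mem_filter] at ha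
    refine ⟨a, ha.1, mem_tile.2 ⟨ha.2.1, ha.2.2, ?_⟩⟩
    rw [tileRim, hcov, hk]; omega

lemma isHead_iff_of_tile {n : ℕ} (hn : 1 ≤ n) {lam : YoungDiagram} {A : Finset ℤ} {a : ℤ}
    {x : ℕ × ℕ} (h : IsHead (tile n lam A a) x) : content x = a + n - 1 := by
  obtain ⟨h1, h2⟩ := h
  have h3 := h2 _ (cellAt_mem_tile (c := a + n - 1) (by omega) (by omega))
  have h4 := tileRim_nonneg n lam A a (a + n - 1)
  have h5 := fst_cellAt (c := a + n - 1) h4.1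
  have h6 := snd_cellAt (c := a + n - 1) h4.2
  have h7 := (mem_tile.1 h1).2.1
  simp only [content] at *
  omega

/-- No ribbon at a smaller position reaches the last content of the ribbon at `a`. -/
lemma tileRim_last (n : ℕ) (lam : YoungDiagram) (A : Finset ℤ) {a c : ℤ} (hc : a + n - 1 ≤ c) :
    tileRim n lam A a c = rim lam c := by
  rw [tileRim, cov_congr (B := ∅), cov_empty, add_zero]
  intro b h1 h2
  simp only [Finset.mem_filter, Finset.notMem_empty, iff_false, not_and]
  omega

/-- The bead moves of an admissible set of positions describe a horizontal ribbon strip. -/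
theorem HStrip.isHorizontalRibbonStrip {n : ℕ} (hn : 1 ≤ n) {lam mu : YoungDiagram}
    {A : Finset ℤ} (h : HStrip n lam A mu) :
    IsHorizontalRibbonStrip n (skewCells mu lam) (tiles n lam A) := by
  refine ⟨⟨lam, mu, h.le, rfl⟩, ⟨?_, ?_, h.cellsOf_tiles⟩, ?_⟩
  · intro r hr
    obtain ⟨a, ha, rfl⟩ := Finset.mem_image.1 hr
    exact h.1.isRibbon_tile hn ha
  · intro r hr s hs hrs
    obtain ⟨a, ha, rfl⟩ := Finset.mem_image.1 hr
    obtain ⟨b, hb, rfl⟩ := Finset.mem_image.1 hs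
    exact disjoint_tile ha hb fun hab => hrs (by rw [hab])
  · intro r hr x hx i hi hmem
    obtain ⟨a, ha, rfl⟩ := Finset.mem_image.1 hr
    have hc := isHead_iff_of_tile hn hx
    have hrow := (mem_tile.1 hx.1).2.2
    rw [hc, tileRim_last n lam A le_rfl] at hrow
    rw [mem_skewCells] at hmem
    have e : content (i, x.2) = a + n := by simp only [content] at *; omega
    rw [e] at hmem
    have hb := (h.1 a ha).1
    rw [bead] at hb
    omega

/-- The height of a ribbon is the number of vertical steps of the rim below which it is added. -/
lemma IsAddable.height_tile {n : ℕ} (hn : 1 ≤ n) {lam : YoungDiagram} {A : Finset ℤ}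
    (h : IsAddable n lam A) (a : ℤ) :
    (height (tile n lam A a) : ℤ) = tileRim n lam A a a - rim lam (a + n - 1) := by
  obtain ⟨m, rfl⟩ : ∃ m, n = m + 1 := ⟨n - 1, by omega⟩
  have hI : (Finset.Ico a (a + ((m + 1 : ℕ) : ℤ))) = Finset.Icc a (a + m) := by
    ext c; simp only [Finset.mem_Ico, Finset.mem_Icc]; push_cast; omega
  have h1 : ((tile (m + 1) lam A a).image Prod.fst).image (fun i : ℕ => (i : ℤ)) =
      (Finset.Icc a (a + m)).image (tileRim (m + 1) lam A a) := by
    rw [tile, hI, Finset.image_image, Finset.image_image]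
    refine Finset.image_congr fun c _ => ?_
    exact fst_cellAt (tileRim_nonneg ..).1
  have h2 := card_image_of_steps (tileRim (m + 1) lam A a) a m fun c _ _ => h.tileRim_step hn a c
  rw [← h1, Finset.card_image_of_injective _ Nat.cast_injective] at h2
  have h3 : a + ((m + 1 : ℕ) : ℤ) - 1 = a + m := by push_cast; ring
  have h4 := tileRim_last (m + 1) lam A (a := a) h3.le
  rw [h3, height, ← h4]
  have hpos : 0 < ((tile (m + 1) lam A a).image Prod.fst).card :=
    Finset.card_pos.2 ((tile_nonempty hn ..).image _)
  have := h2.1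
  omega

lemma spin_tiles {n : ℕ} (hn : 1 ≤ n) (lam : YoungDiagram) (A : Finset ℤ) :
    spin (tiles n lam A) = ∑ a ∈ A, height (tile n lam A a) :=
  Finset.sum_image fun _ _ _ _ => tile_injective hn

/-! ### Every horizontal ribbon strip comes from bead moves -/

/-- The smallest content of a set of cells (`0` for the empty set). -/
def pos (r : Finset (ℕ × ℕ)) : ℤ :=
  if h : (r.image content).Nonempty then (r.image content).min' h else 0

lemma pos_eq {r : Finset (ℕ × ℕ)} {p : ℤ} (h1 : ∃ x ∈ r, content x = p)
    (h2 : ∀ x ∈ r, p ≤ content x) : pos r = p := by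
  obtain ⟨x, hx, hxp⟩ := h1
  have hne : (r.image content).Nonempty := ⟨_, Finset.mem_image_of_mem _ hx⟩
  rw [pos, dif_pos hne]
  apply le_antisymm
  · rw [← hxp]; exact Finset.min'_le _ _ (Finset.mem_image_of_mem _ hx)
  · refine Finset.le_min' _ _ _ fun y hy => ?_
    obtain ⟨z, hz, rfl⟩ := Finset.mem_image.1 hy
    exact h2 z hz

lemma pos_tile {n : ℕ} (hn : 1 ≤ n) (lam : YoungDiagram) (A : Finset ℤ) (a : ℤ) :
    pos (tile n lam A a) = a :=
  pos_eq ⟨_, cellAt_mem_tile le_rfl (by omega),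
    content_cellAt (tileRim_nonneg ..).1 (tileRim_nonneg ..).2⟩ fun _ hx => (mem_tile.1 hx).1

lemma image_pos_tiles {n : ℕ} (hn : 1 ≤ n) (lam : YoungDiagram) (A : Finset ℤ) :
    (tiles n lam A).image pos = A := by
  rw [tiles, Finset.image_image]
  have : pos ∘ tile n lam A = id := funext (pos_tile hn lam A)
  rw [this, Finset.image_id]

lemma IsSkewShape.between {S : Finset (ℕ × ℕ)} (h : IsSkewShape S) {x y z : ℕ × ℕ} (hx : x ∈ S)
    (hz : z ∈ S) (hxy : x ≤ y) (hyz : y ≤ z) : y ∈ S := by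
  obtain ⟨lam, mu, -, rfl⟩ := h
  simp only [skewCells, Finset.mem_sdiff, YoungDiagram.mem_cells] at *
  exact ⟨mu.up_left_mem hyz.1 hyz.2 hz.1, fun h => hx.2 (lam.up_left_mem hxy.1 hxy.2 h)⟩

lemma IsBorderStrip.content_injOn {r : Finset (ℕ × ℕ)} (h : IsBorderStrip r) :
    Set.InjOn content (r : Set (ℕ × ℕ)) := by
  obtain ⟨hskew, -, hsq⟩ := h
  have key : ∀ x ∈ r, ∀ y ∈ r, content x = content y → ¬ x.1 < y.1 := by
    rintro ⟨i, j⟩ hx ⟨i', j'⟩ hy hc hlt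
    simp only [content] at hc hlt
    refine hsq i j fun z hz => ?_
    simp only [Finset.mem_insert, Finset.mem_singleton] at hz
    rcases hz with rfl | rfl | rfl | rfl <;>
      refine hskew.between hx hy ⟨?_, ?_⟩ ⟨?_, ?_⟩ <;> simp <;> omega
  intro x hx y hy hc
  have h1 := key x hx y hy hc
  have h2 := key y hy x hx hc.symm
  exact cell_ext hc (by omega)

lemma hasse_adj_content {x y : ℕ × ℕ} (h : (SimpleGraph.hasse (ℕ × ℕ)).Adj x y) :
    content y = content x + 1 ∧ ((x.1 : ℤ) - y.1 = 0 ∨ (x.1 : ℤ) - y.1 = 1) ∨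
    content y = content x - 1 ∧ ((y.1 : ℤ) - x.1 = 0 ∨ (y.1 : ℤ) - x.1 = 1) := by
  rw [hasse_adj_iff] at h
  simp only [content]
  omega

/-- A ribbon has one cell on each of `n` consecutive diagonals, and consecutive cells are
neighbours. -/
lemma IsRibbon.exists_rows {n : ℕ} (hn : 1 ≤ n) {r : Finset (ℕ × ℕ)} (h : IsRibbon n r) :
    ∃ t : ℤ → ℤ, (∀ x, x ∈ r ↔
        pos r ≤ content x ∧ content x < pos r + n ∧ (x.1 : ℤ) = t (content x)) ∧
      (∀ c, pos r < c → c < pos r + n → t (c - 1) - t c = 0 ∨ t (c - 1) - t c = 1) ∧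
      ∀ c, pos r ≤ c → c < pos r + n → 0 ≤ t c ∧ 0 ≤ t c + c := by
  obtain ⟨hb, hcard⟩ := h
  have hinj := hb.content_injOn
  have hne : (r.image content).Nonempty := by
    rw [Finset.image_nonempty, ← Finset.card_pos]; omega
  set p := pos r with hp
  have hp' : p = (r.image content).min' hne := by rw [hp, pos, dif_pos hne]
  set m := (r.image content).max' hne with hm
  obtain ⟨xp, hxp, hxpc⟩ := Finset.mem_image.1 ((r.image content).min'_mem hne)
  obtain ⟨xm, hxm, hxmc⟩ := Finset.mem_image.1 ((r.image content).max'_mem hne)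
  rw [← hp'] at hxpc
  rw [← hm] at hxmc
  have hlo : ∀ x ∈ r, p ≤ content x := fun x hx =>
    hp' ▸ Finset.min'_le _ _ (Finset.mem_image_of_mem _ hx)
  have hhi : ∀ x ∈ r, content x ≤ m := fun x hx =>
    Finset.le_max' _ _ (Finset.mem_image_of_mem _ hx)
  -- the ribbon crosses from each of its diagonals to the next one
  have hcross : ∀ c, p ≤ c → c < m → ∃ x ∈ r, ∃ y ∈ r, content x = c ∧ content y = c + 1 ∧
      ((x.1 : ℤ) - y.1 = 0 ∨ (x.1 : ℤ) - y.1 = 1) := by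
    intro c h1 h2
    by_contra! hno
    have := (isConnectedShape_iff.1 hb.2.1).2 (fun x => content x ≤ c) ⟨xp, hxp, hxpc.trans_le h1⟩
      (fun x hx y hy hadj hxc => by
        by_contra hyc
        rcases hasse_adj_content hadj with ⟨h3, h4⟩ | ⟨h3, h4⟩
        · have h5 := hno x hx y hy (by omega) (by omega)
          omega
        · omega) xm hxm
    omega
  have hex : ∀ c, p ≤ c → c ≤ m → ∃ x ∈ r, content x = c := by
    intro c h1 h2
    rcases h2.lt_or_eq with h3 | rfl
    · obtain ⟨x, hx, -, -, hc, -⟩ := hcross c h1 h3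
      exact ⟨x, hx, hc⟩
    · exact ⟨xm, hxm, hxmc⟩
  have himg : r.image content = Finset.Icc p m := by
    ext c
    simp only [Finset.mem_image, Finset.mem_Icc]
    constructor
    · rintro ⟨x, hx, rfl⟩; exact ⟨hlo x hx, hhi x hx⟩
    · rintro ⟨h1, h2⟩; exact hex c h1 h2
  have hm' : m = p + n - 1 := by
    have h1 := Finset.card_image_of_injOn hinj
    rw [himg, Int.card_Icc, hcard] at h1
    omega
  obtain ⟨t, ht⟩ : ∃ t : ℤ → ℤ, ∀ c, p ≤ c → c ≤ m → ∃ x ∈ r, content x = c ∧ t c = x.1 := by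
    choose! f hf using hex
    exact ⟨fun c => (f c).1, fun c h1 h2 => ⟨f c, (hf c h1 h2).1, (hf c h1 h2).2, rfl⟩⟩
  refine ⟨t, ?_, ?_, ?_⟩
  · intro x
    constructor
    · intro hx
      have h1 := hlo x hx
      have h2 := hhi x hx
      refine ⟨h1, by omega, ?_⟩
      obtain ⟨y, hy, hyc, e⟩ := ht _ h1 h2
      rw [e, hinj hy hx hyc]
    · rintro ⟨h1, h2, h3⟩
      obtain ⟨y, hy, hyc, e⟩ := ht _ h1 (by omega)
      rw [e] at h3
      rwa [cell_ext hyc.symm h3]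
  · intro c h1 h2
    obtain ⟨x, hx, y, hy, hxc, hyc, hs⟩ := hcross (c - 1) (by omega) (by omega)
    obtain ⟨x', hx', hxc', ex⟩ := ht (c - 1) (by omega) (by omega)
    obtain ⟨y', hy', hyc', ey⟩ := ht c (by omega) (by omega)
    rw [ex, ey]
    rw [hinj hx' hx (hxc'.trans hxc.symm), hinj hy' hy (by omega)]
    exact hs
  · intro c h1 h2
    obtain ⟨x, hx, hxc, e⟩ := ht c h1 (by omega)
    rw [e]
    simp only [content] at hxc
    omega

lemma isHead_last {n : ℕ} (hn : 1 ≤ n) {r : Finset (ℕ × ℕ)} {t : ℤ → ℤ}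
    (h : (∀ x, x ∈ r ↔
        pos r ≤ content x ∧ content x < pos r + n ∧ (x.1 : ℤ) = t (content x)) ∧
      (∀ c, pos r < c → c < pos r + n → t (c - 1) - t c = 0 ∨ t (c - 1) - t c = 1) ∧
      ∀ c, pos r ≤ c → c < pos r + n → 0 ≤ t c ∧ 0 ≤ t c + c) :
    IsHead r (cellAt (pos r + n - 1) (t (pos r + n - 1))) := by
  obtain ⟨hr1, hr2, hr3⟩ := h
  set e := pos r + n - 1 with he
  have hre := hr3 e (by omega) (by omega)
  refine ⟨?_, fun d hd => ?_⟩
  · rw [hr1, content_cellAt hre.1 hre.2, fst_cellAt hre.1]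
    omega
  · obtain ⟨hd1, hd2, hd3⟩ := (hr1 d).1 hd
    have hmono : ∀ k : ℕ, pos r ≤ e - k → t e ≤ t (e - k) ∧ t (e - k) ≤ t e + k := by
      intro k
      induction k with
      | zero => intro _; simp
      | succ k ih =>
        intro hk
        push_cast at hk ⊢
        have h3 := ih (by omega)
        have h4 := hr2 (e - k) (by omega) (by omega)
        rw [show e - ((k : ℤ) + 1) = e - k - 1 by ring]
        omega
    have h3 := hmono (e - content d).toNat (by omega)
    rw [show e - ((e - content d).toNat : ℤ) = content d by omega, ← hd3] at h3
    have h4 := fst_cellAt (c := e) hre.1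
    have h5 := snd_cellAt (c := e) hre.2
    simp only [content] at *
    omega

/-- In a horizontal ribbon strip the ribbons that meet a diagonal are ordered along it in the
order of their positions, since the last cell of each ribbon touches the northern edge. -/
lemma IsHorizontalRibbonStrip.rows_lt {n : ℕ} (hn : 1 ≤ n) {lam mu : YoungDiagram} {T : RibbonSet}
    (h : IsHorizontalRibbonStrip n (skewCells mu lam) T)
    {t : Finset (ℕ × ℕ) → ℤ → ℤ}
    (ht : ∀ r ∈ T, (∀ x, x ∈ r ↔
        pos r ≤ content x ∧ content x < pos r + n ∧ (x.1 : ℤ) = t r (content x)) ∧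
      (∀ c, pos r < c → c < pos r + n → t r (c - 1) - t r c = 0 ∨ t r (c - 1) - t r c = 1) ∧
      ∀ c, pos r ≤ c → c < pos r + n → 0 ≤ t r c ∧ 0 ≤ t r c + c)
    {r s : Finset (ℕ × ℕ)} (hr : r ∈ T) (hs : s ∈ T) (hrs : r ≠ s) (hpos : pos r ≤ pos s) {c : ℤ}
    (h1 : pos s ≤ c) (h2 : c < pos r + n) : t r c < t s c := by
  obtain ⟨-, ⟨-, hdis, hcov⟩, hnorth⟩ := h
  obtain ⟨hr1, hr2, hr3⟩ := ht r hr
  obtain ⟨hs1, hs2, hs3⟩ := ht s hs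
  have hcell : ∀ c, pos r ≤ c → c < pos r + n → cellAt c (t r c) ∈ r := fun c h1 h2 => by
    rw [hr1, content_cellAt (hr3 c h1 h2).1 (hr3 c h1 h2).2, fst_cellAt (hr3 c h1 h2).1]
    exact ⟨h1, h2, rfl⟩
  have hcell' : ∀ c, pos s ≤ c → c < pos s + n → cellAt c (t s c) ∈ s := fun c h1 h2 => by
    rw [hs1, content_cellAt (hs3 c h1 h2).1 (hs3 c h1 h2).2, fst_cellAt (hs3 c h1 h2).1]
    exact ⟨h1, h2, rfl⟩
  have hne : ∀ c, pos s ≤ c → c < pos r + n → t r c ≠ t s c := by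
    intro c h1 h2 e
    have h3 := hcell c (by omega) h2
    rw [e] at h3
    exact Finset.disjoint_left.1 (hdis hr hs hrs) h3 (hcell' c h1 (by omega))
  by_contra hlt
  -- if `s` lay above `r`, it would still do so on the last diagonal of `r`
  have key : ∀ k : ℕ, c + k < pos r + n → t s (c + k) < t r (c + k) := by
    intro k
    induction k with
    | zero => intro _; have := hne c h1 h2; simp; omega
    | succ k ih =>
      intro hk
      push_cast at hk ⊢
      have h3 := ih (by omega)
      have h4 := hr2 (c + (k + 1)) (by omega) (by omega)
      have h5 := hs2 (c + (k + 1)) (by omega) (by omega)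
      have h6 := hne (c + (k + 1)) (by omega) (by omega)
      rw [show c + ((k : ℤ) + 1) - 1 = c + k by ring] at h4 h5
      omega
  have hlast := key (pos r + n - 1 - c).toNat (by omega)
  rw [show c + ((pos r + n - 1 - c).toNat : ℤ) = pos r + n - 1 by omega] at hlast
  -- the cell above the head of `r` then lies in the skew shape, as `s` is even further up
  set e := pos r + n - 1 with he
  have hsub : ∀ r ∈ T, r ⊆ skewCells mu lam := fun r hr x hx =>
    hcov ▸ mem_cellsOf.2 ⟨r, hr, hx⟩
  have hre := hr3 e (by omega) (by omega)
  have hse := hs3 e (by omega) (by omega)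
  have hmr := hsub r hr (hcell e (by omega) (by omega))
  have hms := hsub s hs (hcell' e (by omega) (by omega))
  rw [mem_skewCells, content_cellAt hre.1 hre.2, fst_cellAt hre.1] at hmr
  rw [mem_skewCells, content_cellAt hse.1 hse.2, fst_cellAt hse.1] at hms
  have hhead : IsHead r (cellAt e (t r e)) := isHead_last hn (ht r hr)
  have h3 := hnorth r hr _ hhead ((t r e).toNat - 1) (by simp only [cellAt]; omega)
  refine h3 (mem_skewCells.2 ?_)
  have e1 : content ((t r e).toNat - 1, (cellAt e (t r e)).2) = e + 1 := by
    simp only [content, cellAt]; omega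
  have e2 : (((t r e).toNat - 1 : ℕ) : ℤ) = t r e - 1 := by omega
  rw [e1]
  simp only [e2]
  have h4 := bead_eq_zero_or_one lam (e + 1)
  have h5 := bead_eq_zero_or_one mu (e + 1)
  simp only [bead, add_sub_cancel_right] at h4 h5
  omega

/-- Every horizontal ribbon strip is given by bead moves: its ribbons are determined by their
positions. -/
theorem IsHorizontalRibbonStrip.exists_hStrip {n : ℕ} (hn : 1 ≤ n) {lam mu : YoungDiagram}
    {T : RibbonSet} (hle : lam ≤ mu) (h : IsHorizontalRibbonStrip n (skewCells mu lam) T) :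
    HStrip n lam (T.image pos) mu ∧ T = tiles n lam (T.image pos) := by
  choose! t ht using fun r (hr : r ∈ T) => (h.2.1.1 r hr).exists_rows hn
  have hlt := fun {r s} hr hs hrs hpos {c} =>
    h.rows_lt hn (r := r) (s := s) (c := c) ht hr hs hrs hpos
  obtain ⟨-, ⟨-, hdis, hcov⟩, hnorth⟩ := h
  have hinj : Set.InjOn pos (T : Set (Finset (ℕ × ℕ))) := by
    intro r hr s hs e
    by_contra hne
    have h1 := hlt hr hs hne e.le (c := pos s) le_rfl (by omega)
    have h2 := hlt hs hr (Ne.symm hne) e.ge (c := pos s) (by omega) (by omega)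
    omega
  have hcard : ∀ (Q : ℤ → Prop) [DecidablePred Q], ((T.image pos).filter Q).card =
      (T.filter fun r => Q (pos r)).card := fun Q _ => by
    rw [Finset.filter_image, Finset.card_image_of_injOn]
    exact hinj.mono (Finset.coe_subset.2 (Finset.filter_subset _ _))
  have hmem : ∀ r ∈ T, ∀ c, pos r ≤ c → c < pos r + n → cellAt c (t r c) ∈ r :=
    fun r hr c h1 h2 => by
      obtain ⟨hr1, -, hr3⟩ := ht r hr
      rw [hr1, content_cellAt (hr3 c h1 h2).1 (hr3 c h1 h2).2, fst_cellAt (hr3 c h1 h2).1]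
      exact ⟨h1, h2, rfl⟩
  have hskew : ∀ r ∈ T, ∀ c, pos r ≤ c → c < pos r + n → rim lam c ≤ t r c ∧ t r c < rim mu c :=
    fun r hr c h1 h2 => by
      have h3 := (ht r hr).2.2 c h1 h2
      have h4 : cellAt c (t r c) ∈ skewCells mu lam :=
        hcov ▸ mem_cellsOf.2 ⟨r, hr, hmem r hr c h1 h2⟩
      rwa [mem_skewCells, content_cellAt h3.1 h3.2, fst_cellAt h3.1] at h4
  -- count the ribbons that meet a diagonal above a given row
  have hcount : ∀ c i, rim lam c ≤ i → i ≤ rim mu c →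
      ((T.filter fun r => (pos r ≤ c ∧ c < pos r + n) ∧ t r c < i).card : ℤ) = i - rim lam c := by
    intro c i h1 h2
    have : (T.filter fun r => (pos r ≤ c ∧ c < pos r + n) ∧ t r c < i).card =
        (Finset.Ico (rim lam c) i).card := by
      refine Finset.card_bij (fun r _ => t r c) ?_ ?_ ?_
      · intro r hr
        simp only [Finset.mem_filter, Finset.mem_Ico] at hr ⊢
        exact ⟨(hskew r hr.1 c hr.2.1.1 hr.2.1.2).1, hr.2.2⟩
      · intro r hr s hs e
        simp only [Finset.mem_filter] at hr hs
        by_contra hne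
        rcases le_total (pos r) (pos s) with hp | hp
        · exact (hlt hr.1 hs.1 hne hp hs.2.1.1 hr.2.1.2).ne e
        · exact (hlt hs.1 hr.1 (Ne.symm hne) hp hr.2.1.1 hs.2.1.2).ne e.symm
      · intro k hk
        rw [Finset.mem_Ico] at hk
        have h3 := rim_nonneg lam c
        have h4 := rim_add_nonneg lam c
        have : cellAt c k ∈ cellsOf T := by
          rw [hcov, mem_skewCells, content_cellAt (by omega) (by omega), fst_cellAt (by omega)]
          omega
        obtain ⟨r, hr, hx⟩ := mem_cellsOf.1 this
        have hx' := ((ht r hr).1 _).1 hx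
        rw [content_cellAt (by omega) (by omega), fst_cellAt (by omega)] at hx'
        refine ⟨r, ?_, hx'.2.2.symm⟩
        rw [Finset.mem_filter, ← hx'.2.2]
        exact ⟨hr, ⟨hx'.1, hx'.2.1⟩, hk.2⟩
    rw [this, Int.card_Ico]; omega
  -- the whole diagonal gives the rim of `mu`, and the part above a ribbon gives its rows
  have hrim : ∀ c, rim mu c = rim lam c + cov n (T.image pos) c := by
    intro c
    have h1 := hcount c (rim mu c) (le_iff_rim_le.1 hle c) le_rfl
    rw [cov, hcard]
    rw [Finset.filter_congr (q := fun r => pos r ≤ c ∧ c < pos r + n)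
      (fun r hr => ⟨fun h => h.1, fun h => ⟨h, (hskew r hr c h.1 h.2).2⟩⟩)] at h1
    omega
  have htile : ∀ r ∈ T, ∀ c, pos r ≤ c → c < pos r + n →
      t r c = tileRim n lam (T.image pos) (pos r) c := by
    intro r hr c h1 h2
    have h3 := hskew r hr c h1 h2
    have h4 := hcount c (t r c) h3.1 h3.2.le
    have h5 : cov n ((T.image pos).filter (· < pos r)) c =
        ((T.filter fun s => (pos s ≤ c ∧ c < pos s + n) ∧ t s c < t r c).card : ℤ) := by
      rw [cov, Finset.filter_filter, hcard]
      congr 2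
      refine Finset.filter_congr fun s hs => ?_
      constructor
      · rintro ⟨h6, h7⟩
        exact ⟨h7, hlt hs hr (fun e => by rw [e] at h6; exact lt_irrefl _ h6) h6.le h1 h7.2⟩
      · rintro ⟨h6, h7⟩
        refine ⟨?_, h6⟩
        by_contra! h8
        rcases eq_or_ne r s with rfl | hne
        · exact lt_irrefl _ h7
        · have := hlt hr hs hne h8 h6.1 h2
          omega
    rw [tileRim, h5]; omega
  have hT : T = tiles n lam (T.image pos) := by
    have : T.image (fun r => tile n lam (T.image pos) (pos r)) = T.image id := by
      refine Finset.image_congr fun r hr => ?_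
      ext x
      simp only [id, mem_tile, (ht r hr).1 x]
      constructor
      · rintro ⟨h1, h2, h3⟩; exact ⟨h1, h2, by rw [htile r hr _ h1 h2]; exact h3⟩
      · rintro ⟨h1, h2, h3⟩; exact ⟨h1, h2, by rw [← htile r hr _ h1 h2]; exact h3⟩
    rw [tiles, Finset.image_image]
    exact (this.trans Finset.image_id).symm
  refine ⟨⟨?_, hrim⟩, hT⟩
  -- a bead in the place to which a ribbon should move one contradicts the northern edge condition
  intro a ha
  obtain ⟨r, hr, rfl⟩ := Finset.mem_image.1 ha
  constructor
  · refine (bead_eq_zero_or_one lam (pos r + n)).resolve_right fun hb => ?_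
    set e := pos r + n - 1 with he
    have h0 := hmem r hr e (by omega) (by omega)
    have h1 := (ht r hr).2.2 e (by omega) (by omega)
    have h2 : t r e = rim lam e := by
      rw [htile r hr e (by omega) (by omega), tileRim_last n lam _ he.le]
    have hb' : rim lam e - rim lam (e + 1) = 1 := by
      rw [bead] at hb; convert hb using 3; omega
    have h3 := hskew r hr e (by omega) (by omega)
    have h4 := rim_nonneg lam (e + 1)
    have hhead : IsHead r (cellAt e (t r e)) := isHead_last hn (ht r hr)
    refine hnorth r hr _ hhead ((t r e).toNat - 1) (by simp only [cellAt]; omega)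
      (mem_skewCells.2 ?_)
    have e1 : content ((t r e).toNat - 1, (cellAt e (t r e)).2) = e + 1 := by
      simp only [content, cellAt]; omega
    have e2 : (((t r e).toNat - 1 : ℕ) : ℤ) = t r e - 1 := by omega
    rw [e1]
    simp only [e2]
    have h5 := bead_eq_zero_or_one mu (e + 1)
    simp only [bead, add_sub_cancel_right] at h5
    omega
  · -- the rim of `mu` has no step of size `-1` at `pos r`
    by_contra! hno
    have h1 := bead_eq_of_rim hn hrim (pos r)
    have h2 := bead_eq_zero_or_one lam (pos r)
    have h3 := bead_eq_zero_or_one mu (pos r)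
    rw [if_neg hno.2, if_pos ha] at h1
    have := hno.1
    omega

/-! ### Runs of contents -/

/-- Some element of `A` lies in `(c, c + n]`. -/
def IsFollowed (n : ℕ) (A : Finset ℤ) (c : ℤ) : Prop := ∃ a ∈ A, c < a ∧ a ≤ c + n

/-- The elements of `A` after which there is a gap of more than `n`. There is one of them for each
connected component of a horizontal strip. -/
def ends (n : ℕ) (A : Finset ℤ) : Finset ℤ := A.filter fun c => ¬ IsFollowed n A c

/-- The elements of `A` that are linked to `m` from the left by steps of length at most `n`. -/
def run (n : ℕ) (A : Finset ℤ) (m : ℤ) : Finset ℤ :=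
  A.filter fun x => x ≤ m ∧ ∀ y ∈ A, x ≤ y → y < m → IsFollowed n A y

/-- The ends of the runs of `A` are precisely the elements of `A` that are followed in `A'`. -/
def IsJoined (n : ℕ) (A' A : Finset ℤ) : Prop :=
  ∀ c ∈ A, IsFollowed n A' c ↔ ¬ IsFollowed n A c

lemma mem_ends {n : ℕ} {A : Finset ℤ} {c : ℤ} : c ∈ ends n A ↔ c ∈ A ∧ ¬ IsFollowed n A c := by
  simp [ends]

lemma mem_run {n : ℕ} {A : Finset ℤ} {m x : ℤ} : x ∈ run n A m ↔
    x ∈ A ∧ x ≤ m ∧ ∀ y ∈ A, x ≤ y → y < m → IsFollowed n A y := by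
  simp [run]

lemma IsFollowed.mono {n : ℕ} {A B : Finset ℤ} {c : ℤ} (h : A ⊆ B) (hc : IsFollowed n A c) :
    IsFollowed n B c := by
  obtain ⟨a, ha, h1⟩ := hc; exact ⟨a, h ha, h1⟩

lemma self_mem_run {n : ℕ} {A : Finset ℤ} {m : ℤ} (h : m ∈ A) : m ∈ run n A m :=
  mem_run.2 ⟨h, le_rfl, fun _ _ h1 h2 => absurd h2 (by omega)⟩

lemma isInitial_run (n : ℕ) (D : Finset ℤ) (m : ℤ) : IsInitial n D (run n D m) := by
  refine ⟨Finset.filter_subset _ _, fun a ha b hb h1 h2 => ?_⟩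
  rw [mem_run] at ha ⊢
  refine ⟨hb, by omega, fun y hy h3 h4 => ?_⟩
  by_cases h5 : a ≤ y
  · exact ha.2.2 y hy h5 h4
  · exact ⟨a, ha.1, by omega, by omega⟩

/-- If all the elements of `A` to the left of `m ∈ A` are followed in the initial part `A` of `D`,
then `A` contains the run of `D` that leads to `m`, and nothing else to the left of `m`. -/
lemma IsInitial.filter_le_eq_run {n : ℕ} {D A : Finset ℤ} (h : IsInitial n D A) {m : ℤ}
    (hm : m ∈ A) (hf : ∀ x ∈ A, x < m → IsFollowed n A x) : A.filter (· ≤ m) = run n D m := by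
  ext x
  rw [Finset.mem_filter, mem_run]
  constructor
  · rintro ⟨hx, hxm⟩
    refine ⟨h.1 hx, hxm, fun y hy h1 h2 => ?_⟩
    -- the last element of `A` up to `y` is followed by an element beyond `y`
    have hne : (A.filter (· ≤ y)).Nonempty := ⟨x, by simp [hx, h1]⟩
    set a := (A.filter (· ≤ y)).max' hne with ha
    have ha' := (A.filter (· ≤ y)).max'_mem hne
    rw [← ha, Finset.mem_filter] at ha'
    obtain ⟨a', h3, h4, h5⟩ := hf a ha'.1 (by omega)
    refine ⟨a', h.1 h3, ?_, by omega⟩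
    by_contra! h6
    have := Finset.le_max' (A.filter (· ≤ y)) a' (by simp [h3, h6])
    omega
  · rintro ⟨hx, hxm, hy⟩
    refine ⟨?_, hxm⟩
    by_contra hxA
    have hne : (D.filter fun z => z ∉ A ∧ x ≤ z ∧ z ≤ m).Nonempty := ⟨x, by simp [hx, hxA, hxm]⟩
    set z := (D.filter fun z => z ∉ A ∧ x ≤ z ∧ z ≤ m).max' hne with hz
    have hz' := (D.filter fun z => z ∉ A ∧ x ≤ z ∧ z ≤ m).max'_mem hne
    rw [← hz, Finset.mem_filter] at hz'
    obtain ⟨h1, h2, h3, h4⟩ := hz'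
    have h5 : z ≠ m := fun e => h2 (e ▸ hm)
    obtain ⟨d, hd, h6, h7⟩ := hy z h1 h3 (by omega)
    by_cases h8 : d ≤ m
    · by_cases h9 : d ∈ A
      · exact h2 (h.2 d h9 z h1 (by omega) h6)
      · have := Finset.le_max' (D.filter fun z => z ∉ A ∧ x ≤ z ∧ z ≤ m) d
          (by simp only [Finset.mem_filter]; exact ⟨hd, h9, by omega, h8⟩)
        omega
    · exact h2 (h.2 m hm z h1 (by omega) (by omega))

lemma max'_mem_ends {n : ℕ} {A : Finset ℤ} (h : A.Nonempty) : A.max' h ∈ ends n A :=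
  mem_ends.2 ⟨A.max'_mem h, fun ⟨a, ha, h1, _⟩ => by have := A.le_max' a ha; omega⟩

lemma ends_run {n : ℕ} {D : Finset ℤ} {m : ℤ} (hm : m ∈ D) : ends n (run n D m) = {m} := by
  ext x
  rw [mem_ends, Finset.mem_singleton]
  constructor
  · rintro ⟨hx, hnf⟩
    by_contra hne
    obtain ⟨h1, h2, h3⟩ := mem_run.1 hx
    obtain ⟨d, hd, h4, h5⟩ := h3 x h1 le_rfl (by omega)
    refine hnf ?_
    by_cases h6 : d ≤ m
    · exact ⟨d, mem_run.2 ⟨hd, h6, fun y hy h7 h8 => h3 y hy (by omega) h8⟩, h4, h5⟩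
    · exact ⟨m, self_mem_run hm, by omega, by omega⟩
  · rintro rfl
    refine ⟨self_mem_run hm, fun ⟨a, ha, h1, _⟩ => ?_⟩
    have := (mem_run.1 ha).2.1
    omega

/-- A connected initial part of `D` is the same thing as an element of `D`, its last one. -/
lemma card_initial_of_card_ends_eq_one (n : ℕ) (D : Finset ℤ) :
    (D.powerset.filter fun A => IsInitial n D A ∧ (ends n A).card = 1).card = D.card := by
  symm
  refine Finset.card_bij (fun m _ => run n D m) ?_ ?_ ?_
  · intro m hm
    rw [Finset.mem_filter, Finset.mem_powerset, ends_run hm]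
    exact ⟨(isInitial_run n D m).1, isInitial_run n D m, rfl⟩
  · intro a ha b hb e
    have := congrArg (ends n) e
    rwa [ends_run ha, ends_run hb, Finset.singleton_inj] at this
  · intro A hA
    obtain ⟨-, hA, hcard⟩ := Finset.mem_filter.1 hA
    obtain ⟨e, he⟩ := Finset.card_eq_one.1 hcard
    have heA : e ∈ ends n A := he ▸ Finset.mem_singleton_self e
    have hne : A.Nonempty := ⟨e, (mem_ends.1 heA).1⟩
    have hmax : A.max' hne = e := by
      have h := max'_mem_ends (n := n) hne
      rwa [he, Finset.mem_singleton] at h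
    have heA := (mem_ends.1 heA).1
    have hle : ∀ x ∈ A, x ≤ e := fun x hx => hmax ▸ A.le_max' x hx
    refine ⟨e, hA.1 heA, ?_⟩
    rw [← hA.filter_le_eq_run heA fun x hx hxe => ?_]
    · exact Finset.filter_true_of_mem hle
    · by_contra hnf
      have : x ∈ ends n A := mem_ends.2 ⟨hx, hnf⟩
      rw [he, Finset.mem_singleton] at this
      omega

section Toggle

variable {n : ℕ} {A' D A : Finset ℤ} {m : ℤ}

/-- An initial part of `D` that is joined to `A'` and does not contain the first element `m` of
`D` that is followed in `A'` has no elements to the left of `m`. -/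
lemma IsInitial.lt_of_isJoined (h : IsInitial n D A) (hj : IsJoined n A' A)
    (hmin : ∀ c ∈ D, IsFollowed n A' c → m ≤ c) (hmD : m ∈ D) (hm : m ∉ A) :
    ∀ x ∈ A, m < x := by
  by_contra! hx
  obtain ⟨x, hx, hxm⟩ := hx
  have hne : (A.filter (· ≤ m)).Nonempty := ⟨x, by simp [hx, hxm]⟩
  set z := (A.filter (· ≤ m)).max' hne with hz
  have hz' := (A.filter (· ≤ m)).max'_mem hne
  rw [← hz, Finset.mem_filter] at hz'
  have h1 : z ≠ m := fun e => hm (e ▸ hz'.1)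
  have h2 : IsFollowed n A z := by
    by_contra h3
    have := hmin z (h.1 hz'.1) ((hj z hz'.1).2 h3)
    omega
  obtain ⟨a, ha, h4, h5⟩ := h2
  by_cases h6 : a ≤ m
  · have := Finset.le_max' (A.filter (· ≤ m)) a (by simp [ha, h6])
    omega
  · exact hm (h.2 a ha m hmD (by omega) (by omega))

lemma IsInitial.filter_le_eq_run_of_isJoined (h : IsInitial n D A) (hj : IsJoined n A' A)
    (hmin : ∀ c ∈ D, IsFollowed n A' c → m ≤ c) (hm : m ∈ A) :
    A.filter (· ≤ m) = run n D m := by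
  refine h.filter_le_eq_run hm fun x hx hxm => ?_
  by_contra hnf
  have := hmin x (h.1 hx) ((hj x hx).2 hnf)
  omega

lemma IsInitial.not_isFollowed (h : IsInitial n D A) {b : ℤ} (hb : b ∈ D) (hbA : b ∉ A) :
    ¬ IsFollowed n A b := fun ⟨a, ha, h1, h2⟩ => hbA (h.2 a ha b hb (by omega) h1)

/-- The run that leads to the first element of `D` followed in `A'` can be added to an initial
part of `D` joined to `A'`. -/
lemma IsInitial.union_run (h : IsInitial n D A) (hj : IsJoined n A' A)
    (hmin : ∀ c ∈ D, IsFollowed n A' c → m ≤ c) (hmD : m ∈ D) (hmf : IsFollowed n A' m)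
    (hm : m ∉ A) : IsInitial n D (A ∪ run n D m) ∧ IsJoined n A' (A ∪ run n D m) ∧
      ends n (A ∪ run n D m) = insert m (ends n A) := by
  have hlt := h.lt_of_isJoined hj hmin hmD hm
  have hrun := isInitial_run n D m
  have hle : ∀ x ∈ run n D m, x ≤ m := fun x hx => (mem_run.1 hx).2.1
  -- being followed does not change for the elements of `A`, and holds in `run n D m` before `m`
  have h1 : ∀ c ∈ A, IsFollowed n (A ∪ run n D m) c ↔ IsFollowed n A c := fun c hc =>
    ⟨fun ⟨a, ha, h2, h3⟩ => by
      rcases Finset.mem_union.1 ha with ha | ha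
      · exact ⟨a, ha, h2, h3⟩
      · have := hle a ha; have := hlt c hc; omega, IsFollowed.mono Finset.subset_union_left⟩
  have h2 : ∀ c ∈ run n D m, IsFollowed n (A ∪ run n D m) c ↔ c ≠ m := by
    intro c hc
    constructor
    · rintro ⟨a, ha, h3, h4⟩ rfl
      rcases Finset.mem_union.1 ha with ha | ha
      · exact h.not_isFollowed hmD hm ⟨a, ha, h3, h4⟩
      · have := hle a ha; omega
    · intro hne
      have : IsFollowed n (run n D m) c := by
        by_contra hnf
        have h3 : c ∈ ends n (run n D m) := mem_ends.2 ⟨hc, hnf⟩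
        rw [ends_run hmD, Finset.mem_singleton] at h3
        exact hne h3
      exact this.mono Finset.subset_union_right
  refine ⟨⟨Finset.union_subset h.1 hrun.1, ?_⟩, ?_, ?_⟩
  · intro a ha b hb h3 h4
    rcases Finset.mem_union.1 ha with ha | ha
    · exact Finset.mem_union_left _ (h.2 a ha b hb h3 h4)
    · exact Finset.mem_union_right _ (hrun.2 a ha b hb h3 h4)
  · intro c hc
    rcases Finset.mem_union.1 hc with hc | hc
    · rw [h1 c hc]; exact hj c hc
    · rw [h2 c hc, not_not]
      constructor
      · intro h3
        have := hmin c (hrun.1 hc) h3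
        have := hle c hc
        omega
      · rintro rfl; exact hmf
  · ext c
    rw [Finset.mem_insert, mem_ends, mem_ends, Finset.mem_union]
    constructor
    · rintro ⟨hc | hc, hnf⟩
      · rw [h1 c hc] at hnf; exact Or.inr ⟨hc, hnf⟩
      · rw [h2 c hc, not_not] at hnf; exact Or.inl hnf
    · rintro (rfl | ⟨hc, hnf⟩)
      · exact ⟨Or.inr (self_mem_run hmD), by rw [h2 _ (self_mem_run hmD)]; simp⟩
      · exact ⟨Or.inl hc, by rwa [h1 c hc]⟩

/-- The run that leads to the first element of `D` followed in `A'` can be removed from an initial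
part of `D` joined to `A'`. -/
lemma IsInitial.sdiff_run (h : IsInitial n D A) (hj : IsJoined n A' A)
    (hmin : ∀ c ∈ D, IsFollowed n A' c → m ≤ c) (hmf : IsFollowed n A' m)
    (hm : m ∈ A) : IsInitial n D (A \ run n D m) ∧ IsJoined n A' (A \ run n D m) := by
  have hrun := h.filter_le_eq_run_of_isJoined hj hmin hm
  have hmem : ∀ x, x ∈ A \ run n D m ↔ x ∈ A ∧ m < x := fun x => by
    rw [← hrun, Finset.mem_sdiff, Finset.mem_filter]
    constructor
    · rintro ⟨h1, h2⟩; exact ⟨h1, not_le.1 fun h3 => h2 ⟨h1, h3⟩⟩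
    · rintro ⟨h1, h2⟩; exact ⟨h1, fun h3 => absurd h3.2 (not_le.2 h2)⟩
  have hnf := (hj m hm).1 hmf
  refine ⟨⟨fun x hx => h.1 ((hmem x).1 hx).1, fun a ha b hb h1 h2 => ?_⟩, fun c hc => ?_⟩
  · rw [hmem] at ha ⊢
    refine ⟨h.2 a ha.1 b hb h1 h2, ?_⟩
    by_contra! h3
    exact hnf ⟨a, ha.1, ha.2, by omega⟩
  · rw [hmem] at hc
    rw [hj c hc.1]
    refine not_congr ⟨fun ⟨a, ha, h1, h2⟩ => ⟨a, (hmem a).2 ⟨ha, by omega⟩, h1, h2⟩,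
      IsFollowed.mono Finset.sdiff_subset⟩

end Toggle

/-- The signs of the initial parts of `D` that are joined to `A'` cancel, unless no element of `D`
is followed in `A'`. The run that leads to the first such element can always be added or removed. -/
lemma sum_neg_one_pow_ends {R : Type*} [CommRing R] (n : ℕ) (A' D : Finset ℤ) :
    ∑ A ∈ D.powerset with IsInitial n D A ∧ IsJoined n A' A, (-1 : R) ^ (ends n A).card =
      if ∃ c ∈ D, IsFollowed n A' c then 0 else 1 := by
  split_ifs with hex
  · have hne : (D.filter (IsFollowed n A')).Nonempty := by
      obtain ⟨c, hc, hf⟩ := hex; exact ⟨c, Finset.mem_filter.2 ⟨hc, hf⟩⟩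
    obtain ⟨m, hm⟩ : ∃ m, m = (D.filter (IsFollowed n A')).min' hne := ⟨_, rfl⟩
    obtain ⟨hmD, hmf⟩ : m ∈ D ∧ IsFollowed n A' m := by
      have := (D.filter (IsFollowed n A')).min'_mem hne
      rwa [← hm, Finset.mem_filter] at this
    have hmin : ∀ c ∈ D, IsFollowed n A' c → m ≤ c := fun c hc hf =>
      hm ▸ Finset.min'_le _ _ (Finset.mem_filter.2 ⟨hc, hf⟩)
    have hself := self_mem_run (n := n) hmD
    -- adding or removing the run that leads to `m` changes the number of ends by one
    refine Finset.sum_involution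
      (fun A _ => if m ∈ A then A \ run n D m else A ∪ run n D m) ?_ ?_ ?_ ?_
    · intro A hA
      obtain ⟨-, hA, hj⟩ := Finset.mem_filter.1 hA
      split_ifs with hmA
      · obtain ⟨h1, h2⟩ := hA.sdiff_run hj hmin hmf hmA
        have hu := (h1.union_run h2 hmin hmD hmf (by simp [hself])).2.2
        have hsub : run n D m ⊆ A := by
          rw [← hA.filter_le_eq_run_of_isJoined hj hmin hmA]; exact Finset.filter_subset _ _
        rw [Finset.sdiff_union_of_subset hsub] at hu
        rw [hu, Finset.card_insert_of_notMem (by simp [mem_ends, hself])]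
        ring
      · rw [(hA.union_run hj hmin hmD hmf hmA).2.2,
          Finset.card_insert_of_notMem (by simp [mem_ends, hmA])]
        ring
    · intro A hA _ he
      split_ifs at he with hmA
      · rw [← he] at hmA; simp [hself] at hmA
      · rw [← he] at hmA; simp [hself] at hmA
    · intro A hA
      obtain ⟨-, hA, hj⟩ := Finset.mem_filter.1 hA
      rw [Finset.mem_filter, Finset.mem_powerset]
      split_ifs with hmA
      · obtain ⟨h1, h2⟩ := hA.sdiff_run hj hmin hmf hmA
        exact ⟨h1.1, h1, h2⟩
      · obtain ⟨h1, h2, -⟩ := hA.union_run hj hmin hmD hmf hmA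
        exact ⟨h1.1, h1, h2⟩
    · intro A hA
      obtain ⟨-, hA, hj⟩ := Finset.mem_filter.1 hA
      by_cases hmA : m ∈ A
      · have hsub : run n D m ⊆ A := by
          rw [← hA.filter_le_eq_run_of_isJoined hj hmin hmA]; exact Finset.filter_subset _ _
        rw [if_pos hmA, if_neg (by simp [hself]), Finset.sdiff_union_of_subset hsub]
      · rw [if_neg hmA, if_pos (by simp [hself]), Finset.union_sdiff_cancel_right]
        rw [Finset.disjoint_left]
        intro x hx hx'
        have := hA.lt_of_isJoined hj hmin hmD hmA x hx
        have := (mem_run.1 hx').2.1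
        omega
  · -- the last element of a nonempty set joined to `A'` is followed in `A'`
    push Not at hex
    have : (D.powerset.filter fun A => IsInitial n D A ∧ IsJoined n A' A) = {∅} := by
      ext A
      rw [Finset.mem_filter, Finset.mem_powerset, Finset.mem_singleton]
      constructor
      · rintro ⟨hsub, -, hj⟩
        by_contra hne
        have hmem := max'_mem_ends (n := n) (Finset.nonempty_iff_ne_empty.2 hne)
        obtain ⟨h1, h2⟩ := mem_ends.1 hmem
        exact hex _ (hsub h1) ((hj _ h1).2 h2)
      · rintro rfl
        exact ⟨by simp, ⟨by simp, by simp⟩, by simp [IsJoined]⟩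
    rw [this]; simp [ends]

/-! ### Splitting a strip -/

/-- Two successive strips whose ribbons do not touch from below make up one strip. -/
lemma HStrip.union {n : ℕ} (hn : 1 ≤ n) {lam nu mu : YoungDiagram} {A B : Finset ℤ}
    (hA : HStrip n lam A nu) (hB : HStrip n nu B mu) (hf : ∀ b ∈ B, ¬ IsFollowed n A b) :
    Disjoint A B ∧ HStrip n lam (A ∪ B) mu ∧ IsInitial n (A ∪ B) A := by
  have hdis : Disjoint A B := by
    rw [Finset.disjoint_left]
    intro c hcA hcB
    rcases (hB.1 c hcB).2 with h | h
    · have h1 := hA.bead_eq hn c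
      rw [if_pos hcA] at h1
      have h2 := bead_eq_zero_or_one lam c
      have h3 : c - n ∈ A := by
        by_contra h3; rw [if_neg h3] at h1; omega
      have h4 := (hA.1 _ h3).1
      rw [sub_add_cancel] at h4
      rw [if_pos h3] at h1
      omega
    · exact hf _ h ⟨c, hcA, by omega, by omega⟩
  refine ⟨hdis, ⟨?_, fun c => ?_⟩, Finset.subset_union_left, ?_⟩
  · intro a ha
    rcases Finset.mem_union.1 ha with ha | ha
    · obtain ⟨h1, h2⟩ := hA.1 a ha
      exact ⟨h1, h2.imp_right (Finset.mem_union_left _)⟩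
    · obtain ⟨h1, h2⟩ := hB.1 a ha
      have h3 : a ∉ A := fun h => Finset.disjoint_left.1 hdis h ha
      have h4 : a + n ∉ A := fun h => hf a ha ⟨_, h, by omega, le_rfl⟩
      have h5 := hA.bead_eq hn (a + n)
      have h6 := hA.bead_eq hn a
      rw [add_sub_cancel_right, if_neg h3, if_neg h4] at h5
      rw [if_neg h3] at h6
      refine ⟨by omega, ?_⟩
      rcases h2 with h2 | h2
      · by_cases h7 : a - n ∈ A
        · exact Or.inr (Finset.mem_union_left _ h7)
        · rw [if_neg h7] at h6; exact Or.inl (by omega)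
      · exact Or.inr (Finset.mem_union_right _ h2)
  · rw [hB.2, hA.2, cov_union hdis]; ring
  · intro a ha b hb h1 h2
    rcases Finset.mem_union.1 hb with hb | hb
    · exact hb
    · exact absurd ⟨a, ha, h2, by omega⟩ (hf b hb)

/-- A strip can be built up from an initial part. -/
lemma HStrip.split {n : ℕ} (hn : 1 ≤ n) {lam mu : YoungDiagram} {D A : Finset ℤ}
    (hD : HStrip n lam D mu) (hA : IsInitial n D A) :
    ∃ nu, HStrip n lam A nu ∧ HStrip n nu (D \ A) mu := by
  obtain ⟨nu, hnu⟩ := (hD.1.of_isInitial hn hA).exists_hStrip hn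
  refine ⟨nu, hnu, ⟨fun b hb => ?_, fun c => ?_⟩⟩
  · obtain ⟨hbD, hbA⟩ := Finset.mem_sdiff.1 hb
    obtain ⟨h1, h2⟩ := hD.1 b hbD
    have h3 := hnu.bead_eq hn (b + n)
    have h4 := bead_eq_zero_or_one nu (b + n)
    have h5 := hnu.bead_eq hn b
    have h6 := bead_eq_zero_or_one nu b
    have h7 := bead_eq_zero_or_one lam b
    rw [add_sub_cancel_right, if_neg hbA] at h3
    rw [if_neg hbA] at h5
    constructor
    · split_ifs at h3 <;> omega
    · by_cases h8 : b - n ∈ A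
      · rw [if_pos h8] at h5; exact Or.inl (by omega)
      · rw [if_neg h8] at h5
        exact h2.imp (fun h => by omega) fun h => Finset.mem_sdiff.2 ⟨h, h8⟩
  · have h1 : D = A ∪ D \ A := (Finset.union_sdiff_of_subset hA.1).symm
    rw [hD.2, hnu.2, add_assoc, ← cov_union Finset.disjoint_sdiff, ← h1]

lemma HStrip.tile_union {n : ℕ} {lam nu : YoungDiagram} {A B : Finset ℤ}
    (hA : HStrip n lam A nu) (hdis : Disjoint A B) (hf : ∀ b ∈ B, ¬ IsFollowed n A b) {b : ℤ}
    (hb : b ∈ B) : tile n nu B b = tile n lam (A ∪ B) b := by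
  refine tile_congr fun c h1 h2 => ?_
  rw [tileRim, tileRim, hA.2, Finset.filter_union, cov_union, ← add_assoc]
  · congr 2
    refine cov_congr fun a h3 h4 => ?_
    rw [Finset.mem_filter]
    refine ⟨fun ha => ⟨ha, ?_⟩, fun ha => ha.1⟩
    by_contra! h5
    rcases h5.lt_or_eq with h6 | rfl
    · exact hf b hb ⟨a, ha, h6, by omega⟩
    · exact Finset.disjoint_left.1 hdis ha hb
  · exact Finset.disjoint_filter_filter hdis

lemma HStrip.tiles_union {n : ℕ} (hn : 1 ≤ n) {lam nu mu : YoungDiagram} {A B : Finset ℤ}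
    (hA : HStrip n lam A nu) (hB : HStrip n nu B mu) (hf : ∀ b ∈ B, ¬ IsFollowed n A b) :
    tiles n lam (A ∪ B) = tiles n lam A ∪ tiles n nu B := by
  obtain ⟨hdis, -, hini⟩ := hA.union hn hB hf
  rw [tiles_of_isInitial hini, tiles, Finset.image_union]
  congr 1
  exact Finset.image_congr fun b hb => (hA.tile_union hdis hf hb).symm

lemma HStrip.spin_union {n : ℕ} (hn : 1 ≤ n) {lam nu mu : YoungDiagram} {A B : Finset ℤ}
    (hA : HStrip n lam A nu) (hB : HStrip n nu B mu) (hf : ∀ b ∈ B, ¬ IsFollowed n A b) :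
    spin (tiles n lam (A ∪ B)) = spin (tiles n lam A) + spin (tiles n nu B) := by
  obtain ⟨hdis, -, hini⟩ := hA.union hn hB hf
  rw [spin_tiles hn, spin_tiles hn, spin_tiles hn, Finset.sum_union hdis]
  congr 1
  · exact Finset.sum_congr rfl fun a ha => by rw [tile_of_isInitial hini _ ha]
  · exact Finset.sum_congr rfl fun b hb => by rw [hA.tile_union hdis hf hb]

/-! ### Connected components of a strip -/

/-- Consecutive ribbons of a horizontal strip whose positions differ by at most `n` share an
edge. -/
lemma IsAddable.exists_adj_tile {n : ℕ} (hn : 1 ≤ n) {lam : YoungDiagram} {A : Finset ℤ}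
    (h : IsAddable n lam A) {a a' : ℤ} (ha : a ∈ A) (ha' : a' ∈ A) (hlt : a < a')
    (hle : a' ≤ a + n) (hcons : ∀ b ∈ A, ¬ (a < b ∧ b < a')) :
    ∃ x ∈ tile n lam A a, ∃ y ∈ tile n lam A a', (SimpleGraph.hasse (ℕ × ℕ)).Adj x y := by
  have hx := cellAt_mem_tile (n := n) (lam := lam) (A := A) (a := a) (c := a' - 1) (by omega)
    (by omega)
  have hy := cellAt_mem_tile (n := n) (lam := lam) (A := A) (a := a') (c := a') le_rfl (by omega)
  refine ⟨_, hx, _, hy, ?_⟩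
  have h1 := tileRim_nonneg n lam A a (a' - 1)
  have h2 := tileRim_nonneg n lam A a' a'
  -- both cells lie in the same row, as there is a bead at `a'` before the second ribbon is added
  suffices hrow : tileRim n lam A a (a' - 1) = tileRim n lam A a' a' by
    rw [hasse_adj_iff]; simp only [cellAt]; omega
  have h3 : A.filter (· < a') = insert a (A.filter (· < a)) := by
    ext b
    simp only [Finset.mem_filter, Finset.mem_insert]
    constructor
    · rintro ⟨hb, hb'⟩
      have := hcons b hb
      rcases lt_trichotomy a b with h4 | h4 | h4
      · exact absurd ⟨h4, hb'⟩ this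
      · exact Or.inl h4.symm
      · exact Or.inr ⟨hb, h4⟩
    · rintro (rfl | ⟨hb, hb'⟩)
      · exact ⟨ha, hlt⟩
      · exact ⟨hb, hb'.trans hlt⟩
  have h4 : tileRim n lam A a' (a' - 1) = tileRim n lam A a (a' - 1) + 1 := by
    rw [tileRim, tileRim, h3, cov_insert (by simp), if_pos (by omega)]; ring
  obtain ⟨kap, hkap, hk⟩ := h.exists_tileRim hn a'
  have h5 := hkap.bead_eq hn a'
  have h6 := (h a' ha').2
  have h7 := bead_eq_zero_or_one kap a'
  have h8 := bead_eq_zero_or_one lam a'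
  rw [if_neg (show a' ∉ A.filter (· < a') by simp)] at h5
  have h9 : a' - n ∈ A → a' - n ∈ A.filter (· < a') := fun h => by
    rw [Finset.mem_filter]; exact ⟨h, by omega⟩
  have h10 : bead kap a' = 1 := by
    rcases h6 with h6 | h6
    · split_ifs at h5 <;> omega
    · rw [if_pos (h9 h6)] at h5; omega
  rw [bead, ← hk, ← hk] at h10
  omega

lemma exists_next {n : ℕ} {A : Finset ℤ} {a : ℤ} (hf : IsFollowed n A a) :
    ∃ a' ∈ A, a < a' ∧ a' ≤ a + n ∧ ∀ b ∈ A, ¬ (a < b ∧ b < a') := by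
  obtain ⟨d, hd, h1, h2⟩ := hf
  have hne : (A.filter (a < ·)).Nonempty := ⟨d, by simp [hd, h1]⟩
  have h3 := (A.filter (a < ·)).min'_mem hne
  have hmin : ∀ b ∈ A, a < b → (A.filter (a < ·)).min' hne ≤ b := fun b hb hab =>
    Finset.min'_le _ _ (by simp [hb, hab])
  rw [Finset.mem_filter] at h3
  refine ⟨_, h3.1, h3.2, (hmin d hd h1).trans h2, fun b hb h => ?_⟩
  have := hmin b hb h.1
  omega

lemma isConnectedShape_run {n : ℕ} (hn : 1 ≤ n) {lam : YoungDiagram} {A : Finset ℤ}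
    (h : IsAddable n lam A) {m : ℤ} (hm : m ∈ A) :
    IsConnectedShape (cellsOf ((run n A m).image (tile n lam A))) := by
  set S := cellsOf ((run n A m).image (tile n lam A)) with hS
  have hsub : ∀ a ∈ run n A m, tile n lam A a ⊆ S := fun a ha x hx =>
    mem_cellsOf_image.2 ⟨a, ha, hx⟩
  obtain ⟨x₀, hx₀⟩ := tile_nonempty hn lam A m
  refine isConnectedShape_iff.2 ⟨⟨x₀, hsub m (self_mem_run hm) hx₀⟩, ?_⟩
  rintro P ⟨z, hz, hPz⟩ hP
  have htile : ∀ a ∈ run n A m, (∃ x ∈ tile n lam A a, P x) → ∀ y ∈ tile n lam A a, P y :=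
    fun a ha hex => h.tile_induction hn
      (fun x hx y hy => hP x (hsub a ha hx) y (hsub a ha hy)) hex
  have hnext : ∀ a ∈ run n A m, a ≠ m → ∃ a' ∈ run n A m, a < a' ∧
      ∃ x ∈ tile n lam A a, ∃ y ∈ tile n lam A a', (SimpleGraph.hasse (ℕ × ℕ)).Adj x y := by
    intro a ha hne
    obtain ⟨h1, h2, h3⟩ := mem_run.1 ha
    obtain ⟨a', h4, h5, h6, h7⟩ := exists_next (h3 a h1 le_rfl (by omega))
    have h8 : a' ≤ m := by
      by_contra! h8; exact h7 m hm ⟨by omega, h8⟩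
    exact ⟨a', mem_run.2 ⟨h4, h8, fun y hy h9 => h3 y hy (by omega)⟩, h5,
      h.exists_adj_tile hn h1 h4 h5 h6 h7⟩
  -- go up from any ribbon to the last one, and down again
  have hind : ∀ k : ℕ, ∀ a ∈ run n A m, m - a ≤ k →
      ((∃ x ∈ tile n lam A a, P x) ↔ ∃ x ∈ tile n lam A m, P x) := by
    intro k
    induction k with
    | zero =>
      intro a ha hk
      have := (mem_run.1 ha).2.1
      rw [show a = m by push_cast at hk; omega]
    | succ k ih =>
      intro a ha hk
      rcases eq_or_ne a m with rfl | hne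
      · rfl
      obtain ⟨a', ha', h1, x, hx, y, hy, hadj⟩ := hnext a ha hne
      rw [← ih a' ha' (by push_cast at hk; omega)]
      constructor
      · intro hex
        exact ⟨y, hy, hP x (hsub a ha hx) y (hsub a' ha' hy) hadj (htile a ha hex x hx)⟩
      · intro hex
        exact ⟨x, hx, hP y (hsub a' ha' hy) x (hsub a ha hx) hadj.symm (htile a' ha' hex y hy)⟩
  have hall : ∀ a ∈ run n A m,
      ((∃ x ∈ tile n lam A a, P x) ↔ ∃ x ∈ tile n lam A m, P x) := fun a ha =>
    hind (m - a).toNat a ha (by omega)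
  obtain ⟨a, ha, hza⟩ := mem_cellsOf_image.1 hz
  have hPm := (hall a ha).1 ⟨z, hza, hPz⟩
  intro y hy
  obtain ⟨b, hb, hyb⟩ := mem_cellsOf_image.1 hy
  exact htile b hb ((hall b hb).2 hPm) y hyb

/-- In a connected collection of ribbons the gaps between the positions are at most `n`. -/
lemma isFollowed_of_isConnectedShape {n : ℕ} (hn : 1 ≤ n) {lam : YoungDiagram}
    {A A₀ : Finset ℤ} (hc : IsConnectedShape (cellsOf (A₀.image (tile n lam A)))) {a b : ℤ}
    (ha : a ∈ A₀) (hb : b ∈ A₀) (hab : a < b) : IsFollowed n A₀ a := by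
  by_contra hnf
  obtain ⟨x, hx⟩ := tile_nonempty hn lam A a
  obtain ⟨y, hy⟩ := tile_nonempty hn lam A b
  have := (isConnectedShape_iff.1 hc).2 (fun z => content z < a + n)
    ⟨x, mem_cellsOf_image.2 ⟨a, ha, hx⟩, (mem_tile.1 hx).2.1⟩ ?_ y
    (mem_cellsOf_image.2 ⟨b, hb, hy⟩)
  · have h1 := (mem_tile.1 hy).1
    exact hnf ⟨b, hb, hab, by omega⟩
  · intro u _ w hw hadj hu
    obtain ⟨d, hd, hwd⟩ := mem_cellsOf_image.1 hw
    have h1 := (mem_tile.1 hwd).1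
    have h2 := (mem_tile.1 hwd).2.1
    have h3 := hasse_adj_content hadj
    by_contra h4
    refine hnf ⟨d, hd, by omega, by omega⟩

lemma subset_run_of_isConnectedShape {n : ℕ} (hn : 1 ≤ n) {lam : YoungDiagram}
    {A A₀ : Finset ℤ} (hsub : A₀ ⊆ A)
    (hc : IsConnectedShape (cellsOf (A₀.image (tile n lam A)))) {m : ℤ} (hm : m ∈ A₀)
    (hmax : ∀ a ∈ A₀, a ≤ m) : A₀ ⊆ run n A m := by
  intro x hx
  refine mem_run.2 ⟨hsub hx, hmax x hx, fun y hy h1 h2 => ?_⟩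
  have hne : (A₀.filter (· ≤ y)).Nonempty := ⟨x, by simp [hx, h1]⟩
  have ha := (A₀.filter (· ≤ y)).max'_mem hne
  have hlast : ∀ b ∈ A₀, b ≤ y → b ≤ (A₀.filter (· ≤ y)).max' hne := fun b hb hby =>
    Finset.le_max' _ _ (by simp [hb, hby])
  generalize (A₀.filter (· ≤ y)).max' hne = a at ha hlast
  rw [Finset.mem_filter] at ha
  obtain ⟨a', h3, h4, h5⟩ := isFollowed_of_isConnectedShape hn hc ha.1 hm (by omega)
  refine ⟨a', hsub h3, ?_, by omega⟩
  by_contra! h6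
  have := hlast a' h3 h6
  omega

lemma subset_tiles_iff {n : ℕ} {lam : YoungDiagram} {A : Finset ℤ} {C : RibbonSet}
    (hC : C ⊆ tiles n lam A) : ∃ A₀ ⊆ A, C = A₀.image (tile n lam A) := by
  refine ⟨A.filter fun a => tile n lam A a ∈ C, Finset.filter_subset _ _, ?_⟩
  ext r
  simp only [Finset.mem_image, Finset.mem_filter]
  constructor
  · intro hr
    obtain ⟨a, ha, rfl⟩ := Finset.mem_image.1 (hC hr)
    exact ⟨a, ⟨ha, hr⟩, rfl⟩
  · rintro ⟨a, ⟨-, ha⟩, rfl⟩; exact ha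

lemma image_tile_subset_iff {n : ℕ} (hn : 1 ≤ n) {lam : YoungDiagram} {A A₁ A₂ : Finset ℤ} :
    A₁.image (tile n lam A) ⊆ A₂.image (tile n lam A) ↔ A₁ ⊆ A₂ :=
  Finset.image_subset_image_iff fun _ _ => tile_injective hn

lemma IsAddable.nonempty_of_isConnectedShape {n : ℕ} {lam : YoungDiagram} {A A₀ : Finset ℤ}
    (hc : IsConnectedShape (cellsOf (A₀.image (tile n lam A)))) : A₀.Nonempty := by
  obtain ⟨x, hx⟩ := (isConnectedShape_iff.1 hc).1
  obtain ⟨a, ha, -⟩ := mem_cellsOf_image.1 hx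
  exact ⟨a, ha⟩

/-- The connected components of a horizontal strip are the runs that lead to its ends. -/
lemma IsAddable.isComponent_iff {n : ℕ} (hn : 1 ≤ n) {lam : YoungDiagram} {A : Finset ℤ}
    (h : IsAddable n lam A) {C : RibbonSet} :
    IsComponent (tiles n lam A) C ↔ ∃ m ∈ ends n A, C = (run n A m).image (tile n lam A) := by
  constructor
  · rintro ⟨hsub, hconn, hmax⟩
    obtain ⟨A₀, hA₀, rfl⟩ := subset_tiles_iff hsub
    have hne := nonempty_of_isConnectedShape hconn
    have hm := A₀.max'_mem hne
    have hle : ∀ a ∈ A₀, a ≤ A₀.max' hne := fun a ha => A₀.le_max' a ha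
    generalize A₀.max' hne = m at hm hle
    have hrun := subset_run_of_isConnectedShape hn hA₀ hconn hm hle
    have heq := hmax _ (Finset.image_subset_image (isInitial_run n A m).1)
      ((image_tile_subset_iff hn).2 hrun) (isConnectedShape_run hn h (hA₀ hm))
    refine ⟨m, mem_ends.2 ⟨hA₀ hm, fun ⟨m', hm', h1, h2⟩ => ?_⟩, heq.symm⟩
    -- a run that leads beyond `m` would be a larger connected set
    have hsub' : A₀ ⊆ run n A m' := fun x hx => by
      obtain ⟨h3, h4, h5⟩ := mem_run.1 (hrun hx)
      refine mem_run.2 ⟨h3, by omega, fun y hy h6 h7 => ?_⟩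
      by_cases h8 : y < m
      · exact h5 y hy h6 h8
      · exact ⟨m', hm', h7, by omega⟩
    have heq' := hmax _ (Finset.image_subset_image (isInitial_run n A m').1)
      ((image_tile_subset_iff hn).2 hsub') (isConnectedShape_run hn h hm')
    have := hle m' ((image_tile_subset_iff hn).1 heq'.le (self_mem_run hm'))
    omega
  · rintro ⟨m, hm, rfl⟩
    obtain ⟨hmA, hnf⟩ := mem_ends.1 hm
    refine ⟨Finset.image_subset_image (isInitial_run n A m).1, isConnectedShape_run hn h hmA, ?_⟩
    intro D hD hCD hconn
    obtain ⟨A₀, hA₀, rfl⟩ := subset_tiles_iff hD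
    have hsub := (image_tile_subset_iff hn).1 hCD
    have hm₀ := hsub (self_mem_run hmA)
    have hle : ∀ a ∈ A₀, a ≤ m := fun a ha => by
      by_contra! hlt
      exact hnf ((isFollowed_of_isConnectedShape hn hconn hm₀ ha hlt).mono hA₀)
    rw [(subset_run_of_isConnectedShape hn hA₀ hconn hm₀ hle).antisymm hsub]

lemma IsAddable.numComponents_tiles {n : ℕ} (hn : 1 ≤ n) {lam : YoungDiagram} {A : Finset ℤ}
    (h : IsAddable n lam A) : numComponents (tiles n lam A) = (ends n A).card := by
  rw [numComponents, eq_comm]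
  refine Finset.card_bij (fun m _ => (run n A m).image (tile n lam A)) ?_ ?_ ?_
  · intro m hm
    rw [Finset.mem_filter, Finset.mem_powerset]
    exact ⟨Finset.image_subset_image (isInitial_run n A m).1, (h.isComponent_iff hn).2 ⟨m, hm, rfl⟩⟩
  · intro m hm m' hm' e
    have e' : run n A m = run n A m' :=
      ((image_tile_subset_iff hn).1 e.le).antisymm ((image_tile_subset_iff hn).1 e.ge)
    have := congrArg (ends n) e'
    rwa [ends_run (mem_ends.1 hm).1, ends_run (mem_ends.1 hm').1, Finset.singleton_inj] at this
  · intro C hC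
    obtain ⟨m, hm, e⟩ := (h.isComponent_iff hn).1 (Finset.mem_filter.1 hC).2
    exact ⟨m, hm, e.symm⟩

lemma IsAddable.isConnectedShape_tiles_iff {n : ℕ} (hn : 1 ≤ n) {lam : YoungDiagram}
    {A : Finset ℤ} (h : IsAddable n lam A) :
    IsConnectedShape (cellsOf (tiles n lam A)) ↔ (ends n A).card = 1 := by
  rw [← h.numComponents_tiles hn, numComponents]
  constructor
  · intro hc
    rw [Finset.card_eq_one]
    refine ⟨tiles n lam A, ?_⟩
    ext C
    rw [Finset.mem_filter, Finset.mem_powerset, Finset.mem_singleton]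
    constructor
    · rintro ⟨h1, h2⟩; exact (h2.2.2 _ le_rfl h1 hc).symm
    · rintro rfl; exact ⟨le_rfl, le_rfl, hc, fun D h1 h2 _ => h1.antisymm h2⟩
  · intro hc
    rw [← numComponents, h.numComponents_tiles hn, Finset.card_eq_one] at hc
    obtain ⟨m, hm⟩ := hc
    have hmA : m ∈ A := (mem_ends.1 (hm ▸ Finset.mem_singleton_self m)).1
    have hrun : run n A m = A := by
      have hne : A.Nonempty := ⟨m, hmA⟩
      have hmax := max'_mem_ends (n := n) hne
      rw [hm, Finset.mem_singleton] at hmax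
      refine (isInitial_run n A m).1.antisymm fun x hx => mem_run.2 ⟨hx, ?_, fun y hy _ h2 => ?_⟩
      · rw [← hmax]; exact A.le_max' x hx
      · by_contra hnf
        have : y ∈ ends n A := mem_ends.2 ⟨hy, hnf⟩
        rw [hm, Finset.mem_singleton] at this
        omega
    have := isConnectedShape_run hn h hmA
    rwa [hrun] at this

/-! ### Attached components -/

lemma cellsOf_union (T U : RibbonSet) : cellsOf (T ∪ U) = cellsOf T ∪ cellsOf U := by
  ext x; simp only [mem_cellsOf, Finset.mem_union]; grind

lemma skewCells_union {lam nu mu : YoungDiagram} (h : lam ≤ nu) (h' : nu ≤ mu) :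
    skewCells nu lam ∪ skewCells mu nu = skewCells mu lam := by
  ext x
  have h1 := le_iff_rim_le.1 h (content x)
  have h2 := le_iff_rim_le.1 h' (content x)
  simp only [Finset.mem_union, mem_skewCells]
  omega

/-- A strip touches the preceding one from below when one of its positions is followed there. -/
lemma HStrip.touchesFromBelow_iff {n : ℕ} (hn : 1 ≤ n) {lam nu mu : YoungDiagram}
    {A B : Finset ℤ} (hA : HStrip n lam A nu) (hB : HStrip n nu B mu) :
    TouchesFromBelow n (tiles n lam A) (tiles n nu B) ↔ ∃ c ∈ B, IsFollowed n A c := by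
  have hcells : cellsOf (tiles n lam A ∪ tiles n nu B) = skewCells mu lam := by
    rw [cellsOf_union, hA.cellsOf_tiles, hB.cellsOf_tiles, skewCells_union hA.le hB.le]
  rw [TouchesFromBelow, hcells]
  constructor
  · intro hT
    by_contra! hf
    obtain ⟨-, hAB, -⟩ := hA.union hn hB hf
    exact hT (hA.tiles_union hn hB hf ▸ hAB.isHorizontalRibbonStrip hn)
  · rintro ⟨c, hc, a, ha, h1, h2⟩ hT
    obtain ⟨hD, heq⟩ := hT.exists_hStrip hn (hA.le.trans hB.le)
    rw [Finset.image_union, image_pos_tiles hn, image_pos_tiles hn] at hD heq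
    have hta : tile n lam (A ∪ B) a = tile n lam A a := by
      have : tile n lam A a ∈ tiles n lam (A ∪ B) :=
        heq ▸ Finset.mem_union_left _ (Finset.mem_image_of_mem _ ha)
      obtain ⟨a', -, e⟩ := Finset.mem_image.1 this
      obtain rfl := tile_injective hn e
      exact e
    have htc : tile n lam (A ∪ B) c = tile n nu B c := by
      have : tile n nu B c ∈ tiles n lam (A ∪ B) :=
        heq ▸ Finset.mem_union_right _ (Finset.mem_image_of_mem _ hc)
      obtain ⟨a', -, e⟩ := Finset.mem_image.1 this
      obtain rfl := tile_injective hn e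
      exact e
    have hout : ∀ b ∈ A, ∀ x ∈ tile n lam A b, (x.1 : ℤ) < rim nu (content x) := fun b hb x hx => by
      have : x ∈ skewCells nu lam := hA.cellsOf_tiles ▸ mem_cellsOf_image.2 ⟨b, hb, hx⟩
      exact (mem_skewCells.1 this).2
    rcases h2.lt_or_eq with h3 | h3
    · -- the ribbon at `c` would lie above the ribbon at `a` on the diagonal of content `a`
      have h4 := tileRim_lt_tileRim (n := n) (lam := lam) (Finset.mem_union_right A hc) h1 h1.le h3
      have hx := cellAt_mem_tile (n := n) (lam := lam) (A := A ∪ B) (le_refl a) (by omega)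
      have hy := cellAt_mem_tile (n := n) (lam := lam) (A := A ∪ B) h1.le h3
      have hp := tileRim_nonneg n lam (A ∪ B) a a
      have hq := tileRim_nonneg n lam (A ∪ B) c a
      rw [hta] at hx
      rw [htc, mem_tile] at hy
      have h5 := hout a ha _ hx
      have h6 := rim_le_tileRim n nu B c a
      rw [content_cellAt hq.1 hq.2] at hy
      rw [content_cellAt hp.1 hp.2, fst_cellAt hp.1] at h5
      have h7 := hy.2.2
      rw [fst_cellAt hq.1] at h7
      omega
    · -- the bead that moves from `c` would have to move to the place of a bead
      have h4 := (hD.1 c (Finset.mem_union_right A hc)).1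
      rw [← h3] at h4
      have h5 := (hA.1 a ha).2.resolve_left (by omega)
      rw [show a - (n : ℤ) = c by omega] at h5
      have h6 : tile n lam A c = tile n nu B c := by
        rw [← htc]
        have : tile n lam A c ∈ tiles n lam (A ∪ B) :=
          heq ▸ Finset.mem_union_left _ (Finset.mem_image_of_mem _ h5)
        obtain ⟨a', -, e⟩ := Finset.mem_image.1 this
        rw [← e, tile_injective hn e]
      obtain ⟨x, hx⟩ := tile_nonempty hn lam A c
      have h7 := hout c h5 x hx
      rw [h6, mem_tile] at hx
      have := rim_le_tileRim n nu B c (content x)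
      omega

/-- A subset of the ribbons of a connected strip that can be added by itself and that contains
the last ribbon contains all of them. -/
lemma run_subset_of_subset_tiles {n : ℕ} (hn : 1 ≤ n) {nu mu : YoungDiagram}
    {A R : Finset ℤ} {m : ℤ} (hA : IsAddable n nu A) (hR : HStrip n nu R mu)
    (hsub : tiles n nu R ⊆ (run n A m).image (tile n nu A)) (hm : m ∈ R) : run n A m ⊆ R := by
  have htile : ∀ a ∈ R, a ∈ run n A m ∧ tile n nu R a = tile n nu A a := fun a ha => by
    obtain ⟨a', ha', e⟩ := Finset.mem_image.1 (hsub (Finset.mem_image_of_mem _ ha))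
    have := tile_injective hn e
    subst this
    exact ⟨ha', e.symm⟩
  -- consider the last ribbon of the component that is missing, and the one that follows it
  by_contra hno
  obtain ⟨x, hx, hxR⟩ := Finset.not_subset.1 hno
  have hne : ((run n A m).filter (· ∉ R)).Nonempty := ⟨x, by simp [hx, hxR]⟩
  have hz := ((run n A m).filter (· ∉ R)).max'_mem hne
  have hmax : ∀ y ∈ run n A m, y ∉ R → y ≤ ((run n A m).filter (· ∉ R)).max' hne :=
    fun y hy hyR => Finset.le_max' _ _ (by simp [hy, hyR])
  generalize ((run n A m).filter (· ∉ R)).max' hne = z at hz hmax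
  obtain ⟨hz, hzR⟩ := Finset.mem_filter.1 hz
  obtain ⟨h1, h2, h3⟩ := mem_run.1 hz
  have hzm : z ≠ m := fun e => hzR (e ▸ hm)
  obtain ⟨y, h4, h5, h6, h7⟩ := exists_next (h3 z h1 le_rfl (by omega))
  have hmA : m ∈ A := (mem_run.1 (htile m hm).1).1
  have h8 : y ≤ m := by by_contra! h8; exact h7 m hmA ⟨by omega, h8⟩
  have hyrun : y ∈ run n A m := mem_run.2 ⟨h4, h8, fun w hw h9 => h3 w hw (by omega)⟩
  have hyR : y ∈ R := by
    by_contra h9; have := hmax y hyrun h9; omega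
  rcases h6.lt_or_eq with h9 | h9
  · -- without the ribbon at `z` the next one would lie higher on the diagonal of content `y`
    have hx := cellAt_mem_tile (n := n) (lam := nu) (A := R) (le_refl y) (by omega)
    rw [(htile y hyR).2, mem_tile, content_cellAt (tileRim_nonneg ..).1 (tileRim_nonneg ..).2,
      fst_cellAt (tileRim_nonneg ..).1, tileRim, tileRim] at hx
    have : cov n (R.filter (· < y)) y < cov n (A.filter (· < y)) y := by
      refine cov_lt_cov (a := z) ?_ (by simp [h1, h5]) (by simp [hzR]) h5.le h9
      intro w hw
      rw [Finset.mem_filter] at hw ⊢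
      exact ⟨(mem_run.1 (htile w hw.1).1).1, hw.2⟩
    have := hx.2.2
    omega
  · -- the bead that moves from `y = z + n` has to come there from `z` first
    have h10 := (hA z h1).1
    rw [← h9] at h10
    have h11 := (hR.1 y hyR).2.resolve_left (by omega)
    rw [show y - (n : ℤ) = z by omega] at h11
    exact hzR h11

/-- A connected component is attached when its last ribbon touches the preceding part, and no
other ribbon does. -/
lemma HStrip.isAttached_run_iff {n : ℕ} (hn : 1 ≤ n) {lam nu mu : YoungDiagram}
    {A' A : Finset ℤ} (hA' : HStrip n lam A' nu) (hA : HStrip n nu A mu) {m : ℤ} (hm : m ∈ A) :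
    IsAttached n nu (tiles n lam A') ((run n A m).image (tile n nu A)) ↔
      IsFollowed n A' m ∧ ∀ c ∈ run n A m, c < m → ¬ IsFollowed n A' c := by
  have hrun := isInitial_run n A m
  obtain ⟨kap, hkap, -⟩ := hA.split hn hrun
  have hmrun := self_mem_run (n := n) hm
  have hpre : IsInitial n A ((run n A m).filter (· < m)) := by
    refine ⟨(Finset.filter_subset _ _).trans hrun.1, fun a ha b hb h1 h2 => ?_⟩
    rw [Finset.mem_filter] at ha ⊢
    exact ⟨hrun.2 a ha.1 b hb h1 h2, h2.trans ha.2⟩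
  obtain ⟨kap', hkap', -⟩ := hA.split hn hpre
  rw [IsAttached, ← tiles_of_isInitial hrun, hA'.touchesFromBelow_iff hn hkap]
  constructor
  · rintro ⟨⟨c, hc, hf⟩, hmin⟩
    -- the component without its last ribbon can be added by itself
    have hno : ∀ c ∈ run n A m, c < m → ¬ IsFollowed n A' c := by
      have h1 := hmin (tiles n nu ((run n A m).filter (· < m))) ?_ ?_
      · rw [hA'.touchesFromBelow_iff hn hkap'] at h1
        intro c hc hcm hf
        exact h1 ⟨c, Finset.mem_filter.2 ⟨hc, hcm⟩, hf⟩
      · rw [tiles_of_isInitial hpre, tiles_of_isInitial hrun, Finset.ssubset_iff_subset_ne]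
        refine ⟨Finset.image_subset_image (Finset.filter_subset _ _), fun e => ?_⟩
        have := (image_tile_subset_iff hn).1 e.ge hmrun
        simp at this
      · rw [hkap'.cellsOf_tiles]
        have : nu.cells ∪ skewCells kap' nu = kap'.cells :=
          Finset.union_sdiff_of_subset (YoungDiagram.cells_subset_iff.2 hkap'.le)
        rw [this]
        exact kap'.isLowerSet
    refine ⟨?_, hno⟩
    rcases (mem_run.1 hc).2.1.lt_or_eq with h1 | rfl
    · exact absurd hf (hno c hc h1)
    · exact hf
  · rintro ⟨hf, hno⟩
    refine ⟨⟨m, hmrun, hf⟩, fun C' hC' hlow => ?_⟩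
    -- a part of the component that can be added by itself is again a horizontal strip
    let kap₁ : YoungDiagram := ⟨nu.cells ∪ cellsOf C', hlow⟩
    have hdis : Disjoint nu.cells (cellsOf C') := by
      rw [Finset.disjoint_left]
      intro x hx hx'
      obtain ⟨r, hr, hxr⟩ := mem_cellsOf.1 hx'
      have : x ∈ skewCells kap nu := hkap.cellsOf_tiles ▸ mem_cellsOf.2 ⟨r, hC'.1 hr, hxr⟩
      exact (Finset.mem_sdiff.1 this).2 hx
    have hsk : skewCells kap₁ nu = cellsOf C' := by
      change (nu.cells ∪ cellsOf C') \ nu.cells = _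
      exact Finset.union_sdiff_cancel_left hdis
    have hle : nu ≤ kap₁ := YoungDiagram.cells_subset_iff.1 Finset.subset_union_left
    have hhor : IsHorizontalRibbonStrip n (skewCells kap₁ nu) C' := by
      obtain ⟨-, ⟨h1, h2, -⟩, h3⟩ := hkap.isHorizontalRibbonStrip hn
      refine ⟨⟨nu, kap₁, hle, rfl⟩, ⟨fun r hr => h1 r (hC'.1 hr), h2.subset hC'.1, hsk.symm⟩,
        fun r hr c hc i hi hmem => h3 r (hC'.1 hr) c hc i hi ?_⟩
      rw [hsk] at hmem
      obtain ⟨s, hs, hx⟩ := mem_cellsOf.1 hmem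
      exact hkap.cellsOf_tiles ▸ mem_cellsOf.2 ⟨s, hC'.1 hs, hx⟩
    obtain ⟨hR, heq⟩ := hhor.exists_hStrip hn hle
    generalize C'.image pos = R at hR heq
    subst heq
    rw [hA'.touchesFromBelow_iff hn hR]
    rintro ⟨c, hc, hfc⟩
    have hCsub := hC'.1
    rw [tiles_of_isInitial hrun] at hCsub
    have hcrun : c ∈ run n A m := by
      obtain ⟨a', ha', e⟩ := Finset.mem_image.1 (hCsub (Finset.mem_image_of_mem _ hc))
      exact tile_injective hn e ▸ ha'
    rcases (mem_run.1 hcrun).2.1.lt_or_eq with h1 | rfl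
    · exact hno c hcrun h1 hfc
    · have h2 := run_subset_of_subset_tiles hn hA.1 hR hCsub hc
      refine hC'.2 fun r hr => ?_
      obtain ⟨a, ha, rfl⟩ := Finset.mem_image.1 (tiles_of_isInitial hrun nu ▸ hr)
      obtain ⟨a', ha', e⟩ := Finset.mem_image.1 (hCsub (Finset.mem_image_of_mem _ (h2 ha)))
      rw [← tile_injective hn e, e]
      exact Finset.mem_image_of_mem _ (h2 ha)

/-- All the components of a part of a border ribbon strip are attached to the preceding part when
the ends of the runs are the positions followed there. -/
theorem HStrip.isAttached_iff_isJoined {n : ℕ} (hn : 1 ≤ n) {lam nu mu : YoungDiagram}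
    {A' A : Finset ℤ} (hA' : HStrip n lam A' nu) (hA : HStrip n nu A mu) :
    (∀ C, IsComponent (tiles n nu A) C → IsAttached n nu (tiles n lam A') C) ↔
      IsJoined n A' A := by
  constructor
  · intro h c hc
    -- `m` is the end of the run that contains `c`
    have hne : ((ends n A).filter (c ≤ ·)).Nonempty := by
      refine ⟨A.max' ⟨c, hc⟩, Finset.mem_filter.2 ⟨max'_mem_ends _, A.le_max' c hc⟩⟩
    have hm := ((ends n A).filter (c ≤ ·)).min'_mem hne
    have hmin : ∀ e ∈ ends n A, c ≤ e → ((ends n A).filter (c ≤ ·)).min' hne ≤ e :=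
      fun e he hce => Finset.min'_le _ _ (Finset.mem_filter.2 ⟨he, hce⟩)
    generalize ((ends n A).filter (c ≤ ·)).min' hne = m at hm hmin
    obtain ⟨hm, hcm⟩ := Finset.mem_filter.1 hm
    obtain ⟨hmA, hmf⟩ := mem_ends.1 hm
    obtain ⟨h1, h2⟩ := (hA'.isAttached_run_iff hn hA hmA).1
      (h _ ((hA.1.isComponent_iff hn).2 ⟨m, hm, rfl⟩))
    have hfol : ∀ y ∈ A, c ≤ y → y < m → IsFollowed n A y := fun y hy hcy hym => by
      by_contra hnf
      have := hmin y (mem_ends.2 ⟨hy, hnf⟩) hcy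
      omega
    rcases hcm.lt_or_eq with hlt | rfl
    · have h3 := h2 c (mem_run.2 ⟨hc, hcm, hfol⟩) hlt
      have h4 := hfol c hc le_rfl hlt
      tauto
    · tauto
  · intro h C hC
    obtain ⟨m, hm, rfl⟩ := (hA.1.isComponent_iff hn).1 hC
    obtain ⟨hmA, hmf⟩ := mem_ends.1 hm
    refine (hA'.isAttached_run_iff hn hA hmA).2 ⟨(h m hmA).2 hmf, fun c hc hcm hf => ?_⟩
    obtain ⟨h1, h2, h3⟩ := mem_run.1 hc
    exact (h c h1).1 hf (h3 c h1 le_rfl hcm)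

/-! ### Border ribbon strips -/

/-- A ribbon whose position is followed in the preceding strip shares an edge with that strip. -/
lemma HStrip.exists_adj_of_isFollowed {n : ℕ} {lam nu mu : YoungDiagram}
    {A' A : Finset ℤ} (hA' : HStrip n lam A' nu) (hA : HStrip n nu A mu) {c : ℤ} (hc : c ∈ A)
    (hf : IsFollowed n A' c) : ∃ x ∈ tile n nu A c, ∃ y ∈ skewCells nu lam,
      (SimpleGraph.hasse (ℕ × ℕ)).Adj x y := by
  obtain ⟨a, ha, h1, h2⟩ := hf
  have hx := cellAt_mem_tile (n := n) (lam := nu) (A := A) (a := c) (c := c + n - 1) (by omega)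
    (by omega)
  rw [tileRim_last n nu A le_rfl] at hx
  have h3 := (hA.1 c hc).1
  rw [bead] at h3
  have h4 := hA'.2 (c + n)
  have h5 : cov n ∅ (c + n) < cov n A' (c + n) :=
    cov_lt_cov (Finset.empty_subset _) ha (by simp) h2 (by omega)
  rw [cov_empty] at h5
  have h6 := rim_nonneg lam (c + n)
  have h7 := rim_add_nonneg lam (c + n)
  refine ⟨_, hx, cellAt (c + n) (rim nu (c + n - 1) - 1), ?_, ?_⟩
  · rw [mem_skewCells, content_cellAt (by omega) (by omega), fst_cellAt (by omega)]
    omega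
  · rw [hasse_adj_iff]; simp only [cellAt]; omega

/-- Adding a strip that is joined to the last part keeps a connected shape connected. -/
lemma HStrip.isConnectedShape_skewCells {n : ℕ} (hn : 1 ≤ n) {kap lam nu mu : YoungDiagram}
    {A' A : Finset ℤ} (hA' : HStrip n lam A' nu) (hA : HStrip n nu A mu) (hj : IsJoined n A' A)
    (hle : kap ≤ lam) (hc : IsConnectedShape (skewCells nu kap)) :
    IsConnectedShape (skewCells mu kap) := by
  have hunion := skewCells_union (hle.trans hA'.le) hA.le
  have hsub : skewCells nu kap ⊆ skewCells mu kap := hunion ▸ Finset.subset_union_left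
  have htile : ∀ a ∈ A, tile n nu A a ⊆ skewCells mu kap := fun a ha x hx =>
    hunion ▸ Finset.mem_union_right _ (hA.cellsOf_tiles ▸ mem_cellsOf_image.2 ⟨a, ha, hx⟩)
  have hsub' : skewCells nu lam ⊆ skewCells nu kap := fun x hx => by
    rw [mem_skewCells] at hx ⊢
    exact ⟨(le_iff_rim_le.1 hle _).trans hx.1, hx.2⟩
  obtain ⟨⟨x₀, hx₀⟩, hcon⟩ := isConnectedShape_iff.1 hc
  refine isConnectedShape_iff.2 ⟨⟨x₀, hsub hx₀⟩, ?_⟩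
  rintro P ⟨z, hz, hPz⟩ hP
  have hbase : (∃ x ∈ skewCells nu kap, P x) → ∀ y ∈ skewCells nu kap, P y := fun hex =>
    hcon P hex fun x hx y hy => hP x (hsub hx) y (hsub hy)
  have hstep : ∀ a ∈ A, (∃ x ∈ tile n nu A a, P x) → ∀ y ∈ tile n nu A a, P y := fun a ha hex =>
    hA.1.tile_induction hn (fun x hx y hy => hP x (htile a ha hx) y (htile a ha hy)) hex
  obtain ⟨M, hM⟩ : ∃ M, ∀ a ∈ A, a ≤ M := ⟨∑ a ∈ A, |a|, fun a ha =>
    (le_abs_self a).trans (Finset.single_le_sum (f := fun a => |a|) (fun _ _ => abs_nonneg _) ha)⟩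
  -- each ribbon is linked to the following one, or to the preceding part if none follows
  have hind : ∀ k : ℕ, ∀ a ∈ A, M - a ≤ k →
      ((∃ x ∈ tile n nu A a, P x) ↔ ∃ x ∈ skewCells nu kap, P x) := by
    intro k
    induction k using Nat.strong_induction_on with
    | _ k ih =>
      intro a ha hk
      by_cases hf : IsFollowed n A a
      · obtain ⟨b, hb, h1, h2, h3⟩ := exists_next hf
        have hbM := hM b hb
        obtain ⟨x, hx, y, hy, hadj⟩ := hA.1.exists_adj_tile hn ha hb h1 h2 h3
        rw [← ih (k - 1) (by omega) b hb (by omega)]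
        exact ⟨fun hex => ⟨y, hy, hP x (htile a ha hx) y (htile b hb hy) hadj
            (hstep a ha hex x hx)⟩,
          fun hex => ⟨x, hx, hP y (htile b hb hy) x (htile a ha hx) hadj.symm
            (hstep b hb hex y hy)⟩⟩
      · obtain ⟨x, hx, y, hy, hadj⟩ := hA'.exists_adj_of_isFollowed hA ha ((hj a ha).2 hf)
        exact ⟨fun hex => ⟨y, hsub' hy, hP x (htile a ha hx) y (hsub (hsub' hy)) hadj
            (hstep a ha hex x hx)⟩,
          fun hex => ⟨x, hx, hP y (hsub (hsub' hy)) x (htile a ha hx) hadj.symm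
            (hbase hex y (hsub' hy))⟩⟩
  have hall : ∀ a ∈ A, ((∃ x ∈ tile n nu A a, P x) ↔ ∃ x ∈ skewCells nu kap, P x) :=
    fun a ha => hind (M - a).toNat a ha (by have := hM a ha; omega)
  have hex : ∃ x ∈ skewCells nu kap, P x := by
    rw [← hunion, Finset.mem_union, ← hA.cellsOf_tiles] at hz
    rcases hz with hz | hz
    · exact ⟨z, hz, hPz⟩
    · obtain ⟨a, ha, hza⟩ := mem_cellsOf_image.1 hz
      exact (hall a ha).1 ⟨z, hza, hPz⟩
  intro y hy
  rw [← hunion, Finset.mem_union, ← hA.cellsOf_tiles] at hy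
  rcases hy with hy | hy
  · exact hbase hex y hy
  · obtain ⟨a, ha, hya⟩ := mem_cellsOf_image.1 hy
    exact hstep a ha ((hall a ha).2 hex) y hya

/-- The positions of the ribbons in the last part of a border ribbon strip. -/
def lastPos (L : List RibbonSet) : Finset ℤ := L.headI.image pos

lemma BorderChain.exists_hStrip {n : ℕ} (hn : 1 ≤ n) {lam mu : YoungDiagram} {L : List RibbonSet}
    (h : BorderChain n lam mu L) : ∃ nu, lam ≤ nu ∧ HStrip n nu (lastPos L) mu ∧
      L.headI = tiles n nu (lastPos L) := by
  cases h with
  | single _ T hle hne hT hconn =>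
    obtain ⟨h1, h2⟩ := hT.exists_hStrip hn hle
    exact ⟨lam, le_rfl, h1, h2⟩
  | extend nu _ T T' L hL hle hne hT hatt =>
    obtain ⟨h1, h2⟩ := hT.exists_hStrip hn hle
    refine ⟨nu, ?_, h1, h2⟩
    clear h1 h2 hatt hT hle
    generalize hL' : T' :: L = L' at hL
    clear hL'
    induction hL with
    | single _ _ hle => exact hle
    | extend _ _ _ _ _ _ hle _ _ _ ih => exact ih.trans hle

lemma BorderChain.le {n : ℕ} (hn : 1 ≤ n) {lam mu : YoungDiagram} {L : List RibbonSet}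
    (h : BorderChain n lam mu L) : lam ≤ mu := by
  obtain ⟨nu, h1, h2, -⟩ := h.exists_hStrip hn
  exact h1.trans h2.le

lemma borderChain_singleton_iff {n : ℕ} (hn : 1 ≤ n) {lam mu : YoungDiagram} {T : RibbonSet} :
    BorderChain n lam mu [T] ↔
      ∃ A, HStrip n lam A mu ∧ T = tiles n lam A ∧ (ends n A).card = 1 := by
  constructor
  · intro h
    cases h with
    | single _ _ hle hne hT hconn =>
      obtain ⟨h1, h2⟩ := hT.exists_hStrip hn hle
      refine ⟨_, h1, h2, ?_⟩
      rw [h2] at hconn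
      exact (h1.1.isConnectedShape_tiles_iff hn).1 hconn
  · rintro ⟨A, hA, rfl, hcard⟩
    refine .single _ _ hA.le ?_ (hA.isHorizontalRibbonStrip hn)
      ((hA.1.isConnectedShape_tiles_iff hn).2 hcard)
    obtain ⟨m, hm⟩ := Finset.card_pos.1 (hcard ▸ Nat.one_pos)
    exact ⟨_, Finset.mem_image_of_mem _ (mem_ends.1 hm).1⟩

lemma borderChain_cons_iff {n : ℕ} (hn : 1 ≤ n) {lam mu : YoungDiagram} {T : RibbonSet}
    {L : List RibbonSet} (hL : L ≠ []) : BorderChain n lam mu (T :: L) ↔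
      ∃ nu A, BorderChain n lam nu L ∧ A.Nonempty ∧ HStrip n nu A mu ∧ T = tiles n nu A ∧
        IsJoined n (lastPos L) A := by
  obtain ⟨T', L, rfl⟩ := List.exists_cons_of_ne_nil hL
  constructor
  · intro h
    cases h with
    | extend nu _ _ _ _ hL hle hne hT hatt =>
      obtain ⟨h1, h2⟩ := hT.exists_hStrip hn hle
      obtain ⟨kap, -, h3, h4⟩ := hL.exists_hStrip hn
      refine ⟨nu, _, hL, hne.image _, h1, h2, (h3.isAttached_iff_isJoined hn h1).1 ?_⟩
      rw [← h2, ← h4]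
      exact hatt
  · rintro ⟨nu, A, h1, h2, h3, rfl, h4⟩
    obtain ⟨kap, -, h5, h6⟩ := h1.exists_hStrip hn
    refine .extend nu _ _ _ _ h1 h3.le (h2.image _) (h3.isHorizontalRibbonStrip hn) ?_
    have := (h5.isAttached_iff_isJoined hn h3).2 h4
    rwa [← h6] at this

lemma BorderChain.ne_nil {n : ℕ} {lam mu : YoungDiagram} {L : List RibbonSet}
    (h : BorderChain n lam mu L) : L ≠ [] := by
  cases h <;> simp

/-- The shape of a border ribbon strip is connected as soon as its parts satisfy the conditions
on their components. -/
lemma BorderChain.isConnectedShape {n : ℕ} (hn : 1 ≤ n) {lam mu : YoungDiagram}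
    {L : List RibbonSet} (h : BorderChain n lam mu L) : IsConnectedShape (skewCells mu lam) := by
  induction h with
  | single mu T hle hne hT hconn => rwa [hT.2.1.2.2] at hconn
  | extend nu mu T T' L hL hle hne hT hatt ih =>
    obtain ⟨kap, h1, h2, -⟩ := hL.exists_hStrip hn
    obtain ⟨nu', A, h3, -, h4, h5, h6⟩ :=
      (borderChain_cons_iff hn (List.cons_ne_nil T' L)).1 (.extend nu mu T T' L hL hle hne hT hatt)
    have hnu : nu' = nu := by
      apply YoungDiagram.ext
      have h7 : skewCells mu nu' = skewCells mu nu := by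
        rw [← h4.cellsOf_tiles, ← h5, hT.2.1.2.2]
      have h8 := YoungDiagram.cells_subset_iff.2 h4.le
      have h9 := YoungDiagram.cells_subset_iff.2 hle
      rw [← Finset.sdiff_sdiff_eq_self h8, ← Finset.sdiff_sdiff_eq_self h9]
      exact congrArg (mu.cells \ ·) h7
    subst hnu
    exact h2.isConnectedShape_skewCells hn h4 h6 h1 ih

lemma isBorderRibbonStrip_iff {n : ℕ} (hn : 1 ≤ n) {lam mu : YoungDiagram}
    {L : List RibbonSet} : IsBorderRibbonStrip n mu lam L ↔ BorderChain n lam mu L :=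
  ⟨fun h => h.2, fun h => ⟨h.isConnectedShape hn, h⟩⟩

/-! ### The coefficients as sums over sets of contents -/

/-- The sets of positions of the horizontal strips of shape `mu / lam` with `k` ribbons. -/
def strips (n : ℕ) (lam mu : YoungDiagram) (k : ℕ) : Finset (Finset ℤ) :=
  ((skewCells mu lam).powerset.powerset.filter fun T =>
    lam ≤ mu ∧ IsHorizontalRibbonStrip n (skewCells mu lam) T ∧ T.card = k).image
      fun T => T.image pos

lemma mem_powerset_powerset {S : Finset (ℕ × ℕ)} {T : RibbonSet} (h : cellsOf T = S) :
    T ∈ S.powerset.powerset := by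
  rw [Finset.mem_powerset]
  intro r hr
  rw [Finset.mem_powerset, ← h]
  exact fun x hx => mem_cellsOf.2 ⟨r, hr, hx⟩

lemma mem_strips {n : ℕ} (hn : 1 ≤ n) {lam mu : YoungDiagram} {k : ℕ} {A : Finset ℤ} :
    A ∈ strips n lam mu k ↔ HStrip n lam A mu ∧ A.card = k := by
  simp only [strips, Finset.mem_image, Finset.mem_filter]
  constructor
  · rintro ⟨T, ⟨-, hle, hT, hk⟩, rfl⟩
    obtain ⟨h1, h2⟩ := hT.exists_hStrip hn hle
    refine ⟨h1, ?_⟩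
    rw [← hk]
    conv_rhs => rw [h2, card_tiles hn]
  · rintro ⟨hA, hk⟩
    exact ⟨tiles n lam A, ⟨mem_powerset_powerset hA.cellsOf_tiles, hA.le,
      hA.isHorizontalRibbonStrip hn, (card_tiles hn ..).trans hk⟩, image_pos_tiles hn ..⟩

lemma horizontalCoeff_eq_sum {n : ℕ} (hn : 1 ≤ n) (mu lam : YoungDiagram) (k : ℕ) :
    horizontalCoeff n mu lam k = ∑ A ∈ strips n lam mu k, q ^ spin (tiles n lam A) := by
  have h : ∀ T ∈ (skewCells mu lam).powerset.powerset.filter (fun T =>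
      lam ≤ mu ∧ IsHorizontalRibbonStrip n (skewCells mu lam) T ∧ T.card = k),
      T = tiles n lam (T.image pos) := fun T hT => by
    obtain ⟨-, hle, hT, -⟩ := Finset.mem_filter.1 hT
    exact (hT.exists_hStrip hn hle).2
  rw [strips, Finset.sum_image]
  · exact Finset.sum_congr rfl fun T hT => by rw [← h T hT]
  · intro T hT U hU e
    rw [h T hT, h U hU]
    exact congrArg _ e

/-- The partitions contained in `mu`. -/
def partitionsBelow (mu : YoungDiagram) : Finset YoungDiagram :=
  (show {nu : YoungDiagram | nu ≤ mu}.Finite from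
    (mu.cells.powerset.finite_toSet.preimage (f := YoungDiagram.cells)
      fun _ _ _ _ h => YoungDiagram.ext h).subset fun nu h => by
        simpa using YoungDiagram.cells_subset_iff.2 h).toFinset

lemma mem_partitionsBelow {mu nu : YoungDiagram} : nu ∈ partitionsBelow mu ↔ nu ≤ mu := by
  simp [partitionsBelow]

/-- The border ribbon strips of shape `mu / lam` and size `k` form a finite set. -/
lemma finite_borderChain (n : ℕ) (lam mu : YoungDiagram) (k : ℕ) :
    {L | BorderChain n lam mu L ∧ stripSize L = k}.Finite := by
  have hparts : ∀ {nu : YoungDiagram} {L : List RibbonSet}, BorderChain n lam nu L →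
      L.length ≤ stripSize L ∧ ∀ T ∈ L, T ⊆ nu.cells.powerset := by
    intro nu L h
    have hsub : ∀ {kap nu : YoungDiagram} {T : RibbonSet},
        IsHorizontalRibbonStrip n (skewCells nu kap) T → T ⊆ nu.cells.powerset := fun hT r hr => by
      have h1 := mem_powerset_powerset hT.2.1.2.2
      exact Finset.mem_powerset.2 ((Finset.mem_powerset.1 (Finset.mem_powerset.1 h1 hr)).trans
        Finset.sdiff_subset)
    induction h with
    | single nu T hle hne hT hconn =>
      exact ⟨by simpa [stripSize] using hne, by simpa using hsub hT⟩
    | extend nu mu T T' L hL hle hne hT hatt ih =>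
      refine ⟨?_, ?_⟩
      · have := Finset.card_pos.2 hne
        have := ih.1
        simp only [stripSize, List.map_cons, List.sum_cons, List.length_cons] at *
        omega
      · intro U hU
        rcases List.mem_cons.1 hU with rfl | hU
        · exact hsub hT
        · exact (ih.2 U hU).trans (Finset.powerset_mono.2 (YoungDiagram.cells_subset_iff.2 hle))
  refine ((List.finite_length_le {T // T ⊆ mu.cells.powerset} k).image
    (List.map Subtype.val)).subset ?_
  rintro L ⟨hL, rfl⟩
  obtain ⟨h1, h2⟩ := hparts hL
  exact ⟨L.attach.map fun T => ⟨T.1, h2 T.1 T.2⟩, by simpa using h1, by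
    rw [List.map_map]; exact List.attach_map_subtype_val L⟩

/-- The border ribbon strips of shape `mu / lam` and size `k`. -/
def chains (n : ℕ) (lam mu : YoungDiagram) (k : ℕ) : Finset (List RibbonSet) :=
  (finite_borderChain n lam mu k).toFinset

lemma mem_chains {n : ℕ} {lam mu : YoungDiagram} {k : ℕ} {L : List RibbonSet} :
    L ∈ chains n lam mu k ↔ BorderChain n lam mu L ∧ stripSize L = k := by
  simp [chains]

/-- The contribution of a border ribbon strip to `𝒳`. -/
def weight (L : List RibbonSet) : Cq := (-1) ^ stripHeight L * q ^ stripSpin L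

lemma borderCoeff_eq_sum {n : ℕ} (hn : 1 ≤ n) (mu lam : YoungDiagram) (k : ℕ) :
    borderCoeff n mu lam k = ∑ L ∈ chains n lam mu k, weight L := by
  rw [borderCoeff]
  simp only [isBorderRibbonStrip_iff hn]
  exact finsum_mem_eq_finite_toFinset_sum _ (finite_borderChain n lam mu k)

/-! ### Border ribbon strips followed by horizontal strips -/

lemma HStrip.eq_left {n : ℕ} {nu nu' mu : YoungDiagram} {A : Finset ℤ} (h : HStrip n nu A mu)
    (h' : HStrip n nu' A mu) : nu = nu' :=
  ext_rim fun c => by have := h.2 c; have := h'.2 c; omega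

/-- The spin generating function of the horizontal strips of shape `mu / nu` with `j` ribbons that
do not touch the strip with positions `A'` from below. -/
def freeSum (n : ℕ) (nu : YoungDiagram) (A' : Finset ℤ) (mu : YoungDiagram) (j : ℕ) : Cq :=
  ∑ B ∈ strips n nu mu j with ∀ b ∈ B, ¬ IsFollowed n A' b, q ^ spin (tiles n nu B)

/-- Sums over a strip and a further strip that does not touch it from below are sums over one
strip and an initial part of it. -/
lemma sum_freeSum {n : ℕ} (hn : 1 ≤ n) (lam mu : YoungDiagram) (j : ℕ) (Q : Finset ℤ → Prop)
    [DecidablePred Q] (g : Finset ℤ → Cq) :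
    ∑ nu ∈ partitionsBelow mu, ∑ i ∈ Finset.range (j + 1), ∑ A ∈ strips n lam nu i with Q A,
        g A * q ^ spin (tiles n lam A) * freeSum n nu A mu (j - i) =
      ∑ D ∈ strips n lam mu j, q ^ spin (tiles n lam D) *
        ∑ A ∈ D.powerset with IsInitial n D A ∧ Q A, g A := by
  calc _ = ∑ x ∈ (partitionsBelow mu).sigma fun nu => (Finset.range (j + 1)).sigma fun i =>
          ((strips n lam nu i).filter Q).sigma fun A =>
            (strips n nu mu (j - i)).filter fun B => ∀ b ∈ B, ¬ IsFollowed n A b,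
        g x.2.2.1 * (q ^ spin (tiles n lam x.2.2.1) * q ^ spin (tiles n x.1 x.2.2.2)) := by
        simp only [Finset.sum_sigma, freeSum, Finset.mul_sum, mul_assoc]
    _ = ∑ y ∈ (strips n lam mu j).sigma fun D =>
          D.powerset.filter fun A => IsInitial n D A ∧ Q A,
        q ^ spin (tiles n lam y.1) * g y.2 := by
        refine Finset.sum_bij (fun x _ => ⟨x.2.2.1 ∪ x.2.2.2, x.2.2.1⟩) ?_ ?_ ?_ ?_
        · rintro ⟨nu, i, A, B⟩ hx
          simp only [Finset.mem_sigma, Finset.mem_filter, mem_strips hn, mem_partitionsBelow,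
            Finset.mem_range, Finset.mem_powerset] at hx ⊢
          obtain ⟨h1, h2, ⟨⟨h3, h4⟩, h5⟩, ⟨h6, h7⟩, h8⟩ := hx
          obtain ⟨hdis, hu, hini⟩ := h3.union hn h6 h8
          refine ⟨⟨hu, ?_⟩, hini.1, hini, h5⟩
          rw [Finset.card_union_of_disjoint hdis]; omega
        · rintro ⟨nu, i, A, B⟩ hx ⟨nu', i', A', B'⟩ hx' e
          simp only [Finset.mem_sigma, Finset.mem_filter, mem_strips hn] at hx hx'
          obtain ⟨h1, h2, ⟨⟨h3, h4⟩, h5⟩, ⟨h6, h7⟩, h8⟩ := hx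
          obtain ⟨h1', h2', ⟨⟨h3', h4'⟩, h5'⟩, ⟨h6', h7'⟩, h8'⟩ := hx'
          simp only [Sigma.mk.injEq, heq_eq_eq] at e
          obtain ⟨e1, rfl⟩ := e
          obtain rfl := h3.eq h3'
          have hB := (h3.union hn h6 h8).1
          have hB' := (h3.union hn h6' h8').1
          have : B = B' := by
            rw [← Finset.union_sdiff_cancel_left hB, e1, Finset.union_sdiff_cancel_left hB']
          subst h4 this
          subst h4'
          rfl
        · rintro ⟨D, A⟩ hy
          simp only [Finset.mem_sigma, Finset.mem_filter, mem_strips hn,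
            Finset.mem_powerset] at hy
          obtain ⟨⟨h1, h2⟩, h3, h4, h5⟩ := hy
          obtain ⟨nu, h6, h7⟩ := h1.split hn h4
          have hcard := Finset.card_sdiff_add_card_eq_card h3
          refine ⟨⟨nu, A.card, A, D \ A⟩, ?_, ?_⟩
          · simp only [Finset.mem_sigma, Finset.mem_filter, mem_strips hn, mem_partitionsBelow,
              Finset.mem_range]
            refine ⟨h7.le, by omega, ⟨⟨h6, trivial⟩, h5⟩, ⟨h7, by omega⟩, fun b hb => ?_⟩
            rw [Finset.mem_sdiff] at hb
            exact h4.not_isFollowed hb.1 hb.2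
          · simp only [Finset.union_sdiff_of_subset h3]
        · rintro ⟨nu, i, A, B⟩ hx
          simp only [Finset.mem_sigma, Finset.mem_filter, mem_strips hn] at hx
          obtain ⟨h1, h2, ⟨⟨h3, h4⟩, h5⟩, ⟨h6, h7⟩, h8⟩ := hx
          simp only
          rw [h3.spin_union hn h6 h8, pow_add]; ring
    _ = _ := by simp only [Finset.sum_sigma, Finset.mul_sum]

lemma freeSum_empty {n : ℕ} (hn : 1 ≤ n) (nu mu : YoungDiagram) (j : ℕ) :
    freeSum n nu ∅ mu j = horizontalCoeff n mu nu j := by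
  rw [freeSum, horizontalCoeff_eq_sum hn, Finset.filter_true_of_mem]
  simp [IsFollowed]

lemma strips_zero {n : ℕ} (hn : 1 ≤ n) (lam nu : YoungDiagram) :
    strips n lam nu 0 = if nu = lam then {∅} else ∅ := by
  ext A
  rw [mem_strips hn, Finset.card_eq_zero]
  split_ifs with h
  · subst h
    rw [Finset.mem_singleton]
    refine ⟨fun h => h.2, ?_⟩
    rintro rfl
    exact ⟨⟨by simp [IsAddable], by simp⟩, rfl⟩
  · simp only [Finset.notMem_empty, iff_false, not_and]
    rintro hA rfl
    exact h (ext_rim fun c => by simpa using hA.2 c)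

/-- Continuing a border ribbon strip in all possible ways by one more part removes from the
horizontal strips those that touch the last part from below. -/
lemma horizontalCoeff_add_sum {n : ℕ} (hn : 1 ≤ n) {nu mu : YoungDiagram} (hle : nu ≤ mu)
    (A' : Finset ℤ) (j : ℕ) : horizontalCoeff n mu nu j +
      ∑ nu' ∈ partitionsBelow mu, ∑ i ∈ Finset.Icc 1 j,
        ∑ A ∈ strips n nu nu' i with IsJoined n A' A,
          (-1) ^ (ends n A).card * q ^ spin (tiles n nu A) * freeSum n nu' A mu (j - i) =
      freeSum n nu A' mu j := by
  -- the term `A = ∅` gives `horizontalCoeff`; the signs of all the terms cancel unless nothing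
  -- touches `A'`
  have h := sum_freeSum hn nu mu j (IsJoined n A') fun A => (-1) ^ (ends n A).card
  have hr : Finset.range (j + 1) = insert 0 (Finset.Icc 1 j) := by
    ext i; simp only [Finset.mem_range, Finset.mem_insert, Finset.mem_Icc]; omega
  simp only [sum_neg_one_pow_ends, hr, Finset.sum_insert (by simp : 0 ∉ Finset.Icc 1 j),
    Finset.sum_add_distrib, strips_zero hn] at h
  rw [Finset.sum_eq_single_of_mem nu (mem_partitionsBelow.2 hle)] at h
  · have h1 : ({∅} : Finset (Finset ℤ)).filter (IsJoined n A') = {∅} :=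
      Finset.filter_true_of_mem fun A hA => by
        rw [Finset.mem_singleton] at hA; subst hA; simp [IsJoined]
    rw [if_pos rfl, h1, Finset.sum_singleton, freeSum_empty hn] at h
    simp only [ends, tiles, spin, Finset.filter_empty, Finset.card_empty, pow_zero,
      Finset.image_empty, Finset.sum_empty, mul_one, one_mul, Nat.sub_zero] at h
    simp only [spin, tiles, ends]
    rw [h, freeSum, Finset.sum_filter]
    refine Finset.sum_congr rfl fun D _ => ?_
    by_cases hD : ∃ c ∈ D, IsFollowed n A' c
    · rw [if_pos hD, if_neg, mul_zero]
      push Not; exact hD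
    · rw [if_neg hD, if_pos, mul_one]
      · rfl
      · push Not at hD; exact hD
  · intro nu' _ hne
    rw [if_neg hne]; simp

lemma BorderChain.numComponents_pos {n : ℕ} (hn : 1 ≤ n) {lam mu : YoungDiagram}
    {L : List RibbonSet} (h : BorderChain n lam mu L) : 1 ≤ (L.map numComponents).sum := by
  induction h with
  | single mu T hle hne hT hconn =>
    obtain ⟨A, h1, rfl, h3⟩ := (borderChain_singleton_iff hn).1 (.single mu T hle hne hT hconn)
    simp [h1.1.numComponents_tiles hn, h3]
  | extend _ _ _ _ _ _ _ _ _ _ ih => rw [List.map_cons, List.sum_cons]; omega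

lemma weight_cons {n : ℕ} (hn : 1 ≤ n) {lam nu mu : YoungDiagram} {L : List RibbonSet}
    {A : Finset ℤ} (h : BorderChain n lam nu L) (hA : HStrip n nu A mu) :
    weight (tiles n nu A :: L) =
      weight L * ((-1) ^ (ends n A).card * q ^ spin (tiles n nu A)) := by
  have h1 := h.numComponents_pos hn
  have h2 : stripHeight (tiles n nu A :: L) = (ends n A).card + stripHeight L := by
    simp only [stripHeight, List.map_cons, List.sum_cons, hA.1.numComponents_tiles hn]
    omega
  have h3 : stripSpin (tiles n nu A :: L) = spin (tiles n nu A) + stripSpin L := by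
    simp [stripSpin]
  rw [weight, weight, h2, h3, pow_add, pow_add]
  ring

lemma lastPos_cons {n : ℕ} (hn : 1 ≤ n) (nu : YoungDiagram) (A : Finset ℤ)
    (L : List RibbonSet) : lastPos (tiles n nu A :: L) = A :=
  image_pos_tiles hn nu A

lemma stripSize_cons (T : RibbonSet) (L : List RibbonSet) :
    stripSize (T :: L) = T.card + stripSize L := by
  simp [stripSize]

/-- The border ribbon strips with at least two parts are the continuations of border ribbon
strips by one more part. -/
lemma sum_chains_two_le {n : ℕ} (hn : 1 ≤ n) (lam mu : YoungDiagram) (k : ℕ) :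
    ∑ nu ∈ partitionsBelow mu, ∑ i ∈ Finset.Icc 1 k, ∑ L ∈ chains n lam nu i with 2 ≤ L.length,
        weight L * freeSum n nu (lastPos L) mu (k - i) =
      ∑ nu ∈ partitionsBelow mu, ∑ i ∈ Finset.Icc 1 k, ∑ L ∈ chains n lam nu i,
        weight L * ∑ nu' ∈ partitionsBelow mu, ∑ i' ∈ Finset.Icc 1 (k - i),
          ∑ A ∈ strips n nu nu' i' with IsJoined n (lastPos L) A,
            (-1) ^ (ends n A).card * q ^ spin (tiles n nu A) *
              freeSum n nu' A mu (k - i - i') := by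
  symm
  calc _ = ∑ x ∈ (partitionsBelow mu).sigma fun nu => (Finset.Icc 1 k).sigma fun i =>
          (chains n lam nu i).sigma fun L => (partitionsBelow mu).sigma fun nu' =>
            (Finset.Icc 1 (k - i)).sigma fun i' =>
              (strips n nu nu' i').filter (IsJoined n (lastPos L)),
        weight x.2.2.1 * ((-1) ^ (ends n x.2.2.2.2.2).card *
          q ^ spin (tiles n x.1 x.2.2.2.2.2) *
            freeSum n x.2.2.2.1 x.2.2.2.2.2 mu (k - x.2.1 - x.2.2.2.2.1)) := by
        simp only [Finset.sum_sigma, Finset.mul_sum]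
    _ = ∑ y ∈ (partitionsBelow mu).sigma fun nu => (Finset.Icc 1 k).sigma fun i =>
          (chains n lam nu i).filter fun L => 2 ≤ L.length,
        weight y.2.2 * freeSum n y.1 (lastPos y.2.2) mu (k - y.2.1) := by
        refine Finset.sum_bij (fun x _ => ⟨x.2.2.2.1, x.2.1 + x.2.2.2.2.1,
          tiles n x.1 x.2.2.2.2.2 :: x.2.2.1⟩) ?_ ?_ ?_ ?_
        · rintro ⟨nu, i, L, nu', i', A⟩ hx
          simp only [Finset.mem_sigma, Finset.mem_filter, mem_strips hn, mem_partitionsBelow,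
            Finset.mem_Icc, mem_chains] at hx ⊢
          obtain ⟨h1, h2, ⟨h3, h4⟩, h5, h6, ⟨h7, h8⟩, h9⟩ := hx
          refine ⟨h5, by omega, ⟨?_, ?_⟩, ?_⟩
          · refine (borderChain_cons_iff hn h3.ne_nil).2 ⟨nu, A, h3, ?_, h7, rfl, h9⟩
            exact Finset.card_pos.1 (by omega)
          · rw [stripSize_cons, card_tiles hn]; omega
          · have := List.length_pos_iff.2 h3.ne_nil
            rw [List.length_cons]; omega
        · rintro ⟨nu, i, L, nu', i', A⟩ hx ⟨mu₂, i₂, L₂, nu₂, j₂, A₂⟩ hx' e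
          simp only [Finset.mem_sigma, Finset.mem_filter, mem_strips hn, mem_chains] at hx hx'
          obtain ⟨h1, h2, ⟨h3, h4⟩, h5, h6, ⟨h7, h8⟩, h9⟩ := hx
          obtain ⟨h1', h2', ⟨h3', h4'⟩, h5', h6', ⟨h7', h8'⟩, h9'⟩ := hx'
          simp only [Sigma.mk.injEq, heq_eq_eq, List.cons.injEq] at e
          obtain ⟨rfl, e1, e2, rfl⟩ := e
          obtain rfl := tiles_injective hn e2
          obtain rfl := h7.eq_left h7'
          obtain rfl : i = i₂ := h4.symm.trans h4'
          obtain rfl : i' = j₂ := h8.symm.trans h8'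
          rfl
        · rintro ⟨nu', i, L⟩ hy
          simp only [Finset.mem_sigma, Finset.mem_filter, mem_partitionsBelow,
            Finset.mem_Icc, mem_chains] at hy
          obtain ⟨h1, h2, ⟨h3, h4⟩, h5⟩ := hy
          obtain ⟨T, L, rfl⟩ := List.exists_cons_of_ne_nil h3.ne_nil
          have hL : L ≠ [] := by
            rintro rfl; simp at h5
          obtain ⟨nu, A, h6, h7, h8, rfl, h9⟩ := (borderChain_cons_iff hn hL).1 h3
          rw [stripSize_cons, card_tiles hn] at h4
          have hA := Finset.card_pos.2 h7
          have hsize : 1 ≤ stripSize L := by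
            obtain ⟨T', L', rfl⟩ := List.exists_cons_of_ne_nil hL
            have hT : T'.Nonempty := by cases h6 <;> assumption
            rw [stripSize_cons]
            have := Finset.card_pos.2 hT
            omega
          refine ⟨⟨nu, stripSize L, L, nu', A.card, A⟩, ?_, ?_⟩
          · simp only [Finset.mem_sigma, Finset.mem_filter, mem_strips hn, mem_partitionsBelow,
              Finset.mem_Icc, mem_chains]
            exact ⟨h8.le.trans h1, by omega, ⟨h6, trivial⟩, h1, by omega, ⟨h8, trivial⟩, h9⟩
          · simp only
            rw [add_comm, h4]
        · rintro ⟨nu, i, L, nu', i', A⟩ hx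
          simp only [Finset.mem_sigma, Finset.mem_filter, mem_strips hn, mem_chains] at hx
          obtain ⟨h1, h2, ⟨h3, h4⟩, h5, h6, ⟨h7, h8⟩, h9⟩ := hx
          simp only
          rw [weight_cons hn h3 h7, lastPos_cons hn, Nat.sub_sub]
          ring
    _ = _ := by simp only [Finset.sum_sigma]

lemma sum_chains_one {n : ℕ} (hn : 1 ≤ n) (lam nu mu : YoungDiagram) (i j : ℕ) :
    ∑ L ∈ chains n lam nu i with ¬ 2 ≤ L.length, weight L * freeSum n nu (lastPos L) mu j =
      ∑ A ∈ strips n lam nu i with (ends n A).card = 1,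
        1 * q ^ spin (tiles n lam A) * freeSum n nu A mu j := by
  symm
  refine Finset.sum_bij (fun A _ => [tiles n lam A]) ?_ ?_ ?_ ?_
  · intro A hA
    simp only [Finset.mem_filter, mem_strips hn, mem_chains] at hA ⊢
    obtain ⟨⟨h1, h2⟩, h3⟩ := hA
    refine ⟨⟨(borderChain_singleton_iff hn).2 ⟨A, h1, rfl, h3⟩, ?_⟩, by simp⟩
    simp [stripSize, card_tiles hn, h2]
  · intro A _ B _ e
    exact tiles_injective hn (List.singleton_injective e)
  · intro L hL
    simp only [Finset.mem_filter, mem_chains] at hL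
    obtain ⟨⟨h1, h2⟩, h3⟩ := hL
    obtain ⟨T, L, rfl⟩ := List.exists_cons_of_ne_nil h1.ne_nil
    obtain rfl : L = [] := by
      rw [← List.length_eq_zero_iff]; rw [List.length_cons] at h3; omega
    obtain ⟨A, h4, rfl, h5⟩ := (borderChain_singleton_iff hn).1 h1
    refine ⟨A, ?_, rfl⟩
    simp only [Finset.mem_filter, mem_strips hn]
    refine ⟨⟨h4, ?_⟩, h5⟩
    rw [← h2]; simp [stripSize, card_tiles hn]
  · intro A hA
    simp only [Finset.mem_filter, mem_strips hn] at hA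
    obtain ⟨⟨h1, h2⟩, h3⟩ := hA
    rw [lastPos_cons hn, weight]
    simp [stripHeight, stripSpin, h1.1.numComponents_tiles hn, h3]

/-- The Newton identity `k h_k = ∑ p_i h_{k - i}` on the level of coefficients. -/
theorem natCast_mul_horizontalCoeff {n : ℕ} (hn : 1 ≤ n) (mu lam : YoungDiagram) (k : ℕ) :
    (k : Cq) * horizontalCoeff n mu lam k =
      ∑ nu ∈ partitionsBelow mu, ∑ i ∈ Finset.Icc 1 k,
        borderCoeff n nu lam i * horizontalCoeff n mu nu (k - i) := by
  -- a horizontal strip with `k` ribbons has `k` connected initial parts, one for each last ribbon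
  have hone := sum_freeSum hn lam mu k (fun A => (ends n A).card = 1) fun _ => 1
  have hr : Finset.range (k + 1) = insert 0 (Finset.Icc 1 k) := by
    ext i; simp only [Finset.mem_range, Finset.mem_insert, Finset.mem_Icc]; omega
  have hzero : ∀ nu, ∑ A ∈ strips n lam nu 0 with (ends n A).card = 1,
      1 * q ^ spin (tiles n lam A) * freeSum n nu A mu (k - 0) = 0 := fun nu => by
    rw [strips_zero hn, Finset.sum_filter]
    split_ifs <;> simp [ends]
  simp only [hr, Finset.sum_insert (by simp : 0 ∉ Finset.Icc 1 k), hzero, zero_add,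
    Finset.sum_const, nsmul_eq_mul, mul_one, card_initial_of_card_ends_eq_one] at hone
  have hk : ∑ D ∈ strips n lam mu k, q ^ spin (tiles n lam D) * (D.card : Cq) =
      k * horizontalCoeff n mu lam k := by
    rw [horizontalCoeff_eq_sum hn, Finset.mul_sum]
    refine Finset.sum_congr rfl fun D hD => ?_
    rw [((mem_strips hn).1 hD).2, mul_comm]
  rw [← hk, ← hone]
  -- the sum over all border ribbon strips telescopes to those with a single part
  have htel : ∑ nu ∈ partitionsBelow mu, ∑ i ∈ Finset.Icc 1 k,
        borderCoeff n nu lam i * horizontalCoeff n mu nu (k - i) +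
      ∑ nu ∈ partitionsBelow mu, ∑ i ∈ Finset.Icc 1 k, ∑ L ∈ chains n lam nu i with 2 ≤ L.length,
        weight L * freeSum n nu (lastPos L) mu (k - i) =
      ∑ nu ∈ partitionsBelow mu, ∑ i ∈ Finset.Icc 1 k, ∑ L ∈ chains n lam nu i,
        weight L * freeSum n nu (lastPos L) mu (k - i) := by
    rw [sum_chains_two_le hn, ← Finset.sum_add_distrib]
    refine Finset.sum_congr rfl fun nu hnu => ?_
    rw [← Finset.sum_add_distrib]
    refine Finset.sum_congr rfl fun i _ => ?_
    rw [borderCoeff_eq_sum hn, Finset.sum_mul, ← Finset.sum_add_distrib]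
    refine Finset.sum_congr rfl fun L _ => ?_
    rw [← mul_add, horizontalCoeff_add_sum hn (mem_partitionsBelow.1 hnu)]
  have hsplit : ∑ nu ∈ partitionsBelow mu, ∑ i ∈ Finset.Icc 1 k, ∑ L ∈ chains n lam nu i,
        weight L * freeSum n nu (lastPos L) mu (k - i) =
      ∑ nu ∈ partitionsBelow mu, ∑ i ∈ Finset.Icc 1 k, ∑ L ∈ chains n lam nu i with 2 ≤ L.length,
        weight L * freeSum n nu (lastPos L) mu (k - i) +
      ∑ nu ∈ partitionsBelow mu, ∑ i ∈ Finset.Icc 1 k,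
        ∑ A ∈ strips n lam nu i with (ends n A).card = 1,
          1 * q ^ spin (tiles n lam A) * freeSum n nu A mu (k - i) := by
    simp only [← sum_chains_one hn, ← Finset.sum_add_distrib,
      Finset.sum_filter_add_sum_filter_not]
  rw [hsplit, add_comm] at htel
  exact (add_left_cancel htel).symm

/-! ### Vertical ribbon strips -/

/-- `nu` is obtained from `lam` by moving the beads at the positions in `B` from right to left,
which is the effect of a vertical ribbon strip. -/
def VStrip (n : ℕ) (lam : YoungDiagram) (B : Finset ℤ) (nu : YoungDiagram) : Prop :=
  (∀ b ∈ B, bead lam b = 1 ∧ (bead lam (b + n) = 0 ∨ b + n ∈ B)) ∧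
    ∀ c, rim nu c = rim lam c + cov n B c

/-- Conjugation maps a ribbon with smallest content `b` to one with smallest content
`1 - n - b`. -/
def flipPos (n : ℕ) (B : Finset ℤ) : Finset ℤ := B.image fun b => 1 - n - b

lemma mem_flipPos {n : ℕ} {B : Finset ℤ} {a : ℤ} : a ∈ flipPos n B ↔ 1 - n - a ∈ B := by
  simp only [flipPos, Finset.mem_image]
  constructor
  · rintro ⟨b, hb, rfl⟩; rwa [sub_sub_cancel]
  · intro h; exact ⟨_, h, sub_sub_cancel _ _⟩

lemma flipPos_flipPos (n : ℕ) (B : Finset ℤ) : flipPos n (flipPos n B) = B := by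
  ext a; rw [mem_flipPos, mem_flipPos, sub_sub_cancel]

lemma sum_flipPos {M : Type*} [AddCommMonoid M] (n : ℕ) (B : Finset ℤ) (f : ℤ → M) :
    ∑ a ∈ flipPos n B, f a = ∑ b ∈ B, f (1 - n - b) :=
  Finset.sum_image fun a _ b _ h => by omega

lemma card_flipPos (n : ℕ) (B : Finset ℤ) : (flipPos n B).card = B.card :=
  Finset.card_image_of_injective _ fun a b h => by omega

lemma cov_flipPos (n : ℕ) (B : Finset ℤ) (c : ℤ) : cov n (flipPos n B) c = cov n B (-c) := by
  rw [cov_eq_sum, cov_eq_sum, sum_flipPos]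
  refine Finset.sum_congr rfl fun b _ => ?_
  split_ifs <;> omega

/-- Conjugation reverses the order of the beads and exchanges beads and gaps. -/
lemma hStrip_transpose_iff {n : ℕ} {lam nu : YoungDiagram} {B : Finset ℤ} :
    HStrip n lam.transpose (flipPos n B) nu.transpose ↔ VStrip n lam B nu := by
  constructor
  · rintro ⟨h1, h2⟩
    refine ⟨fun b hb => ?_, fun c => ?_⟩
    · have h3 := h1 (1 - n - b) (mem_flipPos.2 (by rwa [sub_sub_cancel]))
      rw [bead_transpose, bead_transpose, mem_flipPos, show 1 - (1 - n - b + n) = b by ring,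
        show 1 - (1 - n - b) = b + n by ring, show 1 - (n : ℤ) - (1 - n - b - n) = b + n by ring]
        at h3
      exact ⟨by omega, h3.2.imp_left (by omega)⟩
    · have h3 := h2 (-c)
      rw [rim_transpose, rim_transpose, cov_flipPos, neg_neg] at h3
      omega
  · rintro ⟨h1, h2⟩
    refine ⟨fun a ha => ?_, fun c => ?_⟩
    · have h3 := h1 _ (mem_flipPos.1 ha)
      rw [bead_transpose, bead_transpose, mem_flipPos, show 1 - (a + n) = 1 - n - a by ring,
        show 1 - (n : ℤ) - (a - n) = 1 - n - a + n by ring]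
      rw [show 1 - (n : ℤ) - a + n = 1 - a by ring] at h3 ⊢
      exact ⟨by omega, h3.2.imp_left (by omega)⟩
    · have h3 := h2 (-c)
      rw [rim_transpose, rim_transpose, cov_flipPos]
      omega

lemma conj_conj (S : Finset (ℕ × ℕ)) : conj (conj S) = S := by
  simp [conj, Finset.image_image]

lemma conj_injective : Function.Injective conj := fun S T h => by
  rw [← conj_conj S, h, conj_conj]

lemma image_conj_image_conj (T : RibbonSet) : (T.image conj).image conj = T := by
  rw [Finset.image_image, show conj ∘ conj = id from funext conj_conj, Finset.image_id]

lemma conj_skewCells (mu lam : YoungDiagram) :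
    conj (skewCells mu lam) = skewCells mu.transpose lam.transpose := by
  ext x
  simp only [conj, skewCells, Finset.mem_image, Finset.mem_sdiff, YoungDiagram.mem_cells,
    YoungDiagram.mem_transpose]
  constructor
  · rintro ⟨y, hy, rfl⟩; simpa using hy
  · intro h; exact ⟨x.swap, h, x.swap_swap⟩

lemma cellsOf_image_conj (T : RibbonSet) : cellsOf (T.image conj) = conj (cellsOf T) := by
  simp only [cellsOf, conj, Finset.image_biUnion, Finset.biUnion_image, id]

/-- The spin of the vertical strip with positions `B` on `lam`: that of the ribbons themselves, not
of their conjugates. -/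
def vspin (n : ℕ) (lam : YoungDiagram) (B : Finset ℤ) : ℕ :=
  spin ((tiles n lam.transpose (flipPos n B)).image conj)

/-- The sets of positions of the vertical strips of shape `mu / lam` with `k` ribbons. -/
def vstrips (n : ℕ) (lam mu : YoungDiagram) (k : ℕ) : Finset (Finset ℤ) :=
  (strips n lam.transpose mu.transpose k).image (flipPos n)

lemma mem_vstrips {n : ℕ} (hn : 1 ≤ n) {lam mu : YoungDiagram} {k : ℕ} {B : Finset ℤ} :
    B ∈ vstrips n lam mu k ↔ VStrip n lam B mu ∧ B.card = k := by
  rw [← hStrip_transpose_iff, ← card_flipPos n B, ← mem_strips hn, vstrips, Finset.mem_image]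
  constructor
  · rintro ⟨A, hA, rfl⟩; rwa [flipPos_flipPos]
  · intro h; exact ⟨_, h, flipPos_flipPos n B⟩

lemma verticalCoeff_eq_sum {n : ℕ} (hn : 1 ≤ n) (mu lam : YoungDiagram) (k : ℕ) :
    verticalCoeff n mu lam k = ∑ B ∈ vstrips n lam mu k, q ^ vspin n lam B := by
  have hinj : Set.InjOn (flipPos n) (strips n lam.transpose mu.transpose k) := fun A _ B _ h => by
    rw [← flipPos_flipPos n A, h, flipPos_flipPos]
  rw [vstrips, Finset.sum_image hinj, verticalCoeff]
  have hcard : ∀ T : RibbonSet, (T.image conj).card = T.card := fun T =>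
    Finset.card_image_of_injective _ conj_injective
  refine Finset.sum_bij' (fun T _ => (T.image conj).image pos)
    (fun A _ => (tiles n lam.transpose A).image conj) ?_ ?_ ?_ ?_ ?_
  · intro T hT
    obtain ⟨-, hle, hT, hk⟩ := Finset.mem_filter.1 hT
    rw [IsVerticalRibbonStrip, conj_skewCells] at hT
    obtain ⟨h1, h2⟩ := hT.exists_hStrip hn (YoungDiagram.transpose_mono hle)
    refine (mem_strips hn).2 ⟨h1, ?_⟩
    rw [← hk, ← hcard T]
    conv_rhs => rw [h2, card_tiles hn]
  · intro A hA
    obtain ⟨h1, h2⟩ := (mem_strips hn).1 hA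
    rw [Finset.mem_filter]
    refine ⟨mem_powerset_powerset ?_, YoungDiagram.transpose_le_iff.1 h1.le, ?_, ?_⟩
    · rw [cellsOf_image_conj, h1.cellsOf_tiles, ← conj_skewCells, conj_conj]
    · rw [IsVerticalRibbonStrip, conj_skewCells, image_conj_image_conj]
      exact h1.isHorizontalRibbonStrip hn
    · rw [hcard, card_tiles hn, h2]
  · intro T hT
    obtain ⟨-, hle, hT, hk⟩ := Finset.mem_filter.1 hT
    rw [IsVerticalRibbonStrip, conj_skewCells] at hT
    obtain ⟨h1, h2⟩ := hT.exists_hStrip hn (YoungDiagram.transpose_mono hle)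
    rw [← h2, image_conj_image_conj]
  · intro A hA
    rw [image_conj_image_conj, image_pos_tiles hn]
  · intro T hT
    obtain ⟨-, hle, hT, hk⟩ := Finset.mem_filter.1 hT
    rw [IsVerticalRibbonStrip, conj_skewCells] at hT
    obtain ⟨h1, h2⟩ := hT.exists_hStrip hn (YoungDiagram.transpose_mono hle)
    rw [vspin, flipPos_flipPos, ← h2, image_conj_image_conj]

/-! ### The spin of horizontal and vertical strips -/

/-- The number of pairs `a ∈ A`, `b ∈ B` with `a < b < a + n`. -/
def cross (n : ℕ) (A B : Finset ℤ) : ℤ :=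
  ∑ a ∈ A, ∑ b ∈ B, if a < b ∧ b < a + n then 1 else 0

lemma cross_insert_left {n : ℕ} {A : Finset ℤ} {x : ℤ} (hx : x ∉ A) (B : Finset ℤ) :
    cross n (insert x A) B = cross n {x} B + cross n A B := by
  simp [cross, Finset.sum_insert hx]

lemma cross_insert_right {n : ℕ} {B : Finset ℤ} {x : ℤ} (hx : x ∉ B) (A : Finset ℤ) :
    cross n A (insert x B) = cross n A {x} + cross n A B := by
  simp only [cross, Finset.sum_insert hx, Finset.sum_singleton, Finset.sum_add_distrib]

lemma cross_singleton_right_eq_zero {n : ℕ} {A : Finset ℤ} {x : ℤ} (h : ∀ a ∈ A, x ≤ a) :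
    cross n A {x} = 0 :=
  Finset.sum_eq_zero fun a ha => by
    rw [Finset.sum_singleton, if_neg]
    have := h a ha
    omega

lemma sum_cov_filter_lt (n : ℕ) (A : Finset ℤ) :
    ∑ a ∈ A, cov n (A.filter (· < a)) a = cross n A A := by
  simp only [cov_eq_sum, cross, Finset.sum_filter]
  rw [Finset.sum_comm]
  refine Finset.sum_congr rfl fun a _ => Finset.sum_congr rfl fun b _ => ?_
  split_ifs <;> omega

/-- A ribbon gains height from the ribbons at smaller positions that cover its first content. -/
lemma IsAddable.spin_eq {n : ℕ} (hn : 1 ≤ n) {lam : YoungDiagram} {A : Finset ℤ}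
    (h : IsAddable n lam A) : (spin (tiles n lam A) : ℤ) =
      ∑ a ∈ A, (rim lam a - rim lam (a + n - 1)) + cross n A A := by
  rw [spin_tiles hn, ← sum_cov_filter_lt, ← Finset.sum_add_distrib]
  push_cast
  refine Finset.sum_congr rfl fun a _ => ?_
  rw [h.height_tile hn, tileRim]; ring

/-- The height of the conjugate of a ribbon is the number of horizontal steps of the rim below
which the ribbon is added. -/
lemma IsAddable.height_conj_tile {n : ℕ} (hn : 1 ≤ n) {lam : YoungDiagram} {A : Finset ℤ}
    (h : IsAddable n lam A) (a : ℤ) :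
    (height (conj (tile n lam A a)) : ℤ) =
      rim lam (a + n - 1) + (n - 1) - tileRim n lam A a a := by
  obtain ⟨m, rfl⟩ : ∃ m, n = m + 1 := ⟨n - 1, by omega⟩
  have hI : (Finset.Ico a (a + ((m + 1 : ℕ) : ℤ))) = Finset.Icc a (a + m) := by
    ext c; simp only [Finset.mem_Ico, Finset.mem_Icc]; push_cast; omega
  have h1 : ((conj (tile (m + 1) lam A a)).image Prod.fst).image (fun i : ℕ => -(i : ℤ)) =
      (Finset.Icc a (a + m)).image fun c => -(tileRim (m + 1) lam A a c + c) := by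
    rw [conj, tile, hI, Finset.image_image, Finset.image_image, Finset.image_image]
    refine Finset.image_congr fun c _ => ?_
    exact congrArg _ (snd_cellAt (tileRim_nonneg ..).2)
  have h2 := card_image_of_steps (fun c => -(tileRim (m + 1) lam A a c + c)) a m
    fun c _ _ => by have := h.tileRim_step hn a c; omega
  rw [← h1, Finset.card_image_of_injective _ fun i j hij => by simpa using hij] at h2
  have h3 : a + ((m + 1 : ℕ) : ℤ) - 1 = a + m := by push_cast; ring
  have h4 := tileRim_last (m + 1) lam A (a := a) h3.le
  rw [h3, height, ← h4]
  have hpos : 0 < ((conj (tile (m + 1) lam A a)).image Prod.fst).card :=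
    Finset.card_pos.2 (((tile_nonempty hn ..).image _).image _)
  have := h2.1
  push_cast
  omega

/-- In a vertical strip the overlaps of the ribbons are subtracted from the spin; in a horizontal
strip they are added. -/
lemma VStrip.vspin_eq {n : ℕ} (hn : 1 ≤ n) {lam nu : YoungDiagram} {B : Finset ℤ}
    (h : VStrip n lam B nu) : (vspin n lam B : ℤ) =
      ∑ b ∈ B, (rim lam b - rim lam (b + n - 1)) - cross n B B := by
  have hA := (hStrip_transpose_iff.2 h).1
  have hcross : cross n (flipPos n B) (flipPos n B) = cross n B B := by
    simp only [cross, sum_flipPos]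
    rw [Finset.sum_comm]
    refine Finset.sum_congr rfl fun a _ => Finset.sum_congr rfl fun b _ => ?_
    split_ifs <;> omega
  have hspin : vspin n lam B = ∑ a ∈ flipPos n B,
      height (conj (tile n lam.transpose (flipPos n B) a)) := by
    rw [vspin, spin, tiles, Finset.image_image, Finset.sum_image]
    · rfl
    · intro a _ b _ e
      exact tile_injective hn (conj_injective e)
  have h1 : ∀ a, (height (conj (tile n lam.transpose (flipPos n B) a)) : ℤ) =
      (rim lam (1 - n - a) - rim lam (-a)) - cov n ((flipPos n B).filter (· < a)) a := fun a => by
    rw [hA.height_conj_tile hn, tileRim, rim_transpose, rim_transpose,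
      show -(a + n - 1) = 1 - n - a by ring]
    ring
  rw [hspin]
  push_cast
  rw [Finset.sum_congr rfl fun a _ => h1 a, Finset.sum_sub_distrib, sum_cov_filter_lt, hcross,
    sum_flipPos]
  congr 1
  refine Finset.sum_congr rfl fun b _ => ?_
  rw [sub_sub_cancel, show -(1 - (n : ℤ) - b) = b + n - 1 by ring]

/-- The total spin of a vertical strip followed by a horizontal one, in terms of the positions. -/
lemma vspin_add_spin {n : ℕ} (hn : 1 ≤ n) {lam nu mu : YoungDiagram} {A B : Finset ℤ}
    (hB : VStrip n lam B nu) (hA : HStrip n nu A mu) :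
    (vspin n lam B : ℤ) + spin (tiles n nu A) =
      ∑ x ∈ B, (rim lam x - rim lam (x + n - 1)) + ∑ x ∈ A, (rim lam x - rim lam (x + n - 1)) -
        cross n B B + cross n A A + cross n B A - cross n A B := by
  have h1 : ∀ x, rim nu x - rim nu (x + n - 1) = (rim lam x - rim lam (x + n - 1)) +
      cross n B {x} - cross n {x} B := fun x => by
    have : cov n B x - cov n B (x + n - 1) = cross n B {x} - cross n {x} B := by
      simp only [cov_eq_sum, cross, Finset.sum_singleton, ← Finset.sum_sub_distrib]
      refine Finset.sum_congr rfl fun b _ => ?_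
      split_ifs <;> omega
    rw [hB.2, hB.2]; linarith
  have h2 : ∑ x ∈ A, cross n B {x} = cross n B A := by
    simp only [cross, Finset.sum_singleton]; rw [Finset.sum_comm]
  have h3 : ∑ x ∈ A, cross n {x} B = cross n A B := by
    simp only [cross, Finset.sum_singleton]
  rw [hB.vspin_eq hn, hA.1.spin_eq hn, Finset.sum_congr rfl fun x _ => h1 x,
    Finset.sum_sub_distrib (fun x => _ + cross n B {x}), Finset.sum_add_distrib, h2, h3]
  ring

/-! ### Vertical strips followed by horizontal strips -/

lemma VStrip.bead_eq {n : ℕ} (hn : 1 ≤ n) {lam nu : YoungDiagram} {B : Finset ℤ}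
    (h : VStrip n lam B nu) (p : ℤ) :
    bead nu p = bead lam p + (if p - n ∈ B then 1 else 0) - (if p ∈ B then 1 else 0) :=
  bead_eq_of_rim hn h.2 p

lemma VStrip.eq {n : ℕ} {lam mu nu : YoungDiagram} {B : Finset ℤ} (h : VStrip n lam B mu)
    (h' : VStrip n lam B nu) : mu = nu :=
  ext_rim fun c => (h.2 c).trans (h'.2 c).symm

lemma exists_vStrip {n : ℕ} (hn : 1 ≤ n) {lam : YoungDiagram} {B : Finset ℤ}
    (h : ∀ b ∈ B, bead lam b = 1 ∧ (bead lam (b + n) = 0 ∨ b + n ∈ B)) :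
    ∃ nu, VStrip n lam B nu := by
  obtain ⟨nu, hnu⟩ := exists_rim_eq_add_cov hn (lam := lam) (A := B) fun p => by
    have hb := bead_eq_zero_or_one lam p
    have h1 := h p
    have h2 := h (p - n)
    rw [sub_add_cancel] at h2
    split_ifs <;> simp_all
    all_goals omega
  exact ⟨nu, h, hnu⟩

section Toggle

variable {n : ℕ} {lam nu mu : YoungDiagram} {A B : Finset ℤ} {x : ℤ}

/-- The smallest position belongs to only one of the two strips. -/
lemma VStrip.notMem_of_le (hn : 1 ≤ n) (hB : VStrip n lam B nu) (hA : HStrip n nu A mu)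
    (hxA : x ∈ A) (hmin : ∀ y ∈ A ∪ B, x ≤ y) : x ∉ B := by
  intro hxB
  have h1 := hB.bead_eq hn x
  have h2 : x - n ∉ B := fun h => by
    have := hmin _ (Finset.mem_union_right A h); omega
  have h3 : x - n ∉ A := fun h => by
    have := hmin _ (Finset.mem_union_left B h); omega
  have h4 := (hA.1 x hxA).2.resolve_right h3
  have h5 := bead_eq_zero_or_one lam x
  rw [if_neg h2, if_pos hxB] at h1
  omega

/-- The ribbon at the smallest position can be moved from the horizontal strip to the vertical
one. -/
lemma VStrip.insert_min (hn : 1 ≤ n) (hB : VStrip n lam B nu) (hA : HStrip n nu A mu)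
    (hxA : x ∈ A) (hmin : ∀ y ∈ A ∪ B, x ≤ y) :
    ∃ nu', VStrip n lam (insert x B) nu' ∧ HStrip n nu' (A.erase x) mu := by
  have hxB := hB.notMem_of_le hn hA hxA hmin
  have hminA : ∀ y ∈ A, x ≤ y := fun y hy => hmin y (Finset.mem_union_left B hy)
  have hminB : ∀ y ∈ B, x ≤ y := fun y hy => hmin y (Finset.mem_union_right A hy)
  have h2 : x - n ∉ B := fun h => by have := hminB _ h; omega
  have h3 : x - n ∉ A := fun h => by have := hminA _ h; omega
  obtain ⟨nu', hnu'⟩ : ∃ nu', VStrip n lam (insert x B) nu' := by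
    refine exists_vStrip hn fun b hb => ?_
    rcases Finset.mem_insert.1 hb with rfl | hb
    · have h4 := hB.bead_eq hn b
      have h5 := hB.bead_eq hn (b + n)
      obtain ⟨h6, h7⟩ := hA.1 b hxA
      rw [if_neg h2, if_neg hxB] at h4
      rw [add_sub_cancel_right, if_neg hxB] at h5
      refine ⟨by have := h7.resolve_right h3; omega, ?_⟩
      by_cases h8 : b + n ∈ B
      · exact Or.inr (Finset.mem_insert_of_mem h8)
      · rw [if_neg h8] at h5; exact Or.inl (by omega)
    · exact ⟨(hB.1 b hb).1, (hB.1 b hb).2.imp_right Finset.mem_insert_of_mem⟩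
  refine ⟨nu', hnu', fun a ha => ?_, fun c => ?_⟩
  · obtain ⟨hax, haA⟩ := Finset.mem_erase.1 ha
    have hxa := hminA a haA
    obtain ⟨h6, h7⟩ := hA.1 a haA
    have h8 := hB.bead_eq hn (a + n)
    have h9 := hnu'.bead_eq hn (a + n)
    have h10 := hB.bead_eq hn a
    have h11 := hnu'.bead_eq hn a
    have h12 := bead_eq_zero_or_one nu' a
    have h13 := bead_eq_zero_or_one nu a
    rw [add_sub_cancel_right] at h8 h9
    simp only [Finset.mem_insert, show a + n ≠ x by omega, hax, false_or] at h9 h11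
    refine ⟨by omega, ?_⟩
    by_cases h14 : a - n = x
    · simp only [h14, true_or, if_true] at h11
      rw [h14, if_neg hxB] at h10
      exact Or.inl (by omega)
    · simp only [h14, false_or] at h11
      exact h7.imp (fun h => by omega) fun h => Finset.mem_erase.2 ⟨h14, h⟩
  · have h4 : cov n A c = (if x ≤ c ∧ c < x + n then 1 else 0) + cov n (A.erase x) c := by
      rw [← cov_insert (Finset.notMem_erase x A), Finset.insert_erase hxA]
    rw [hA.2, hB.2, hnu'.2, cov_insert hxB, h4]
    ring

/-- The ribbon at the smallest position can be moved from the vertical strip to the horizontal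
one. -/
lemma VStrip.erase_min (hn : 1 ≤ n) (hB : VStrip n lam B nu) (hA : HStrip n nu A mu)
    (hxB : x ∈ B) (hmin : ∀ y ∈ A ∪ B, x ≤ y) :
    ∃ nu', VStrip n lam (B.erase x) nu' ∧ HStrip n nu' (insert x A) mu := by
  have hxA : x ∉ A := fun hxA => hB.notMem_of_le hn hA hxA hmin hxB
  have hminA : ∀ y ∈ A, x ≤ y := fun y hy => hmin y (Finset.mem_union_left B hy)
  have hminB : ∀ y ∈ B, x ≤ y := fun y hy => hmin y (Finset.mem_union_right A hy)
  have h2 : x - n ∉ B := fun h => by have := hminB _ h; omega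
  obtain ⟨nu', hnu'⟩ : ∃ nu', VStrip n lam (B.erase x) nu' := by
    refine exists_vStrip hn fun b hb => ?_
    obtain ⟨hbx, hb⟩ := Finset.mem_erase.1 hb
    have := hminB b hb
    exact ⟨(hB.1 b hb).1, (hB.1 b hb).2.imp_right fun h =>
      Finset.mem_erase.2 ⟨by omega, h⟩⟩
  refine ⟨nu', hnu', fun a ha => ?_, fun c => ?_⟩
  · rcases Finset.mem_insert.1 ha with rfl | haA
    · obtain ⟨h6, h7⟩ := hB.1 a hxB
      have h9 := hnu'.bead_eq hn (a + n)
      have h11 := hnu'.bead_eq hn a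
      have h12 := bead_eq_zero_or_one nu' (a + n)
      have h13 := bead_eq_zero_or_one lam (a + n)
      simp only [Finset.mem_erase, add_sub_cancel_right, ne_eq, not_true, false_and, if_false,
        h2, and_false, show a + n ≠ a by omega, not_false_iff, true_and] at h9 h11
      refine ⟨?_, Or.inl (by omega)⟩
      rcases h7 with h7 | h7
      · split_ifs at h9 <;> omega
      · rw [if_pos h7] at h9; omega
    · have hxa := hminA a haA
      have hax : a ≠ x := fun h => hxA (h ▸ haA)
      obtain ⟨h6, h7⟩ := hA.1 a haA
      have h8 := hB.bead_eq hn (a + n)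
      have h9 := hnu'.bead_eq hn (a + n)
      have h10 := hB.bead_eq hn a
      have h11 := hnu'.bead_eq hn a
      rw [add_sub_cancel_right] at h8 h9
      simp only [Finset.mem_erase, ne_eq, show a + n ≠ x by omega, hax, not_false_iff, true_and]
        at h9 h11
      refine ⟨by omega, ?_⟩
      by_cases h14 : a - n = x
      · exact Or.inr (by rw [h14]; exact Finset.mem_insert_self _ _)
      · simp only [h14, not_false_iff, true_and] at h11
        exact h7.imp (fun h => by omega) Finset.mem_insert_of_mem
  · have h4 : cov n B c = (if x ≤ c ∧ c < x + n then 1 else 0) + cov n (B.erase x) c := by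
      rw [← cov_insert (Finset.notMem_erase x B), Finset.insert_erase hxB]
    rw [hA.2, hB.2, hnu'.2, cov_insert hxA, h4]
    ring

end Toggle

/-- The total spin of a vertical strip `B` on `lam` followed by a horizontal strip `A`. -/
def totalSpin (n : ℕ) (lam : YoungDiagram) (B A : Finset ℤ) : ℤ :=
  ∑ x ∈ B, (rim lam x - rim lam (x + n - 1)) + ∑ x ∈ A, (rim lam x - rim lam (x + n - 1)) -
    cross n B B + cross n A A + cross n B A - cross n A B

/-- The smallest position contributes the same amount to the spin in either strip. -/
lemma totalSpin_insert {n : ℕ} (lam : YoungDiagram) {A B : Finset ℤ} {x : ℤ}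
    (hA : ∀ a ∈ A, x < a) (hB : ∀ b ∈ B, x < b) :
    totalSpin n lam (insert x B) A = totalSpin n lam B (insert x A) := by
  have h1 : x ∉ A := fun h => lt_irrefl _ (hA x h)
  have h2 : x ∉ B := fun h => lt_irrefl _ (hB x h)
  have h3 : cross n A {x} = 0 := cross_singleton_right_eq_zero fun a ha => (hA a ha).le
  have h4 : cross n B {x} = 0 := cross_singleton_right_eq_zero fun a ha => (hB a ha).le
  have h5 : cross n {x} {x} = 0 := cross_singleton_right_eq_zero (by simp)
  simp only [totalSpin, Finset.sum_insert h1, Finset.sum_insert h2, cross_insert_left h1,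
    cross_insert_left h2, cross_insert_right h1, cross_insert_right h2, h3, h4, h5]
  ring

/-- The relation `∑ (-1)^i e_i h_{k - i} = 0` on the level of coefficients: the ribbon at the
smallest position can be moved between the vertical and the horizontal strip. -/
theorem sum_verticalCoeff_mul_horizontalCoeff {n : ℕ} (hn : 1 ≤ n) (mu lam : YoungDiagram) {k : ℕ}
    (hk : 1 ≤ k) : ∑ nu ∈ partitionsBelow mu, ∑ i ∈ Finset.range (k + 1),
      (-1) ^ i * (verticalCoeff n nu lam i * horizontalCoeff n mu nu (k - i)) = 0 := by
  set S := (partitionsBelow mu).sigma fun nu => (Finset.range (k + 1)).sigma fun i =>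
    (vstrips n lam nu i).sigma fun _ => strips n nu mu (k - i) with hS
  set F : Finset ℤ × Finset ℤ → Cq := fun p =>
    (-1) ^ p.1.card * q ^ (totalSpin n lam p.1 p.2).toNat with hF
  set pr : (Σ _ : YoungDiagram, Σ _ : ℕ, Σ _ : Finset ℤ, Finset ℤ) → Finset ℤ × Finset ℤ :=
    fun x => (x.2.2.1, x.2.2.2) with hpr
  have hmemS : ∀ nu i B A, (⟨nu, i, B, A⟩ : Σ _ : YoungDiagram, Σ _ : ℕ, Σ _ : Finset ℤ,
      Finset ℤ) ∈ S ↔ VStrip n lam B nu ∧ HStrip n nu A mu ∧ B.card = i ∧ i + A.card = k := by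
    intro nu i B A
    simp only [hS, Finset.mem_sigma, mem_partitionsBelow, Finset.mem_range, mem_vstrips hn,
      mem_strips hn]
    constructor
    · rintro ⟨h1, h2, ⟨h3, h4⟩, h5, h6⟩; exact ⟨h3, h5, h4, by omega⟩
    · rintro ⟨h3, h5, h4, h6⟩; exact ⟨h5.le, by omega, ⟨h3, h4⟩, h5, by omega⟩
  have hinj : Set.InjOn pr S := by
    rintro ⟨nu, i, B, A⟩ hx ⟨nu', i', B', A'⟩ hx' e
    rw [Finset.mem_coe, hmemS] at hx hx'
    simp only [hpr, Prod.mk.injEq] at e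
    obtain ⟨rfl, rfl⟩ := e
    obtain rfl := hx.1.eq hx'.1
    obtain rfl := hx.2.2.1.symm.trans hx'.2.2.1
    rfl
  have hmem : ∀ p : Finset ℤ × Finset ℤ, p ∈ S.image pr ↔
      ∃ nu, VStrip n lam p.1 nu ∧ HStrip n nu p.2 mu ∧ p.1.card + p.2.card = k := by
    rintro ⟨B, A⟩
    rw [Finset.mem_image]
    constructor
    · rintro ⟨⟨nu, i, B', A'⟩, hx, e⟩
      rw [hmemS] at hx
      simp only [hpr, Prod.mk.injEq] at e
      obtain ⟨rfl, rfl⟩ := e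
      exact ⟨nu, hx.1, hx.2.1, by rw [hx.2.2.1]; exact hx.2.2.2⟩
    · rintro ⟨nu, h1, h2, h3⟩
      exact ⟨⟨nu, B.card, B, A⟩, (hmemS ..).2 ⟨h1, h2, rfl, h3⟩, rfl⟩
  -- the two sets of positions determine the partition in between and the spin
  have hsum : ∑ nu ∈ partitionsBelow mu, ∑ i ∈ Finset.range (k + 1),
      (-1) ^ i * (verticalCoeff n nu lam i * horizontalCoeff n mu nu (k - i)) =
      ∑ p ∈ S.image pr, F p := by
    rw [Finset.sum_image hinj, hS]
    simp only [Finset.sum_sigma, verticalCoeff_eq_sum hn, horizontalCoeff_eq_sum hn]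
    refine Finset.sum_congr rfl fun nu _ => Finset.sum_congr rfl fun i _ => ?_
    rw [Finset.sum_mul_sum, Finset.mul_sum]
    refine Finset.sum_congr rfl fun B hB => ?_
    rw [Finset.mul_sum]
    refine Finset.sum_congr rfl fun A hA => ?_
    obtain ⟨h1, h2⟩ := (mem_vstrips hn).1 hB
    obtain ⟨h3, h4⟩ := (mem_strips hn).1 hA
    have h5 := vspin_add_spin hn h1 h3
    have h6 : (totalSpin n lam B A).toNat = vspin n lam B + spin (tiles n nu A) := by
      rw [totalSpin, ← h5]; omega
    simp only [hF, hpr]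
    rw [h6, h2, pow_add]
  rw [hsum]
  have hmin : ∀ p ∈ S.image pr, ∃ x ∈ p.2 ∪ p.1, ∀ y ∈ p.2 ∪ p.1, x ≤ y := by
    intro p hp
    obtain ⟨nu, -, -, h3⟩ := (hmem p).1 hp
    have hne : (p.2 ∪ p.1).Nonempty := by
      rw [Finset.nonempty_iff_ne_empty]
      intro h
      rw [Finset.union_eq_empty] at h
      rw [h.1, h.2] at h3
      simp at h3; omega
    exact ⟨_, Finset.min'_mem _ hne, fun y hy => Finset.min'_le _ y hy⟩
  choose! m hm hmle using hmin
  -- the smallest position does not change when it is moved to the other strip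
  have huniq : ∀ p ∈ S.image pr, ∀ p' ∈ S.image pr, p'.2 ∪ p'.1 = p.2 ∪ p.1 → m p' = m p := by
    intro p hp p' hp' e
    exact le_antisymm (hmle p' hp' _ (e ▸ hm p hp)) (hmle p hp _ (e ▸ hm p' hp'))
  -- the two halves of the involution
  have hleA : ∀ p ∈ S.image pr, m p ∈ p.2 → m p ∉ p.1 ∧
      (insert (m p) p.1, p.2.erase (m p)) ∈ S.image pr := by
    intro p hp hA
    obtain ⟨nu, h1, h2, h3⟩ := (hmem p).1 hp
    have h4 := h1.notMem_of_le hn h2 hA (hmle p hp)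
    obtain ⟨nu', h5, h6⟩ := h1.insert_min hn h2 hA (hmle p hp)
    refine ⟨h4, (hmem _).2 ⟨nu', h5, h6, ?_⟩⟩
    have := Finset.card_erase_add_one hA
    simp only [Finset.card_insert_of_notMem h4]
    omega
  have hleB : ∀ p ∈ S.image pr, m p ∉ p.2 → m p ∈ p.1 ∧
      (p.1.erase (m p), insert (m p) p.2) ∈ S.image pr := by
    intro p hp hA
    obtain ⟨nu, h1, h2, h3⟩ := (hmem p).1 hp
    have h4 := (Finset.mem_union.1 (hm p hp)).resolve_left hA
    obtain ⟨nu', h5, h6⟩ := h1.erase_min hn h2 h4 (hmle p hp)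
    refine ⟨h4, (hmem _).2 ⟨nu', h5, h6, ?_⟩⟩
    have := Finset.card_erase_add_one h4
    simp only [Finset.card_insert_of_notMem hA]
    omega
  refine Finset.sum_involution (fun p _ => if m p ∈ p.2 then
    (insert (m p) p.1, p.2.erase (m p)) else (p.1.erase (m p), insert (m p) p.2)) ?_ ?_ ?_ ?_
  · intro p hp
    have hlt : ∀ y ∈ p.2 ∪ p.1, y ≠ m p → m p < y := fun y hy hne =>
      lt_of_le_of_ne (hmle p hp y hy) hne.symm
    split_ifs with hA
    · obtain ⟨h1, -⟩ := hleA p hp hA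
      have h2 := totalSpin_insert (n := n) lam (A := p.2.erase (m p)) (B := p.1) (x := m p)
        (fun a ha => hlt a (Finset.mem_union_left _ (Finset.mem_of_mem_erase ha))
          (Finset.ne_of_mem_erase ha))
        (fun b hb => hlt b (Finset.mem_union_right _ hb) fun e => h1 (e ▸ hb))
      rw [Finset.insert_erase hA] at h2
      simp only [hF]
      rw [h2, Finset.card_insert_of_notMem h1]
      ring
    · obtain ⟨h1, -⟩ := hleB p hp hA
      have h2 := totalSpin_insert (n := n) lam (A := p.2) (B := p.1.erase (m p)) (x := m p)
        (fun a ha => hlt a (Finset.mem_union_left _ ha) fun e => hA (e ▸ ha))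
        (fun b hb => hlt b (Finset.mem_union_right _ (Finset.mem_of_mem_erase hb))
          (Finset.ne_of_mem_erase hb))
      rw [Finset.insert_erase h1] at h2
      simp only [hF]
      rw [← h2, ← Finset.card_erase_add_one h1]
      ring
  · intro p hp _ e
    split_ifs at e with hA
    · have := congrArg Prod.snd e
      simp only at this
      exact Finset.notMem_erase _ _ (this.symm ▸ hA)
    · have := congrArg Prod.snd e
      simp only at this
      exact hA (this ▸ Finset.mem_insert_self _ _)
  · intro p hp
    split_ifs with hA
    · exact (hleA p hp hA).2
    · exact (hleB p hp hA).2
  · intro p hp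
    by_cases hA : m p ∈ p.2
    · obtain ⟨h1, h2⟩ := hleA p hp hA
      have h3 : m (insert (m p) p.1, p.2.erase (m p)) = m p := by
        refine huniq p hp _ h2 ?_
        simp only
        rw [Finset.union_insert, ← Finset.insert_union, Finset.insert_erase hA]
      simp only [if_pos hA, h3, Finset.notMem_erase, if_false, Finset.erase_insert h1,
        Finset.insert_erase hA]
    · obtain ⟨h1, h2⟩ := hleB p hp hA
      have h3 : m (p.1.erase (m p), insert (m p) p.2) = m p := by
        refine huniq p hp _ h2 ?_
        simp only
        rw [Finset.insert_union, ← Finset.union_insert, Finset.insert_erase h1]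
      simp only [if_neg hA, h3, Finset.mem_insert_self, if_true, Finset.erase_insert hA,
        Finset.insert_erase h1]

/-! ### Relations between symmetric polynomials -/

section Symmetric

variable (σ : Type*) [Fintype σ]

/-- The generating function of the complete homogeneous symmetric polynomials. -/
def hSeries [DecidableEq σ] : PowerSeries (MvPolynomial σ Cq) :=
  PowerSeries.mk fun i => MvPolynomial.hsymm σ Cq i

/-- The generating function of the elementary symmetric polynomials, with alternating signs. -/
def eSeries : PowerSeries (MvPolynomial σ Cq) :=
  PowerSeries.mk fun i => (-1) ^ i * MvPolynomial.esymm σ Cq i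

/-- The generating function of the power sums, without constant term. -/
def pSeries : PowerSeries (MvPolynomial σ Cq) :=
  PowerSeries.mk fun i => if i = 0 then 0 else MvPolynomial.psum σ Cq i

/-- A monomial of degree `k` chooses an exponent for each variable. -/
lemma hSeries_eq_prod [DecidableEq σ] : hSeries σ =
    ∏ j : σ, PowerSeries.mk fun i => (MvPolynomial.X j : MvPolynomial σ Cq) ^ i := by
  ext1 k
  rw [hSeries, PowerSeries.coeff_mk, PowerSeries.coeff_prod, MvPolynomial.hsymm]
  refine Finset.sum_bij' (fun s _ => Multiset.toFinsupp s.1)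
    (fun l hl => ⟨Finsupp.toMultiset l, ?_⟩) ?_ ?_ ?_ ?_ ?_
  · rw [Finset.mem_finsuppAntidiag] at hl
    rw [Finsupp.card_toMultiset, ← hl.1, Finsupp.sum_fintype _ _ fun _ => rfl]
    rfl
  · intro s _
    rw [Finset.mem_finsuppAntidiag]
    refine ⟨?_, Finset.subset_univ _⟩
    change ∑ j, Multiset.count j s.1 = k
    rw [Multiset.sum_count_eq_card fun _ _ => Finset.mem_univ _, s.2]
  · exact fun _ _ => Finset.mem_univ _
  · exact fun s _ => Subtype.ext (Multiset.toFinsupp_toMultiset s.1)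
  · exact fun l _ => Finsupp.toMultiset_toFinsupp l
  · intro s _
    simp only [PowerSeries.coeff_mk, Multiset.toFinsupp_apply]
    rw [Finset.prod_multiset_map_count]
    exact Finset.prod_subset (Finset.subset_univ _) fun j _ hj => by
      rw [Multiset.count_eq_zero_of_notMem (by simpa using hj), pow_zero]

lemma eSeries_eq_prod : eSeries σ =
    ∏ j : σ, (1 - PowerSeries.C (MvPolynomial.X j : MvPolynomial σ Cq) * PowerSeries.X) := by
  have h : ∀ j : σ, (1 - PowerSeries.C (MvPolynomial.X j : MvPolynomial σ Cq) * PowerSeries.X) =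
      1 + (-PowerSeries.X) * PowerSeries.C (MvPolynomial.X j : MvPolynomial σ Cq) :=
    fun j => by ring
  simp only [h]
  rw [Finset.prod_one_add]
  ext1 k
  rw [eSeries, PowerSeries.coeff_mk, map_sum, MvPolynomial.esymm, Finset.mul_sum,
    Finset.powersetCard_eq_filter, Finset.sum_filter]
  refine Finset.sum_congr rfl fun t _ => ?_
  have h2 : (-PowerSeries.X : PowerSeries (MvPolynomial σ Cq)) ^ t.card =
      PowerSeries.C ((-1) ^ t.card) * PowerSeries.X ^ t.card := by
    rw [neg_pow, map_pow, map_neg, map_one]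
  rw [Finset.prod_mul_distrib, Finset.prod_const, ← map_prod, h2, mul_right_comm, ← map_mul,
    PowerSeries.coeff_C_mul, PowerSeries.coeff_X_pow]
  by_cases hk : t.card = k
  · rw [if_pos hk, if_pos hk.symm, hk, mul_one]
  · rw [if_neg hk, if_neg (Ne.symm hk), mul_zero]

lemma hSeries_mul_eSeries [DecidableEq σ] : hSeries σ * eSeries σ = 1 := by
  rw [hSeries_eq_prod, eSeries_eq_prod, ← Finset.prod_mul_distrib]
  refine Finset.prod_eq_one fun j _ => ?_
  rw [mul_sub, mul_one, ← mul_assoc]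
  ext1 k
  cases k with
  | zero => simp
  | succ k => simp [PowerSeries.coeff_succ_mul_X, pow_succ, PowerSeries.coeff_one]

/-- Newton's identities for the elementary symmetric polynomials, as a differential equation. -/
lemma X_mul_derivative_eSeries : PowerSeries.X * PowerSeries.derivative _ (eSeries σ) =
    -(eSeries σ * pSeries σ) := by
  ext1 k
  cases k with
  | zero => simp [PowerSeries.coeff_mul, pSeries]
  | succ k =>
    rw [PowerSeries.coeff_succ_X_mul, PowerSeries.coeff_derivative, map_neg, PowerSeries.coeff_mul]
    have := MvPolynomial.mul_esymm_eq_sum σ Cq (k + 1)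
    rw [Finset.sum_filter] at this
    simp only [eSeries, pSeries, PowerSeries.coeff_mk]
    let F : ℕ × ℕ → MvPolynomial σ Cq := fun a =>
      (-1) ^ a.1 * MvPolynomial.esymm σ Cq a.1 *
        (if a.2 = 0 then 0 else MvPolynomial.psum σ Cq a.2)
    rw [Finset.sum_congr (g := F) rfl fun a ha => ?_] at this
    · change _ = -∑ a ∈ Finset.HasAntidiagonal.antidiagonal (k + 1), F a
      push_cast at this
      have h : (-1 : MvPolynomial σ Cq) ^ (k + 1) * (-1) ^ (k + 1) = 1 := by
        rw [← mul_pow]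
        simp
      linear_combination (-1) ^ (k + 1) * this -
        (∑ a ∈ Finset.HasAntidiagonal.antidiagonal (k + 1), F a) * h
    · have ha' := Finset.HasAntidiagonal.mem_antidiagonal.1 ha
      by_cases h : a.2 = 0
      · rw [if_neg (by omega)]
        simp only [F, if_pos h, mul_zero]
      · rw [if_pos (by omega)]
        simp only [F, if_neg h]

/-- The differential equation of `hSeries`, by differentiation of `hSeries * eSeries = 1`. -/
lemma X_mul_derivative_hSeries [DecidableEq σ] :
    PowerSeries.X * PowerSeries.derivative _ (hSeries σ) = pSeries σ * hSeries σ := by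
  have h := congrArg (PowerSeries.derivative (MvPolynomial σ Cq)) (hSeries_mul_eSeries σ)
  rw [Derivation.leibniz, PowerSeries.derivative_one, smul_eq_mul, smul_eq_mul] at h
  linear_combination (PowerSeries.X * hSeries σ) * h - hSeries σ ^ 2 * X_mul_derivative_eSeries σ +
    (-(PowerSeries.X * PowerSeries.derivative _ (hSeries σ)) + hSeries σ * pSeries σ) *
      hSeries_mul_eSeries σ

/-- Newton's identities for the complete homogeneous symmetric polynomials. -/
theorem natCast_mul_hsymm [DecidableEq σ] (k : ℕ) :
    (k : MvPolynomial σ Cq) * MvPolynomial.hsymm σ Cq k =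
      ∑ i ∈ Finset.Icc 1 k, MvPolynomial.psum σ Cq i * MvPolynomial.hsymm σ Cq (k - i) := by
  have h := congrArg (PowerSeries.coeff k) (X_mul_derivative_hSeries σ)
  cases k with
  | zero => simp
  | succ k =>
    rw [PowerSeries.coeff_succ_X_mul, PowerSeries.coeff_derivative, PowerSeries.coeff_mul,
      Finset.Nat.sum_antidiagonal_eq_sum_range_succ_mk, Finset.sum_range_succ'] at h
    simp only [hSeries, pSeries, PowerSeries.coeff_mk, Nat.succ_ne_zero, if_false, if_true,
      zero_mul, add_zero] at h
    rw [show Finset.Icc 1 (k + 1) = Finset.Ico 1 (k + 2) from rfl, Finset.sum_Ico_eq_sum_range,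
      Nat.cast_succ, mul_comm, h]
    exact Finset.sum_congr rfl fun i _ => by rw [add_comm 1 i]

/-- The alternating relation between complete homogeneous and elementary symmetric polynomials. -/
theorem sum_esymm_mul_hsymm [DecidableEq σ] {k : ℕ} (hk : 1 ≤ k) : ∑ i ∈ Finset.range (k + 1),
    (-1) ^ i * (MvPolynomial.esymm σ Cq i * MvPolynomial.hsymm σ Cq (k - i)) = 0 := by
  have h := congrArg (PowerSeries.coeff k) (hSeries_mul_eSeries σ)
  rw [mul_comm, PowerSeries.coeff_mul, Finset.Nat.sum_antidiagonal_eq_sum_range_succ_mk,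
    PowerSeries.coeff_one, if_neg (by omega)] at h
  simpa only [hSeries, eSeries, PowerSeries.coeff_mk, mul_assoc] using h

end Symmetric

/-! ### The coefficients are graded -/

/-- The partitions of `m`. -/
def partitionsOf (m : ℕ) : Finset YoungDiagram :=
  (show {mu : YoungDiagram | mu.card = m}.Finite from
    (((Finset.range m) ×ˢ (Finset.range m)).powerset.finite_toSet.preimage
      (f := YoungDiagram.cells) fun _ _ _ _ h => YoungDiagram.ext h).subset fun mu h => by
        rw [Set.mem_preimage, Finset.mem_coe, Finset.mem_powerset]
        rintro ⟨i, j⟩ hc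
        rw [YoungDiagram.mem_cells] at hc
        have hi : i < mu.cells.card := by
          refine Nat.lt_of_succ_le (le_of_eq_of_le (Finset.card_range (i + 1)).symm
            (Finset.card_le_card_of_injOn (fun a => (a, j)) (fun a ha => ?_)
              fun a _ b _ h => (Prod.mk.inj h).1))
          exact mu.up_left_mem (Nat.lt_succ_iff.1 (Finset.mem_range.1 ha)) le_rfl hc
        have hj : j < mu.cells.card := by
          refine Nat.lt_of_succ_le (le_of_eq_of_le (Finset.card_range (j + 1)).symm
            (Finset.card_le_card_of_injOn (fun a => (i, a)) (fun a ha => ?_)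
              fun a _ b _ h => (Prod.mk.inj h).2))
          exact mu.up_left_mem le_rfl (Nat.lt_succ_iff.1 (Finset.mem_range.1 ha)) hc
        have h : mu.cells.card = m := h
        rw [h] at hi hj
        exact Finset.mem_product.2 ⟨Finset.mem_range.2 hi, Finset.mem_range.2 hj⟩).toFinset

lemma mem_partitionsOf {mu : YoungDiagram} {m : ℕ} : mu ∈ partitionsOf m ↔ mu.card = m := by
  simp [partitionsOf]

/-- Coefficients `c mu lam k` which vanish unless `mu / lam` is a skew shape with `n * k` cells. -/
def IsGraded (n : ℕ) (c : YoungDiagram → YoungDiagram → ℕ → Cq) : Prop :=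
  ∀ mu lam k, c mu lam k ≠ 0 → lam ≤ mu ∧ mu.card = lam.card + n * k

lemma IsRibbonTiling.card_eq {n : ℕ} {S : Finset (ℕ × ℕ)} {T : RibbonSet}
    (h : IsRibbonTiling n S T) : S.card = n * T.card := by
  rw [← h.2.2, cellsOf, Finset.card_biUnion fun r hr r' hr' hne => h.2.1 hr hr' hne,
    Finset.sum_congr (f := fun r => (id r).card) (g := fun _ => n) rfl fun r hr => (h.1 r hr).2,
    Finset.sum_const, smul_eq_mul, mul_comm]

lemma card_eq_add_of_card_skewCells {lam mu : YoungDiagram} (hle : lam ≤ mu) {m : ℕ}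
    (h : (skewCells mu lam).card = m) : mu.card = lam.card + m := by
  have := Finset.card_sdiff_add_card_eq_card (YoungDiagram.cells_subset_iff.2 hle)
  rw [skewCells] at h
  change mu.cells.card = lam.cells.card + m
  omega

lemma IsHorizontalRibbonStrip.card_eq {n : ℕ} {lam mu : YoungDiagram} {T : RibbonSet}
    (h : IsHorizontalRibbonStrip n (skewCells mu lam) T) (hle : lam ≤ mu) :
    mu.card = lam.card + n * T.card :=
  card_eq_add_of_card_skewCells hle h.2.1.card_eq

lemma isGraded_horizontalCoeff (n : ℕ) : IsGraded n (horizontalCoeff n) := by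
  intro mu lam k h
  obtain ⟨T, hT, -⟩ := Finset.exists_ne_zero_of_sum_ne_zero h
  obtain ⟨-, hle, hstrip, rfl⟩ := Finset.mem_filter.1 hT
  exact ⟨hle, hstrip.card_eq hle⟩

lemma isGraded_verticalCoeff (n : ℕ) : IsGraded n (verticalCoeff n) := by
  intro mu lam k h
  obtain ⟨T, hT, -⟩ := Finset.exists_ne_zero_of_sum_ne_zero h
  obtain ⟨-, hle, hstrip, rfl⟩ := Finset.mem_filter.1 hT
  refine ⟨hle, card_eq_add_of_card_skewCells hle ?_⟩
  have := hstrip.2.1.card_eq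
  rwa [conj, Finset.card_image_of_injective _ Prod.swap_injective,
    Finset.card_image_of_injective _ conj_injective] at this

lemma BorderChain.card_eq {n : ℕ} {lam mu : YoungDiagram} {L : List RibbonSet}
    (h : BorderChain n lam mu L) : mu.card = lam.card + n * stripSize L := by
  induction h with
  | single mu T hle hne hT hconn => simpa [stripSize] using hT.card_eq hle
  | extend nu mu T T' L hL hle hne hT hatt ih =>
    have h1 := hT.card_eq hle
    have h2 : stripSize (T :: T' :: L) = T.card + stripSize (T' :: L) := rfl
    rw [h1, ih, h2]
    ring

lemma isGraded_borderCoeff {n : ℕ} (hn : 1 ≤ n) : IsGraded n (borderCoeff n) := by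
  intro mu lam k h
  rw [borderCoeff_eq_sum hn] at h
  obtain ⟨L, hL, -⟩ := Finset.exists_ne_zero_of_sum_ne_zero h
  obtain ⟨hchain, rfl⟩ := mem_chains.1 hL
  exact ⟨hchain.le hn, hchain.card_eq⟩

lemma horizontalCoeff_zero {n : ℕ} (hn : 1 ≤ n) (mu lam : YoungDiagram) :
    horizontalCoeff n mu lam 0 = if mu = lam then 1 else 0 := by
  rw [horizontalCoeff_eq_sum hn, strips_zero hn]
  split_ifs
  · simp [tiles, spin]
  · rfl

lemma verticalCoeff_zero {n : ℕ} (hn : 1 ≤ n) (mu lam : YoungDiagram) :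
    verticalCoeff n mu lam 0 = if mu = lam then 1 else 0 := by
  rw [verticalCoeff_eq_sum hn, vstrips, strips_zero hn, YoungDiagram.transpose_eq_iff]
  split_ifs
  · simp [vspin, flipPos, tiles, spin]
  · rfl

/-! ### Raising and lowering operators on formal combinations of partitions -/

section Operators

/-- The operator `lam ↦ ∑_mu c(mu, lam, k) mu` on formal linear combinations of partitions. The sum
is restricted to the partitions which matter for graded coefficients. -/
def raiseOp (n : ℕ) (c : YoungDiagram → YoungDiagram → ℕ → Cq) (k : ℕ) :
    Module.End Cq (YoungDiagram →₀ Cq) :=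
  Finsupp.linearCombination Cq fun lam =>
    ∑ mu ∈ partitionsOf (lam.card + n * k), Finsupp.single mu (c mu lam k)

/-- The operator `lam ↦ ∑_mu c(lam, mu, k) mu` on formal linear combinations of partitions. The sum
is restricted to the partitions which matter for graded coefficients. -/
def lowerOp (c : YoungDiagram → YoungDiagram → ℕ → Cq) (k : ℕ) :
    Module.End Cq (YoungDiagram →₀ Cq) :=
  Finsupp.linearCombination Cq fun lam =>
    ∑ mu ∈ partitionsBelow lam, Finsupp.single mu (c lam mu k)

variable {n : ℕ} {c d : YoungDiagram → YoungDiagram → ℕ → Cq}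

lemma raiseOp_single_apply (hc : IsGraded n c) (k : ℕ) (lam mu : YoungDiagram) :
    raiseOp n c k (Finsupp.single lam 1) mu = c mu lam k := by
  rw [raiseOp, Finsupp.linearCombination_single, one_smul, Finsupp.finsetSum_apply]
  simp only [Finsupp.single_apply]
  rw [Finset.sum_ite_eq']
  split_ifs with h
  · rfl
  · by_contra h'
    exact h (mem_partitionsOf.2 (hc _ _ _ (Ne.symm h')).2)

lemma lowerOp_single_apply (hc : IsGraded n c) (k : ℕ) (lam mu : YoungDiagram) :
    lowerOp c k (Finsupp.single lam 1) mu = c lam mu k := by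
  rw [lowerOp, Finsupp.linearCombination_single, one_smul, Finsupp.finsetSum_apply]
  simp only [Finsupp.single_apply]
  rw [Finset.sum_ite_eq']
  split_ifs with h
  · rfl
  · by_contra h'
    exact h (mem_partitionsBelow.2 (hc _ _ _ (Ne.symm h')).1)

lemma raiseOp_apply (hc : IsGraded n c) (k : ℕ) (f : YoungDiagram →₀ Cq) (mu : YoungDiagram) :
    raiseOp n c k f mu = ∑ nu ∈ partitionsBelow mu, f nu * c mu nu k := by
  induction f using Finsupp.induction_linear with
  | zero => simp
  | add f g hf hg => simp only [map_add, Finsupp.add_apply, hf, hg, add_mul, Finset.sum_add_distrib]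
  | single lam a =>
    rw [← mul_one a, ← smul_eq_mul, ← Finsupp.smul_single, map_smul, Finsupp.smul_apply,
      raiseOp_single_apply hc]
    simp only [Finsupp.smul_single, Finsupp.single_apply, ite_mul, zero_mul, smul_eq_mul, mul_one]
    rw [Finset.sum_ite_eq]
    split_ifs with h
    · rfl
    · have : c mu lam k = 0 := by
        by_contra h'
        exact h (mem_partitionsBelow.2 (hc _ _ _ h').1)
      rw [this, mul_zero]

lemma raiseOp_mul_single_apply (hc : IsGraded n c) (hd : IsGraded n d) (i j : ℕ)
    (lam mu : YoungDiagram) : (raiseOp n c i * raiseOp n d j) (Finsupp.single lam 1) mu =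
      ∑ nu ∈ partitionsBelow mu, d nu lam j * c mu nu i := by
  rw [Module.End.mul_apply, raiseOp_apply hc]
  simp only [raiseOp_single_apply hd]

/-- The matrix coefficients of a composition of lowering operators are those of the composition of
the raising operators in the opposite order. -/
lemma lowerOp_mul_single_apply (hd : IsGraded n d) (i j : ℕ) (lam mu : YoungDiagram) :
    (lowerOp d j * lowerOp c i) (Finsupp.single mu 1) lam =
      ∑ nu ∈ partitionsBelow mu, d nu lam j * c mu nu i := by
  rw [Module.End.mul_apply, show lowerOp c i = Finsupp.linearCombination Cq _ from rfl,
    Finsupp.linearCombination_single, one_smul, map_sum,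
    Finsupp.finsetSum_apply]
  refine Finset.sum_congr rfl fun nu _ => ?_
  rw [← mul_one (c mu nu i), ← smul_eq_mul, ← Finsupp.smul_single, map_smul, Finsupp.smul_apply,
    lowerOp_single_apply hd, smul_eq_mul, smul_eq_mul, mul_one, mul_comm]

lemma end_ext {U W : Module.End Cq (YoungDiagram →₀ Cq)}
    (h : ∀ lam mu, U (Finsupp.single lam 1) mu = W (Finsupp.single lam 1) mu) : U = W :=
  Finsupp.lhom_ext' fun lam => LinearMap.ext_ring (Finsupp.ext fun mu => h lam mu)

lemma raiseOp_zero (hc : IsGraded n c) (h : ∀ mu lam, c mu lam 0 = if mu = lam then 1 else 0) :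
    raiseOp n c 0 = 1 := by
  refine end_ext fun lam mu => ?_
  rw [raiseOp_single_apply hc, h, Module.End.one_apply, Finsupp.single_apply]
  simp only [eq_comm]

lemma lowerOp_zero (hc : IsGraded n c) (h : ∀ mu lam, c mu lam 0 = if mu = lam then 1 else 0) :
    lowerOp c 0 = 1 := by
  refine end_ext fun lam mu => ?_
  rw [lowerOp_single_apply hc, h, Module.End.one_apply, Finsupp.single_apply]

lemma natCast_mul_raiseOp (hn : 1 ≤ n) (k : ℕ) :
    (k : Module.End Cq (YoungDiagram →₀ Cq)) * raiseOp n (horizontalCoeff n) k =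
      ∑ i ∈ Finset.Icc 1 k,
        raiseOp n (horizontalCoeff n) (k - i) * raiseOp n (borderCoeff n) i := by
  refine end_ext fun lam mu => ?_
  rw [LinearMap.sum_apply, Finsupp.finsetSum_apply, ← nsmul_eq_mul, LinearMap.smul_apply,
    Finsupp.smul_apply, raiseOp_single_apply (isGraded_horizontalCoeff n), nsmul_eq_mul,
    natCast_mul_horizontalCoeff hn, Finset.sum_comm]
  exact Finset.sum_congr rfl fun i _ => (raiseOp_mul_single_apply (isGraded_horizontalCoeff n)
    (isGraded_borderCoeff hn) _ _ _ _).symm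

lemma natCast_mul_lowerOp (hn : 1 ≤ n) (k : ℕ) :
    (k : Module.End Cq (YoungDiagram →₀ Cq)) * lowerOp (horizontalCoeff n) k =
      ∑ i ∈ Finset.Icc 1 k, lowerOp (borderCoeff n) i * lowerOp (horizontalCoeff n) (k - i) := by
  refine end_ext fun mu lam => ?_
  rw [LinearMap.sum_apply, Finsupp.finsetSum_apply, ← nsmul_eq_mul, LinearMap.smul_apply,
    Finsupp.smul_apply, lowerOp_single_apply (isGraded_horizontalCoeff n), nsmul_eq_mul,
    natCast_mul_horizontalCoeff hn, Finset.sum_comm]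
  exact Finset.sum_congr rfl fun i _ => (lowerOp_mul_single_apply
    (isGraded_borderCoeff hn) _ _ _ _).symm

lemma sum_raiseOp_mul_raiseOp (hn : 1 ≤ n) {k : ℕ} (hk : 1 ≤ k) :
    ∑ i ∈ Finset.range (k + 1), (-1 : Cq) ^ i •
      (raiseOp n (horizontalCoeff n) (k - i) * raiseOp n (verticalCoeff n) i) = 0 := by
  refine end_ext fun lam mu => ?_
  rw [LinearMap.sum_apply, Finsupp.finsetSum_apply, LinearMap.zero_apply, Finsupp.zero_apply,
    ← sum_verticalCoeff_mul_horizontalCoeff hn mu lam hk, Finset.sum_comm]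
  refine Finset.sum_congr rfl fun i _ => ?_
  rw [LinearMap.smul_apply, Finsupp.smul_apply, raiseOp_mul_single_apply
    (isGraded_horizontalCoeff n) (isGraded_verticalCoeff n), smul_eq_mul, Finset.mul_sum]

lemma sum_lowerOp_mul_lowerOp (hn : 1 ≤ n) {k : ℕ} (hk : 1 ≤ k) :
    ∑ i ∈ Finset.range (k + 1), (-1 : Cq) ^ i •
      (lowerOp (verticalCoeff n) i * lowerOp (horizontalCoeff n) (k - i)) = 0 := by
  refine end_ext fun mu lam => ?_
  rw [LinearMap.sum_apply, Finsupp.finsetSum_apply, LinearMap.zero_apply, Finsupp.zero_apply,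
    ← sum_verticalCoeff_mul_horizontalCoeff hn mu lam hk, Finset.sum_comm]
  refine Finset.sum_congr rfl fun i _ => ?_
  rw [LinearMap.smul_apply, Finsupp.smul_apply, lowerOp_mul_single_apply
    (isGraded_verticalCoeff n), smul_eq_mul, Finset.mul_sum]

end Operators

/-! ### Subalgebras and the relations between the three families -/

section Subalgebra

variable {K R : Type*} [Field K] [Ring R] [Algebra K R] {x y : ℕ → R}

/-- Newton's identities determine either of the families `h_k`, `p_k` by the other one. -/
lemma mem_iff_of_newton [CharZero K] (S : Subalgebra K R) (hx : x 0 = 1)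
    (h : ∀ k : ℕ, (k : R) * x k = ∑ i ∈ Finset.Icc 1 k, x (k - i) * y i) :
    (∀ k, 1 ≤ k → x k ∈ S) ↔ ∀ k, 1 ≤ k → y k ∈ S := by
  constructor
  · intro hS k
    have hS' : ∀ k, x k ∈ S := fun k => by
      rcases Nat.eq_zero_or_pos k with rfl | hk
      · exact hx ▸ S.one_mem
      · exact hS k hk
    induction k using Nat.strong_induction_on with
    | _ k ih =>
      intro hk
      have h1 := h k
      rw [← Finset.sum_erase_add _ _ (Finset.right_mem_Icc.2 hk), Nat.sub_self, hx, one_mul,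
        ← sub_eq_iff_eq_add'] at h1
      rw [← h1]
      refine S.sub_mem (S.mul_mem (natCast_mem S k) (hS' k)) (S.sum_mem fun i hi => ?_)
      rw [Finset.mem_erase, Finset.mem_Icc] at hi
      exact S.mul_mem (hS' _) (ih i (by omega) (by omega))
  · intro hS k
    induction k using Nat.strong_induction_on with
    | _ k ih =>
      intro hk
      have h1 : (k : R) * x k ∈ S := h k ▸ S.sum_mem fun i hi => by
        rw [Finset.mem_Icc] at hi
        refine S.mul_mem ?_ (hS i hi.1)
        rcases Nat.eq_zero_or_pos (k - i) with h0 | h0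
        · rw [h0, hx]
          exact S.one_mem
        · exact ih _ (by omega) h0
      have h2 := S.smul_mem h1 ((k : K)⁻¹)
      rwa [← nsmul_eq_mul, ← Nat.cast_smul_eq_nsmul K, smul_smul,
        inv_mul_cancel₀ (Nat.cast_ne_zero.2 (by omega)), one_smul] at h2

/-- The relations `∑ (-1)^i e_i h_{k - i} = 0` determine either of the families `h_k`, `e_k` by the
other one. -/
lemma mem_iff_of_alternating (S : Subalgebra K R) (hx : x 0 = 1) (hy : y 0 = 1)
    (h : ∀ k, 1 ≤ k → ∑ i ∈ Finset.range (k + 1), (-1 : K) ^ i • (x (k - i) * y i) = 0) :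
    (∀ k, 1 ≤ k → x k ∈ S) ↔ ∀ k, 1 ≤ k → y k ∈ S := by
  constructor
  · intro hS k
    induction k using Nat.strong_induction_on with
    | _ k ih =>
      intro hk
      have h1 := h k hk
      rw [Finset.sum_range_succ, Nat.sub_self, hx, one_mul, add_eq_zero_iff_eq_neg'] at h1
      have h2 : (-1 : K) ^ k • y k ∈ S := h1 ▸ S.neg_mem (S.sum_mem fun i hi => S.smul_mem
        (S.mul_mem (hS _ (by have := Finset.mem_range.1 hi; omega)) (by
          rcases Nat.eq_zero_or_pos i with rfl | h0
          · exact hy ▸ S.one_mem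
          · exact ih i (Finset.mem_range.1 hi) h0)) _)
      have h3 := S.smul_mem h2 ((-1 : K) ^ k)
      rwa [smul_smul, ← mul_pow, neg_one_mul, neg_neg, one_pow, one_smul] at h3
  · intro hS k
    induction k using Nat.strong_induction_on with
    | _ k ih =>
      intro hk
      have h1 := h k hk
      rw [Finset.sum_range_succ', pow_zero, one_smul, hy, mul_one, Nat.sub_zero,
        add_eq_zero_iff_eq_neg'] at h1
      refine h1 ▸ S.neg_mem (S.sum_mem fun i hi => S.smul_mem
        (S.mul_mem ?_ (hS _ (by omega))) _)
      rcases Nat.eq_zero_or_pos (k - (i + 1)) with h0 | h0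
      · rw [h0, hx]
        exact S.one_mem
      · exact ih _ (by omega) h0

end Subalgebra

/-! ### The operators on `V` -/

/-- A family `A₁, A₂, …` together with `A₀ = 1`. -/
def withOne {R : Type*} [One R] (A : ℕ+ → R) (k : ℕ) : R :=
  if h : 0 < k then A (k.toPNat h) else 1

section WithOne

variable {R : Type*}

lemma withOne_zero [One R] (A : ℕ+ → R) : withOne A 0 = 1 := dif_neg (lt_irrefl 0)

lemma withOne_coe [One R] (A : ℕ+ → R) (k : ℕ+) : withOne A k = A k := dif_pos k.pos

/-- For `k = 0` the left side is `1`; this matters for power sums, since `psum σ R 0` is the number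
of variables. -/
lemma withOne_eq [One R] {B : ℕ → R} {k : ℕ} (h : 1 ≤ k ∨ B 0 = 1) :
    withOne (fun i : ℕ+ => B i) k = B k := by
  rcases Nat.eq_zero_or_pos k with rfl | hk
  · exact (withOne_zero _).trans (h.resolve_left (by omega)).symm
  · lift k to ℕ+ using hk
    exact withOne_coe _ k

lemma map_withOne {S : Type*} [Semiring R] [Semiring S] [Algebra Cq R] [Algebra Cq S]
    (f : R →ₐ[Cq] S) (A : ℕ+ → R) (B : ℕ+ → S) (h : ∀ k, f (A k) = B k) (k : ℕ) :
    f (withOne A k) = withOne B k := by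
  rcases Nat.eq_zero_or_pos k with rfl | hk
  · rw [withOne_zero, withOne_zero, map_one]
  · lift k to ℕ+ using hk
    rw [withOne_coe, withOne_coe, h]

lemma withOne_commute [Monoid R] {A B : ℕ+ → R} (h : ∀ i j, Commute (A i) (B j)) (i j : ℕ) :
    Commute (withOne A i) (withOne B j) := by
  rcases Nat.eq_zero_or_pos i with rfl | hi
  · rw [withOne_zero]
    exact Commute.one_left _
  rcases Nat.eq_zero_or_pos j with rfl | hj
  · rw [withOne_zero]
    exact Commute.one_right _
  lift i to ℕ+ using hi
  lift j to ℕ+ using hj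
  rw [withOne_coe, withOne_coe]
  exact h i j

end WithOne

section Relations

variable {V : Type*} [AddCommGroup V] [Module Cq V] {H E P : ℕ+ → Module.End Cq V}

lemma SatisfiesRelations.commute_P_H (hrel : SatisfiesRelations H E P) (i j : ℕ) :
    Commute (withOne P i) (withOne H j) :=
  withOne_commute (fun _ _ => hrel.commute (Sum.inr (Sum.inr _)) (Sum.inl _)) i j

lemma SatisfiesRelations.commute_E_H (hrel : SatisfiesRelations H E P) (i j : ℕ) :
    Commute (withOne E i) (withOne H j) :=
  withOne_commute (fun _ _ => hrel.commute (Sum.inr (Sum.inl _)) (Sum.inl _)) i j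

/-- Newton's identities for the operators, which come from a relation in the free algebra. -/
lemma SatisfiesRelations.natCast_mul (hrel : SatisfiesRelations H E P) (k : ℕ) :
    (k : Module.End Cq V) * withOne H k =
      ∑ i ∈ Finset.Icc 1 k, withOne P i * withOne H (k - i) := by
  let h : ℕ+ → FreeAlgebra Cq (ℕ+ ⊕ (ℕ+ ⊕ ℕ+)) := fun i => FreeAlgebra.ι Cq (Sum.inl i)
  let p : ℕ+ → FreeAlgebra Cq (ℕ+ ⊕ (ℕ+ ⊕ ℕ+)) := fun i => FreeAlgebra.ι Cq (Sum.inr (Sum.inr i))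
  have key := hrel.relation
    ((k : FreeAlgebra Cq _) * withOne h k - ∑ i ∈ Finset.Icc 1 k, withOne p i * withOne h (k - i))
  simp only [IsRelation, map_sub, map_mul, map_natCast, map_sum] at key
  rw [map_withOne (FreeAlgebra.lift Cq (letters H E P)) h H
      fun k => FreeAlgebra.lift_ι_apply _ _] at key
  simp only [map_withOne (FreeAlgebra.lift Cq (letters H E P)) h H
      fun k => FreeAlgebra.lift_ι_apply _ _,
    map_withOne (FreeAlgebra.lift Cq (letters H E P)) p P
      fun k => FreeAlgebra.lift_ι_apply _ _] at key
  refine sub_eq_zero.1 (key fun N => sub_eq_zero.2 ?_)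
  have hN : ∀ k, FreeAlgebra.lift Cq (letters
      (fun i : ℕ+ => MvPolynomial.hsymm (Fin N) Cq i)
      (fun i : ℕ+ => MvPolynomial.esymm (Fin N) Cq i)
      (fun i : ℕ+ => MvPolynomial.psum (Fin N) Cq i)) (withOne h k) =
      MvPolynomial.hsymm (Fin N) Cq k := fun k =>
    (map_withOne _ h _ (fun k => FreeAlgebra.lift_ι_apply _ _) k).trans
      (withOne_eq (B := fun i => MvPolynomial.hsymm (Fin N) Cq i)
        (Or.inr (MvPolynomial.hsymm_zero _ _)))
  rw [hN, natCast_mul_hsymm]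
  refine Finset.sum_congr rfl fun i hi => ?_
  rw [hN]
  congr 1
  exact ((map_withOne _ p _ (fun k => FreeAlgebra.lift_ι_apply _ _) i).trans
    (withOne_eq (B := fun i => MvPolynomial.psum (Fin N) Cq i)
      (Or.inl (Finset.mem_Icc.1 hi).1))).symm

/-- The alternating relation for the operators, which comes from a relation in the free algebra. -/
lemma SatisfiesRelations.alternating (hrel : SatisfiesRelations H E P) {k : ℕ} (hk : 1 ≤ k) :
    ∑ i ∈ Finset.range (k + 1), (-1 : Cq) ^ i • (withOne E i * withOne H (k - i)) = 0 := by
  let h : ℕ+ → FreeAlgebra Cq (ℕ+ ⊕ (ℕ+ ⊕ ℕ+)) := fun i => FreeAlgebra.ι Cq (Sum.inl i)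
  let e : ℕ+ → FreeAlgebra Cq (ℕ+ ⊕ (ℕ+ ⊕ ℕ+)) := fun i => FreeAlgebra.ι Cq (Sum.inr (Sum.inl i))
  have key := hrel.relation
    (∑ i ∈ Finset.range (k + 1), (-1 : Cq) ^ i • (withOne e i * withOne h (k - i)))
  simp only [IsRelation, map_mul, map_smul, map_sum] at key
  simp only [map_withOne (FreeAlgebra.lift Cq (letters H E P)) h H
      fun k => FreeAlgebra.lift_ι_apply _ _,
    map_withOne (FreeAlgebra.lift Cq (letters H E P)) e E
      fun k => FreeAlgebra.lift_ι_apply _ _] at key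
  refine key fun N => ?_
  rw [← sum_esymm_mul_hsymm (Fin N) hk]
  refine Finset.sum_congr rfl fun i _ => ?_
  rw [Algebra.smul_def, map_pow, map_neg, map_one]
  congr 2
  · exact (map_withOne _ e _ (fun k => FreeAlgebra.lift_ι_apply _ _) i).trans
      (withOne_eq (B := fun i => MvPolynomial.esymm (Fin N) Cq i)
        (Or.inr (MvPolynomial.esymm_zero _ _)))
  · exact (map_withOne _ h _ (fun k => FreeAlgebra.lift_ι_apply _ _) _).trans
      (withOne_eq (B := fun i => MvPolynomial.hsymm (Fin N) Cq i)
        (Or.inr (MvPolynomial.hsymm_zero _ _)))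

end Relations

section Rules

variable {V : Type*} [AddCommGroup V] [Module Cq V]

/-- The pairs of an operator `A` on `V` and an operator `U` on formal combinations of partitions
such that `A` acts on the vectors `v_lam` in the way `U` acts on the partitions `lam`. -/
def intertwiners (v : YoungDiagram → V) :
    Subalgebra Cq (Module.End Cq V × Module.End Cq (YoungDiagram →₀ Cq)) where
  carrier := {X | X.1 ∘ₗ Finsupp.linearCombination Cq v = Finsupp.linearCombination Cq v ∘ₗ X.2}
  mul_mem' {X Y} hX hY := by
    change (X.1 * Y.1) ∘ₗ _ = _ ∘ₗ (X.2 * Y.2)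
    rw [Module.End.mul_eq_comp, Module.End.mul_eq_comp, LinearMap.comp_assoc, hY,
      ← LinearMap.comp_assoc, hX, LinearMap.comp_assoc]
  add_mem' {X Y} hX hY := by
    change (X.1 + Y.1) ∘ₗ _ = _ ∘ₗ (X.2 + Y.2)
    rw [LinearMap.add_comp, LinearMap.comp_add, hX, hY]
  algebraMap_mem' a := by
    ext lam
    simp [Module.algebraMap_end_apply]

variable {n : ℕ} {c : YoungDiagram → YoungDiagram → ℕ → Cq} {v : YoungDiagram → V}

lemma mem_intertwiners_iff {A : Module.End Cq V} {U : Module.End Cq (YoungDiagram →₀ Cq)} :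
    (A, U) ∈ intertwiners v ↔ ∀ lam,
      A (v lam) = ∑ᶠ mu, U (Finsupp.single lam 1) mu • v mu := by
  have h : ∀ f : YoungDiagram →₀ Cq, Finsupp.linearCombination Cq v f = ∑ᶠ mu, f mu • v mu :=
    fun f => by
      rw [Finsupp.linearCombination_apply, Finsupp.sum]
      refine (finsum_eq_sum_of_support_subset _ fun mu hmu => ?_).symm
      rw [Finset.mem_coe, Finsupp.mem_support_iff]
      exact fun h0 => hmu (by simp [h0])
  constructor
  · intro hX lam
    have := LinearMap.congr_fun (show A ∘ₗ _ = _ ∘ₗ U from hX) (Finsupp.single lam 1)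
    rw [LinearMap.comp_apply, LinearMap.comp_apply, Finsupp.linearCombination_single, one_smul,
      h] at this
    exact this
  · intro hX
    refine Finsupp.lhom_ext' fun lam => LinearMap.ext_ring ?_
    change A (Finsupp.linearCombination Cq v (Finsupp.single lam 1)) =
      Finsupp.linearCombination Cq v (U (Finsupp.single lam 1))
    rw [Finsupp.linearCombination_single, one_smul, h, hX]

lemma raises_iff (hc : IsGraded n c) (A : ℕ+ → Module.End Cq V) :
    Raises c v A ↔ ∀ k, 1 ≤ k → (withOne A k, raiseOp n c k) ∈ intertwiners v := by
  simp only [mem_intertwiners_iff, raiseOp_single_apply hc]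
  refine ⟨fun h k hk lam => ?_, fun h k lam => ?_⟩
  · lift k to ℕ+ using hk
    rw [withOne_coe]
    exact h k lam
  · have := h k k.pos lam
    rwa [withOne_coe] at this

lemma lowers_iff (hc : IsGraded n c) (A : ℕ+ → Module.End Cq V) :
    Lowers c v A ↔ ∀ k, 1 ≤ k → (withOne A k, lowerOp c k) ∈ intertwiners v := by
  simp only [mem_intertwiners_iff, lowerOp_single_apply hc]
  refine ⟨fun h k hk lam => ?_, fun h k lam => ?_⟩
  · lift k to ℕ+ using hk
    rw [withOne_coe]
    exact h k lam
  · have := h k k.pos lam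
    rwa [withOne_coe] at this

variable {H E P : ℕ+ → Module.End Cq V}

theorem pieriRule_iff_murnaghanNakayamaRule (hn : 1 ≤ n) (hrel : SatisfiesRelations H E P) :
    PieriRule n v H ↔ MurnaghanNakayamaRule n v P := by
  rw [PieriRule, MurnaghanNakayamaRule, raises_iff (isGraded_horizontalCoeff n),
    raises_iff (isGraded_borderCoeff hn)]
  refine mem_iff_of_newton (x := fun k => (withOne H k, raiseOp n (horizontalCoeff n) k))
    (y := fun k => (withOne P k, raiseOp n (borderCoeff n) k)) (intertwiners v) ?_ fun k => ?_
  · exact Prod.ext (withOne_zero H)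
      (raiseOp_zero (isGraded_horizontalCoeff n) (horizontalCoeff_zero hn))
  · refine Prod.ext ?_ ?_
    · simp only [Prod.fst_mul, Prod.fst_natCast, Prod.fst_sum, hrel.natCast_mul,
        (hrel.commute_P_H _ _).eq]
    · simp only [Prod.snd_mul, Prod.snd_natCast, Prod.snd_sum, natCast_mul_raiseOp hn]

theorem pieriRule_iff_dualPieriRule (hn : 1 ≤ n) (hrel : SatisfiesRelations H E P) :
    PieriRule n v H ↔ DualPieriRule n v E := by
  rw [PieriRule, DualPieriRule, raises_iff (isGraded_horizontalCoeff n),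
    raises_iff (isGraded_verticalCoeff n)]
  refine mem_iff_of_alternating (x := fun k => (withOne H k, raiseOp n (horizontalCoeff n) k))
    (y := fun k => (withOne E k, raiseOp n (verticalCoeff n) k)) (intertwiners v) ?_ ?_
      fun k hk => ?_
  · exact Prod.ext (withOne_zero H)
      (raiseOp_zero (isGraded_horizontalCoeff n) (horizontalCoeff_zero hn))
  · exact Prod.ext (withOne_zero E)
      (raiseOp_zero (isGraded_verticalCoeff n) (verticalCoeff_zero hn))
  · refine Prod.ext ?_ ?_
    · simp only [Prod.fst_mul, Prod.smul_fst, Prod.fst_sum, Prod.fst_zero,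
        ← (hrel.commute_E_H _ _).eq, hrel.alternating hk]
    · simp only [Prod.snd_mul, Prod.smul_snd, Prod.snd_sum, Prod.snd_zero,
        sum_raiseOp_mul_raiseOp hn hk]

theorem loweringPieriRule_iff_loweringMurnaghanNakayamaRule (hn : 1 ≤ n)
    (hrel : SatisfiesRelations H E P) :
    LoweringPieriRule n v H ↔ LoweringMurnaghanNakayamaRule n v P := by
  rw [LoweringPieriRule, LoweringMurnaghanNakayamaRule, lowers_iff (isGraded_horizontalCoeff n),
    lowers_iff (isGraded_borderCoeff hn)]
  -- The order of the factors is reversed, so the argument takes place in the opposite ring.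
  refine mem_iff_of_newton (K := Cq)
    (x := fun k => MulOpposite.op (withOne H k, lowerOp (horizontalCoeff n) k))
    (y := fun k => MulOpposite.op (withOne P k, lowerOp (borderCoeff n) k))
    (intertwiners v).op ?_ fun k => ?_
  · exact congrArg MulOpposite.op (Prod.ext (withOne_zero H)
      (lowerOp_zero (isGraded_horizontalCoeff n) (horizontalCoeff_zero hn)))
  · simp only [← MulOpposite.op_mul, ← MulOpposite.op_natCast, ← Finset.op_sum]
    rw [(Nat.cast_commute k _).symm.eq]
    refine congrArg MulOpposite.op (Prod.ext ?_ ?_)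
    · simp only [Prod.fst_mul, Prod.fst_natCast, Prod.fst_sum, hrel.natCast_mul]
    · simp only [Prod.snd_mul, Prod.snd_natCast, Prod.snd_sum, natCast_mul_lowerOp hn]

theorem loweringPieriRule_iff_loweringDualPieriRule (hn : 1 ≤ n)
    (hrel : SatisfiesRelations H E P) :
    LoweringPieriRule n v H ↔ LoweringDualPieriRule n v E := by
  rw [LoweringPieriRule, LoweringDualPieriRule, lowers_iff (isGraded_horizontalCoeff n),
    lowers_iff (isGraded_verticalCoeff n)]
  refine mem_iff_of_alternating (K := Cq)
    (x := fun k => MulOpposite.op (withOne H k, lowerOp (horizontalCoeff n) k))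
    (y := fun k => MulOpposite.op (withOne E k, lowerOp (verticalCoeff n) k))
    (intertwiners v).op ?_ ?_ fun k hk => ?_
  · exact congrArg MulOpposite.op (Prod.ext (withOne_zero H)
      (lowerOp_zero (isGraded_horizontalCoeff n) (horizontalCoeff_zero hn)))
  · exact congrArg MulOpposite.op (Prod.ext (withOne_zero E)
      (lowerOp_zero (isGraded_verticalCoeff n) (verticalCoeff_zero hn)))
  · simp only [← MulOpposite.op_mul, ← MulOpposite.op_smul, ← Finset.op_sum]
    rw [← MulOpposite.op_zero]
    refine congrArg MulOpposite.op (Prod.ext ?_ ?_)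
    · simp only [Prod.fst_mul, Prod.smul_fst, Prod.fst_sum, Prod.fst_zero, hrel.alternating hk]
    · simp only [Prod.snd_mul, Prod.smul_snd, Prod.snd_sum, Prod.snd_zero,
        sum_lowerOp_mul_lowerOp hn hk]

end Rules

end RibbonRules

end

theorem mainTheorem6 (n : ℕ) (hn : 1 ≤ n)
    {V : Type*} [AddCommGroup V] [Module RibbonRules.Cq V]
    (H E P : ℕ+ → Module.End RibbonRules.Cq V)
    (hrel : RibbonRules.SatisfiesRelations H E P)
    (v : YoungDiagram → V) :
    ((RibbonRules.PieriRule n v H ∨ RibbonRules.DualPieriRule n v E ∨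
        RibbonRules.MurnaghanNakayamaRule n v P) →
      (RibbonRules.PieriRule n v H ∧ RibbonRules.DualPieriRule n v E ∧
        RibbonRules.MurnaghanNakayamaRule n v P)) ∧
    ((RibbonRules.LoweringPieriRule n v H ∨ RibbonRules.LoweringDualPieriRule n v E ∨
        RibbonRules.LoweringMurnaghanNakayamaRule n v P) →
      (RibbonRules.LoweringPieriRule n v H ∧ RibbonRules.LoweringDualPieriRule n v E ∧
        RibbonRules.LoweringMurnaghanNakayamaRule n v P)) := by
  have aux : ∀ {a b c : Prop}, (a ↔ c) → (a ↔ b) → (a ∨ b ∨ c → a ∧ b ∧ c) := by tauto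
  exact ⟨aux (RibbonRules.pieriRule_iff_murnaghanNakayamaRule hn hrel)
      (RibbonRules.pieriRule_iff_dualPieriRule hn hrel),
    aux (RibbonRules.loweringPieriRule_iff_loweringMurnaghanNakayamaRule hn hrel)
      (RibbonRules.loweringPieriRule_iff_loweringDualPieriRule hn hrel)⟩
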